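/- Let $k$ be a commutative ring with $\mathbb{Q}\subseteq k$, let $A$ be an associative unital $k$-algebra, let $K\subseteq A$ be a (not necessarily commutative) $k$-subalgebra, and let $(E,p,i)$ be a cleft extension of $A$: $E$ is a $k$-algebra and $p\colon E\to A$, $i\colon A\to E$ are morphisms of $k$-algebras with $p\circ i=\mathrm{id}_A$. Put $M=\ker p$ and identify $A$ with $i(A)$, so that $E=A\oplus M$ as $K$-bimodules. For $x,y\in A\cup M$ let $x\triangledown y$ be the product of $E$ if $x,y\in M$ and $0$ otherwise, and let $x\cdot y$ be the product of $E$ if $x\in A$ or $y\in A$, and $0$ if $x,y\in M$; extend both bilinearly to $E$. Notation. For a $k$-algebra $C$ containing $K$, write $\otimes=\otimes_K$, $\overline{C}=C/K$, and $C\otimes\overline{C}^{\otimes n}\otimes$ for the quotient of $C\otimes\overline{C}^{\otimes n}$ by its commutators with $K$. The normalized mixed complex of the $K$-algebra $C$ is $(C\otimes\overline{C}^{\otimes *}\otimes,b,B)$, with $b$ the Hochschild boundary and $B(c_0\otimes\cdots\otimes c_n)=\sum_{j=0}^n(-1)^{jn}\,1\otimes c_j\otimes\cdots\otimes c_n\otimes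 c_0\otimes\cdots\otimes c_{j-1}$. For a mixed complex $(Y,b,B)$, let $\mathrm{BP}$ be the double complex with columns $Yu^j$, $j\in\mathbb{Z}$ ($u$ of degree $2$), with maps $b(yu^j)=b(y)u^j$ and $B(yu^j)=B(y)u^{j-1}$; let $\mathrm{BC}$ be its quotient consisting of the columns with $j\ge 0$ and $\mathrm{BN}$ its subcomplex consisting of the columns with $j\le 0$. The Hochschild, cyclic, periodic and negative homologies of $(Y,b,B)$ are the homologies of $(Y,b)$, $\mathrm{Tot}(\mathrm{BC})$, $\mathrm{Tot}(\mathrm{BP})$ and $\mathrm{Tot}(\mathrm{BN})$, where $\mathrm{Tot}$ is formed with direct products. Let $\mathrm{HH}^K_*(E,M)$, $\mathrm{HC}^K_*(E,M)$, $\mathrm{HP}^K_*(E,M)$ and $\mathrm{HN}^K_*(E,M)$ be these homologies of the kernel of the morphism from the normalized mixed complex of the $K$-algebra $E$ to that of $A$ induced by $p$. The diagram. For $v,w\ge 0$ and $n=v+w$ let $X_{vw}\subseteq E\otimes\overline{E}^{\otimes n}\otimes$ be spanned by the tensors $x_0\otimes\cdots\otimes x_n$ such that $x_0\in M$, exactly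 $w$ of $x_1,\dots,x_n$ lie in $M$, and the others lie in $A$; put $X_{vw}=0$ otherwise. On such tensors let $$b=\sum_{j=0}^{n}\mu_j,\qquad d'=\sum_{j=0}^{n-1}\varrho_j,\qquad d=d'+\varrho_n,\qquad N=\sum_{l=0}^{w}t^l,$$ where, for $0\le j<n$, $\mu_j$ and $\varrho_j$ replace $x_j\otimes x_{j+1}$ by $(-1)^j x_j\cdot x_{j+1}$ and $(-1)^j x_j\triangledown x_{j+1}$, respectively; $\mu_n(x_0\otimes\cdots\otimes x_n)=(-1)^n (x_n\cdot x_0)\otimes x_1\otimes\cdots\otimes x_{n-1}$ and $\varrho_n(x_0\otimes\cdots\otimes x_n)=(-1)^n (x_n\triangledown x_0)\otimes x_1\otimes\cdots\otimes x_{n-1}$; and $t(x_0\otimes\cdots\otimes x_n)=(-1)^{jn}x_j\otimes\cdots\otimes x_n\otimes x_0\otimes\cdots\otimes x_{j-1}$ with $j$ the last index such that $x_j\in M$. Thus $b\colon X_{vw}\to X_{v-1,w}$, $d,d'\colon X_{vw}\to X_{v,w-1}$ and $t,N\colon X_{vw}\to X_{vw}$. Let $\mathcal{X}$ be the triple diagram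 with $X_{vw}$ in position $(u,v,w)$ for all $u\in\mathbb{Z}$, whose face in column $u$ is $(X,b,d)$ for $u$ even and $(X,-b,-d')$ for $u$ odd, and whose map from column $u+1$ to column $u$ is $\mathrm{id}-t$ for $u$ even and $N$ for $u$ odd. Let $\tau^l(\mathcal{X})$ be the subdiagram of the columns $u\le l$, $\tau_0(\mathcal{X})=\mathcal{X}/\tau^{-1}(\mathcal{X})$ and $\tau_0^1(\mathcal{X})=\tau^1(\mathcal{X})/\tau^{-1}(\mathcal{X})$. Theorem. $\mathcal{X}$ is a triple complex (its three differentials have square zero and anticommute). Moreover, for every $n\in\mathbb{Z}$ there are isomorphisms of $k$-modules $$\mathrm{HH}^K_n(E,M)\cong \mathrm{H}_n(\mathrm{Tot}(\tau_0^1(\mathcal{X}))),\qquad \mathrm{HC}^K_n(E,M)\cong \mathrm{H}_n(\mathrm{Tot}(\tau_0(\mathcal{X}))),$$ $$\mathrm{HP}^K_n(E,M)\cong \mathrm{H}_n(\mathrm{Tot}(\mathcal{X})),\qquad \mathrm{HN}^K_n(E,M)\cong \mathrm{H}_n(\mathrm{Tot}(\tau^1(\mathcal{X}))),$$ where $\mathrm{Tot}$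 is the total complex formed with direct products. -/

import Mathlib

open scoped TensorProduct

noncomputable section

namespace Cleft

variable {k C : Type*} [CommRing k] [Ring C] [Algebra k C]

/-- The relations that cut `C ⊗_K C̄ ⊗_K ⋯ ⊗_K C̄ ⊗_K` (one factor `C`, then `n` factors
`C̄ = C / K`, the tensor product being closed up cyclically) out of the `(n + 1)`-fold tensor
power of `C` over `k`: elements of `K` may be moved across each tensor sign, also cyclically from
the last factor to the first one (`j + 1` is computed modulo `n + 1`), and a simple tensor with an
entry of `K` in one of the positions `1, …, n` is zero. -/
def tensorRel (K : Subalgebra k C) (n : ℕ) : Submodule k (⨂[k] _ : Fin (n + 1), C) :=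
  Submodule.span k
    ({z | ∃ (x : Fin (n + 1) → C) (j : Fin (n + 1)) (c : C), c ∈ K ∧
        z = PiTensorProduct.tprod k (Function.update x j (x j * c)) -
          PiTensorProduct.tprod k (Function.update x (j + 1) (c * x (j + 1)))} ∪
      {z | ∃ (x : Fin (n + 1) → C) (j : Fin (n + 1)), j ≠ 0 ∧ x j ∈ K ∧
        z = PiTensorProduct.tprod k x})

/-- `C ⊗ C̄^{⊗ n} ⊗`, where `⊗ = ⊗_K` and `C̄ = C / K`. The ring `K` need not be commutative. -/
abbrev CycTensor (K : Subalgebra k C) (n : ℕ) : Type _ :=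
  (⨂[k] _ : Fin (n + 1), C) ⧸ tensorRel K n

/-- The class `x₀ ⊗ ⋯ ⊗ xₙ` in `C ⊗ C̄^{⊗ n} ⊗`. -/
def cls (K : Subalgebra k C) (n : ℕ) :
    MultilinearMap k (fun _ : Fin (n + 1) => C) (CycTensor K n) :=
  (tensorRel K n).mkQ.compMultilinearMap (PiTensorProduct.tprod k)

section lift
variable {K : Subalgebra k C} {n : ℕ}

lemma cls_update (x : Fin (n + 1) → C) (j : Fin (n + 1)) {c : C} (hc : c ∈ K) :
    cls K n (Function.update x j (x j * c)) =
      cls K n (Function.update x (j + 1) (c * x (j + 1))) := by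
  refine (Submodule.Quotient.eq _).2 (Submodule.subset_span (Or.inl ⟨x, j, c, hc, rfl⟩))

lemma cls_degen (x : Fin (n + 1) → C) {j : Fin (n + 1)} (hj : j ≠ 0) (hx : x j ∈ K) :
    cls K n x = 0 :=
  (Submodule.Quotient.mk_eq_zero _).2 (Submodule.subset_span (Or.inr ⟨x, j, hj, hx, rfl⟩))

lemma cls_balanced (a : Fin (n + 1)) {c : C} (hc : c ∈ K) (x y z : Fin (n + 1) → C)
    (hy : ∀ l, y l = if l = a then x a * c else x l)
    (hz : ∀ l, z l = if l = a + 1 then c * x (a + 1) else x l) :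
    cls K n y = cls K n z := by
  have h1 : y = Function.update x a (x a * c) := by
    funext l; rw [hy, Function.update_apply]
  have h2 : z = Function.update x (a + 1) (c * x (a + 1)) := by
    funext l; rw [hz, Function.update_apply]
  rw [h1, h2, cls_update x a hc]

variable {V : Type*} [AddCommGroup V] [Module k V]

/-- A `k`-multilinear map on `C^{n+1}` that respects the relations of `C ⊗ C̄^{⊗ n} ⊗`. -/
structure Descends (K : Subalgebra k C) (f : MultilinearMap k (fun _ : Fin (n + 1) => C) V) :
    Prop where
  balanced : ∀ (x : Fin (n + 1) → C) (j : Fin (n + 1)) (c : C), c ∈ K →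
    f (Function.update x j (x j * c)) = f (Function.update x (j + 1) (c * x (j + 1)))
  degen : ∀ (x : Fin (n + 1) → C) (j : Fin (n + 1)), j ≠ 0 → x j ∈ K → f x = 0

/-- The linear map on `C ⊗ C̄^{⊗ n} ⊗` given on simple tensors by `f`. -/
def descend (f : MultilinearMap k (fun _ : Fin (n + 1) => C) V) (hf : Descends K f) :
    CycTensor K n →ₗ[k] V :=
  (tensorRel K n).liftQ (PiTensorProduct.lift f) <| by
    refine Submodule.span_le.2 ?_
    rintro z (⟨x, j, c, hc, rfl⟩ | ⟨x, j, hj, hx, rfl⟩)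
    · simp [hf.balanced x j c hc]
    · simp [hf.degen x j hj hx]

@[simp] lemma descend_cls (f : MultilinearMap k (fun _ : Fin (n + 1) => C) V)
    (hf : Descends K f) (x : Fin (n + 1) → C) : descend f hf (cls K n x) = f x := by
  change (PiTensorProduct.lift f) (PiTensorProduct.tprod k x) = f x
  simp

lemma span_cls : Submodule.span k (Set.range (cls K n)) = ⊤ := by
  have h := congrArg (Submodule.map (tensorRel K n).mkQ)
    (PiTensorProduct.span_tprod_eq_top (R := k) (s := fun _ : Fin (n + 1) => C))
  rw [Submodule.map_span, Submodule.map_top, Submodule.range_mkQ, ← Set.range_comp] at h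
  exact h

end lift

section face

/-- `(x₀, …, xₙ₊₁) ↦ (x₀, …, xⱼ₋₁, μ(xⱼ, xⱼ₊₁), xⱼ₊₂, …, xₙ₊₁)`. -/
def contr (μ : C →ₗ[k] C →ₗ[k] C) {n : ℕ} (j : Fin (n + 1)) (x : Fin (n + 2) → C) :
    Fin (n + 1) → C := fun l =>
  if l < j then x l.castSucc else if l = j then μ (x l.castSucc) (x l.succ) else x l.succ

lemma contr_update (μ : C →ₗ[k] C →ₗ[k] C) {n : ℕ} (j : Fin (n + 1)) (x : Fin (n + 2) → C)
    (i : Fin (n + 2)) : ∃ (a : Fin (n + 1)) (f : C →ₗ[k] C),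
      ∀ v, contr μ j (Function.update x i v) = Function.update (contr μ j x) a (f v) := by
  obtain h | h | h | h : (i : ℕ) < j ∨ (i : ℕ) = j ∨ (i : ℕ) = j + 1 ∨ (j : ℕ) + 1 < i := by omega
  · refine ⟨⟨i, by omega⟩, LinearMap.id, fun v => funext fun l => ?_⟩
    simp only [contr, Function.update_apply, Fin.ext_iff, Fin.lt_def, Fin.val_castSucc, Fin.val_succ,
      LinearMap.id_apply]
    grind
  · refine ⟨j, μ.flip (x j.succ), fun v => funext fun l => ?_⟩
    simp only [contr, Function.update_apply, Fin.ext_iff, Fin.lt_def, Fin.val_castSucc, Fin.val_succ,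
      LinearMap.flip_apply]
    grind
  · refine ⟨j, μ (x j.castSucc), fun v => funext fun l => ?_⟩
    simp only [contr, Function.update_apply, Fin.ext_iff, Fin.lt_def, Fin.val_castSucc, Fin.val_succ]
    grind
  · refine ⟨⟨i - 1, by omega⟩, LinearMap.id, fun v => funext fun l => ?_⟩
    simp only [contr, Function.update_apply, Fin.ext_iff, Fin.lt_def, Fin.val_castSucc, Fin.val_succ,
      LinearMap.id_apply]
    grind

/-- `x₀ ⊗ ⋯ ⊗ xₙ₊₁ ↦ x₀ ⊗ ⋯ ⊗ μ(xⱼ, xⱼ₊₁) ⊗ ⋯ ⊗ xₙ₊₁`, as a multilinear map. -/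
def face (K : Subalgebra k C) (μ : C →ₗ[k] C →ₗ[k] C) (n : ℕ) (j : Fin (n + 1)) :
    MultilinearMap k (fun _ : Fin (n + 2) => C) (CycTensor K n) where
  toFun x := cls K n (contr μ j x)
  map_update_add' {inst} x i v w := by
    obtain rfl : inst = instDecidableEqFin _ := Subsingleton.elim _ _
    obtain ⟨a, f, h⟩ := contr_update μ j x i
    rw [h, h, h, map_add, MultilinearMap.map_update_add]
  map_update_smul' {inst} x i c v := by
    obtain rfl : inst = instDecidableEqFin _ := Subsingleton.elim _ _
    obtain ⟨a, f, h⟩ := contr_update μ j x i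
    rw [h, h, map_smul, MultilinearMap.map_update_smul]

/-- `(x₀, …, xₙ) ↦ (xᵢ, …, xₙ, x₀, …, xᵢ₋₁)` -/
def rot {X : Type*} {n : ℕ} (i : Fin (n + 1)) (x : Fin (n + 1) → X) : Fin (n + 1) → X := fun l => x (l + i)

/-- `μ` is a `K`-balanced map of `K`-bimodules which, as soon as one argument is in `K`, is `e` times
the multiplication of `C`. (Only used to check that maps are well defined.) -/
structure IsProd (K : Subalgebra k C) (μ : C →ₗ[k] C →ₗ[k] C) (e : k) : Prop where
  mid : ∀ c ∈ K, ∀ x y, μ (x * c) y = μ x (c * y)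
  left : ∀ c ∈ K, ∀ x y, μ (c * x) y = c * μ x y
  right : ∀ c ∈ K, ∀ x y, μ x (y * c) = μ x y * c
  one_left : ∀ c ∈ K, ∀ y, μ c y = e • (c * y)
  one_right : ∀ c ∈ K, ∀ y, μ y c = e • (y * c)

lemma val_add_one' {n : ℕ} (a : Fin (n + 1)) :
    ((a + 1 : Fin (n + 1)) : ℕ) = if (a : ℕ) = n then 0 else (a : ℕ) + 1 := by
  rw [Fin.val_add_one]; simp [Fin.ext_iff]

lemma exists_nat_ext {X : Type*} {n : ℕ} (x : Fin (n + 1) → X) :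
    ∃ y : ℕ → X, x = fun l : Fin (n + 1) => y l :=
  ⟨fun m => x (Fin.ofNat (n + 1) m), by funext l; simp⟩

lemma face_balanced {K : Subalgebra k C} {μ : C →ₗ[k] C →ₗ[k] C} {e : k} (hμ : IsProd K μ e)
    {n : ℕ} (l : Fin (n + 1)) (x : Fin (n + 2) → C) (j : Fin (n + 2)) (c : C) (hc : c ∈ K) :
    cls K n (contr μ l (Function.update x j (x j * c))) =
      cls K n (contr μ l (Function.update x (j + 1) (c * x (j + 1)))) := by
  have hj := val_add_one' j
  generalize hj' : j + 1 = j' at *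
  obtain ⟨y, rfl⟩ := exists_nat_ext x
  have hl := hμ.left c hc
  have hr := hμ.right c hc
  have hm := hμ.mid c hc
  obtain h | h | h : (j : ℕ) < l ∨ (j : ℕ) = l ∨ (l : ℕ) + 1 ≤ j := by omega
  · have ha := val_add_one' (⟨j, by omega⟩ : Fin (n + 1))
    refine cls_balanced ⟨j, by omega⟩ hc (contr μ l fun l => y l) _ _ (fun m => ?_) (fun m => ?_) <;>
    simp only [contr, Function.update_apply, Fin.ext_iff, Fin.lt_def, Fin.val_castSucc,
        Fin.val_succ, ha, hj] <;> grind
  · congr 1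
    funext m
    simp only [contr, Function.update_apply, Fin.ext_iff, Fin.lt_def, Fin.val_castSucc,
        Fin.val_succ, hj]
    grind
  · have ha := val_add_one' (⟨j - 1, by omega⟩ : Fin (n + 1))
    refine cls_balanced ⟨j - 1, by omega⟩ hc (contr μ l fun l => y l) _ _ (fun m => ?_) (fun m => ?_) <;>
    simp only [contr, Function.update_apply, Fin.ext_iff, Fin.lt_def, Fin.val_castSucc,
        Fin.val_succ, ha, hj] <;> grind

lemma rot_update {X : Type*} {n : ℕ} (i j : Fin (n + 1)) (x : Fin (n + 1) → X) (v : X) :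
    rot i (Function.update x j v) = Function.update (rot i x) (j - i) v := by
  funext l
  simp only [rot, Function.update_apply, eq_sub_iff_add_eq]

lemma rot_face_balanced {K : Subalgebra k C} {μ : C →ₗ[k] C →ₗ[k] C} {e : k} (hμ : IsProd K μ e)
    {n : ℕ} (i : Fin (n + 2)) (l : Fin (n + 1)) (x : Fin (n + 2) → C) (j : Fin (n + 2)) (c : C)
    (hc : c ∈ K) :
    cls K n (contr μ l (rot i (Function.update x j (x j * c)))) =
      cls K n (contr μ l (rot i (Function.update x (j + 1) (c * x (j + 1))))) := by
  have h := face_balanced hμ l (rot i x) (j - i) c hc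
  rw [rot_update, rot_update]
  have h1 : rot i x (j - i) = x j := by simp [rot]
  have h2 : rot i x (j - i + 1) = x (j + 1) := by
    simp only [rot]; congr 1; abel
  rw [h1, h2] at h
  rw [h]; congr 3; abel

/-- The Hochschild type boundary of the product `μ`,
`∑_{j ≤ n} (-1)^j x₀ ⊗ ⋯ ⊗ μ(xⱼ, xⱼ₊₁) ⊗ ⋯ ⊗ xₙ₊₁ + (-1)^{n+1} μ(xₙ₊₁, x₀) ⊗ x₁ ⊗ ⋯ ⊗ xₙ`;
see `hochMul_apply`. -/
def hochMul (K : Subalgebra k C) (μ : C →ₗ[k] C →ₗ[k] C) (n : ℕ) :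
    MultilinearMap k (fun _ : Fin (n + 2) => C) (CycTensor K n) :=
  (∑ j : Fin (n + 1), (-1 : k) ^ (j : ℕ) • face K μ n j) +
    (-1 : k) ^ (n + 1) • (face K μ n 0).domDomCongr (Equiv.addRight (Fin.last (n + 1)))

/-- The sum `∑_{j ≤ n} (-1)^j x₀ ⊗ ⋯ ⊗ μ(xⱼ, xⱼ₊₁) ⊗ ⋯ ⊗ xₙ₊₁`, without the cyclic term. -/
def hochMul' (K : Subalgebra k C) (μ : C →ₗ[k] C →ₗ[k] C) (n : ℕ) :
    MultilinearMap k (fun _ : Fin (n + 2) => C) (CycTensor K n) :=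
  ∑ j : Fin (n + 1), (-1 : k) ^ (j : ℕ) • face K μ n j

lemma hochMul'_apply (K : Subalgebra k C) (μ : C →ₗ[k] C →ₗ[k] C) (n : ℕ) (x : Fin (n + 2) → C) :
    hochMul' K μ n x = ∑ j : Fin (n + 1), (-1 : k) ^ (j : ℕ) • cls K n (contr μ j x) := by
  simp [hochMul', face]

lemma hochMul_apply (K : Subalgebra k C) (μ : C →ₗ[k] C →ₗ[k] C) (n : ℕ) (x : Fin (n + 2) → C) :
    hochMul K μ n x = (∑ j : Fin (n + 1), (-1 : k) ^ (j : ℕ) • cls K n (contr μ j x)) +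
      (-1 : k) ^ (n + 1) • cls K n (contr μ 0 (rot (Fin.last (n + 1)) x)) := by
  simp [hochMul, face]
  rfl

lemma val_add_last {n : ℕ} (a : Fin (n + 1)) :
    ((a + Fin.last n : Fin (n + 1)) : ℕ) = if (a : ℕ) = 0 then n else (a : ℕ) - 1 := by
  rw [Fin.val_add, Fin.val_last]
  split_ifs with h
  · simp [h]
  · rw [show (a : ℕ) + n = (a - 1) + (n + 1) by omega, Nat.add_mod_right, Nat.mod_eq_of_lt]; omega

lemma cls_contr_smul {K : Subalgebra k C} {μ : C →ₗ[k] C →ₗ[k] C} {e : k} {n : ℕ}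
    (l : Fin (n + 1)) (x : Fin (n + 2) → C)
    (h : μ (x l.castSucc) (x l.succ) = e • (x l.castSucc * x l.succ)) :
    cls K n (contr μ l x) = e • cls K n (contr (LinearMap.mul k C) l x) := by
  have h1 : contr (LinearMap.mul k C) l x =
      Function.update (contr μ l x) l (x l.castSucc * x l.succ) := by
    funext m; simp only [contr, Function.update_apply, LinearMap.mul_apply']; grind
  have h2 : contr μ l x = Function.update (contr μ l x) l (e • (x l.castSucc * x l.succ)) := by
    funext m; simp only [contr, Function.update_apply]; grind
  rw [h1, ← MultilinearMap.map_update_smul, ← h2]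

lemma cls_contr_degen {K : Subalgebra k C} (μ : C →ₗ[k] C →ₗ[k] C) {n : ℕ}
    (l : Fin (n + 1)) (x : Fin (n + 2) → C) {j : Fin (n + 2)} (hj : j ≠ 0) (hx : x j ∈ K)
    (h1 : (j : ℕ) ≠ l) (h2 : (j : ℕ) ≠ l + 1) : cls K n (contr μ l x) = 0 := by
  have hj0 : (j : ℕ) ≠ 0 := fun h => hj (Fin.ext h)
  obtain ⟨y, rfl⟩ := exists_nat_ext x
  obtain h | h : (j : ℕ) < l ∨ (l : ℕ) + 1 < j := by omega
  · refine cls_degen _ (j := ⟨j, by omega⟩) (fun h' => hj0 (congrArg Fin.val h')) ?_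
    simpa [contr, Fin.lt_def, h] using hx
  · refine cls_degen _ (j := ⟨j - 1, by omega⟩) (fun h' => by have := congrArg Fin.val h'; simp at this; omega) ?_
    have e1 : ¬ ((j : ℕ) - 1 < l) := by omega
    have e2 : ¬ ((j : ℕ) - 1 = l) := by omega
    have e3 : (j : ℕ) - 1 + 1 = j := by omega
    simpa [contr, Fin.lt_def, Fin.ext_iff, e1, e2, e3] using hx

lemma hochMul'_descends {K : Subalgebra k C} {μ : C →ₗ[k] C →ₗ[k] C} (hμ : IsProd K μ 0)
    (n : ℕ) : Descends K (hochMul' K μ n) where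
  balanced x j c hc := by
    simp only [hochMul'_apply, face_balanced hμ _ x j c hc]
  degen x j hj hx := by
    rw [hochMul'_apply]
    refine Finset.sum_eq_zero fun l _ => ?_
    by_cases h1 : (j : ℕ) = l
    · obtain rfl : j = l.castSucc := Fin.ext h1
      rw [cls_contr_smul l x (hμ.one_left _ hx _), zero_smul, smul_zero]
    by_cases h2 : (j : ℕ) = l + 1
    · obtain rfl : j = l.succ := Fin.ext h2
      rw [cls_contr_smul l x (hμ.one_right _ hx _), zero_smul, smul_zero]
    rw [cls_contr_degen μ l x hj hx h1 h2, smul_zero]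

lemma hochMul_descends {K : Subalgebra k C} {μ : C →ₗ[k] C →ₗ[k] C} {e : k} (hμ : IsProd K μ e)
    (n : ℕ) : Descends K (hochMul K μ n) where
  balanced x j c hc := by
    simp only [hochMul_apply, face_balanced hμ _ x j c hc, rot_face_balanced hμ _ _ x j c hc]
  degen x j hj hx := by
    rw [hochMul_apply]
    have hj0 : (j : ℕ) ≠ 0 := fun h => hj (Fin.ext h)
    obtain ⟨a, rfl⟩ : ∃ a : Fin (n + 1), j = a.succ := ⟨j.pred hj, by simp⟩
    have hA := cls_contr_smul (K := K) a x (hμ.one_right _ hx _)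
    have hrot : ∀ l : Fin (n + 2), rot (Fin.last (n + 1)) x l =
        x (if (l : ℕ) = 0 then Fin.last _ else ⟨l - 1, by omega⟩) := by
      intro l; simp only [rot]; congr 1; apply Fin.ext; rw [val_add_last]; split_ifs <;> rfl
    by_cases ha : (a : ℕ) = n
    · -- the entry is the last one
      obtain rfl : a = Fin.last n := Fin.ext ha
      rw [Finset.sum_eq_single (Fin.last n), hA]
      · have h0 := hrot 0
        have h1 := hrot 1
        simp only [Fin.coe_ofNat_eq_mod, Nat.zero_mod, if_true] at h0
        have hB := cls_contr_smul (K := K) (μ := μ) (e := e) 0 (rot (Fin.last (n + 1)) x) (by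
          rw [Fin.castSucc_zero, h0]; exact hμ.one_left _ hx _)
        rw [hB]
        have : cls K n (contr (LinearMap.mul k C) (Fin.last n) x) =
            cls K n (contr (LinearMap.mul k C) 0 (rot (Fin.last (n + 1)) x)) := by
          have hv := val_add_one' (Fin.last n)
          refine cls_balanced (Fin.last n) hx (fun l => x l.castSucc) _ _ (fun m => ?_) (fun m => ?_)
          · have := m.2
            simp only [contr, LinearMap.mul_apply']
            split_ifs with h1 h2
            · exact absurd h1 (by simp [h2])
            · rfl
            · rw [‹m = _›]
            · exact absurd (Fin.le_last m) (by rw [not_le]; exact lt_of_le_of_ne (not_lt.1 ‹_›) (Ne.symm ‹_›))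
          · simp only [contr, LinearMap.mul_apply', hrot]
            obtain ⟨y, rfl⟩ := exists_nat_ext x
            simp only [Fin.lt_def, Fin.ext_iff, Fin.val_succ, Fin.val_castSucc, hv, Fin.val_last,
              Fin.val_zero, if_true]
            grind
        rw [this, Fin.val_last, ← add_smul, pow_succ]
        simp
      · intro l _ hl
        rw [cls_contr_degen μ l x hj hx _ _, smul_zero]
        · have := l.2; simp only [Fin.val_succ, Fin.val_last]; omega
        · have hl' : (l : ℕ) ≠ n := fun h => hl (Fin.ext h)
          simp only [Fin.val_succ, Fin.val_last]; omega
      · simp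
    · -- an interior entry
      have ha' : (a : ℕ) + 1 < n + 1 := by omega
      obtain ⟨b, hb⟩ : ∃ b : Fin (n + 1), (b : ℕ) = a + 1 := ⟨⟨a + 1, ha'⟩, rfl⟩
      have hba : b.castSucc = a.succ := Fin.ext hb
      have hB := cls_contr_smul (K := K) (μ := μ) (e := e) b x (by
          rw [hba]; exact hμ.one_left _ hx _)
      have hw : cls K n (contr μ 0 (rot (Fin.last (n + 1)) x)) = 0 := by
        refine cls_degen _ (j := b) (fun h => by rw [h] at hb; simp at hb) ?_
        have hb0 : ¬ (b < 0) := by simp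
        have hb1 : b ≠ 0 := fun h => by rw [h] at hb; simp at hb
        simp only [contr, hb0, hb1, if_false, hrot]
        rw [if_neg (by simp)]
        convert hx using 2
        exact Fin.ext (by simpa using hb)
      have hab : a ≠ b := fun h => by rw [h] at hb; omega
      rw [hw, smul_zero, add_zero, Finset.sum_eq_add a b hab, hA, hB]
      · have : cls K n (contr (LinearMap.mul k C) a x) =
            cls K n (contr (LinearMap.mul k C) b x) := by
          have hv := val_add_one' a
          refine cls_balanced a hx
            (fun l => if l ≤ a then x l.castSucc else x l.succ) _ _ (fun m => ?_) (fun m => ?_) <;>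
          · obtain ⟨y, rfl⟩ := exists_nat_ext x
            simp only [contr, LinearMap.mul_apply', Fin.lt_def, Fin.ext_iff, Fin.val_succ,
              Fin.val_castSucc, hv, hb, Fin.le_def]
            grind
        rw [this, hb, ← add_smul, pow_succ]
        simp
      · intro l _ hl
        have h1 : (l : ℕ) ≠ a := fun h => hl.1 (Fin.ext h)
        have h2 : (l : ℕ) ≠ b := fun h => hl.2 (Fin.ext h)
        rw [cls_contr_degen μ l x hj hx _ _, smul_zero]
        · simp only [Fin.val_succ]; omega
        · simp only [Fin.val_succ]; omega
      · simp
      · simp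

end face

section normalized

/-- `x₀ ⊗ ⋯ ⊗ xₙ ↦ ∑ᵢ (-1)^{i n} 1 ⊗ xᵢ ⊗ ⋯ ⊗ xₙ ⊗ x₀ ⊗ ⋯ ⊗ xᵢ₋₁`; see `connesMul_apply`. -/
def connesMul (K : Subalgebra k C) (n : ℕ) :
    MultilinearMap k (fun _ : Fin (n + 1) => C) (CycTensor K (n + 1)) :=
  ∑ i : Fin (n + 1), (-1 : k) ^ ((i : ℕ) * n) •
    ((cls K (n + 1)).curryLeft 1).domDomCongr (Equiv.addRight i)

lemma connesMul_apply (K : Subalgebra k C) (n : ℕ) (x : Fin (n + 1) → C) :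
    connesMul K n x = ∑ i : Fin (n + 1), (-1 : k) ^ ((i : ℕ) * n) •
      cls K (n + 1) (Fin.cons 1 (rot i x)) := by
  simp [connesMul]
  rfl

lemma cons_one_balanced {K : Subalgebra k C} {n : ℕ} (y : Fin (n + 1) → C) (j : Fin (n + 1))
    (c : C) (hc : c ∈ K) :
    cls K (n + 1) (Fin.cons 1 (Function.update y j (y j * c))) =
      cls K (n + 1) (Fin.cons 1 (Function.update y (j + 1) (c * y (j + 1)))) := by
  have key : ∀ (a : Fin (n + 2)), cls K (n + 1) (Function.update (Fin.cons 1 y : Fin (n + 2) → C) a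
      ((Fin.cons 1 y : Fin (n + 2) → C) a * c)) = _ := fun a => cls_update _ a hc
  by_cases hj : j = Fin.last n
  · subst hj
    have h1 := key (Fin.last (n + 1))
    have h2 := key 0
    rw [Fin.last_add_one] at h1 ⊢
    rw [← Fin.succ_last, Fin.cons_succ, ← Fin.cons_update] at h1
    rw [h1]
    simp only [Fin.cons_zero, one_mul, mul_one] at h2 ⊢
    rw [h2, zero_add, ← Fin.succ_zero_eq_one, Fin.cons_succ, Fin.cons_update]
  · have h1 := key j.succ
    have h3 : j.succ + 1 = (j + 1).succ := by
      apply Fin.ext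
      have : (j : ℕ) ≠ n := fun h => hj (Fin.ext h)
      rw [val_add_one', Fin.val_succ, Fin.val_succ, val_add_one', if_neg this, if_neg (by omega)]
    rw [h3, Fin.cons_succ, Fin.cons_succ, ← Fin.cons_update, ← Fin.cons_update] at h1
    exact h1

lemma connesMul_descends (K : Subalgebra k C) (n : ℕ) : Descends K (connesMul K n) where
  balanced x j c hc := by
    simp only [connesMul_apply]
    refine Finset.sum_congr rfl fun i _ => ?_
    congr 1
    have h := cons_one_balanced (rot i x) (j - i) c hc
    have h1 : rot i x (j - i) = x j := by simp [rot]
    have h2 : rot i x (j - i + 1) = x (j + 1) := by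
      simp only [rot]; congr 1; abel
    rw [h1, h2] at h
    rw [rot_update, rot_update, h]; congr 3; abel
  degen x j hj hx := by
    rw [connesMul_apply]
    refine Finset.sum_eq_zero fun i _ => ?_
    rw [cls_degen _ (Fin.succ_ne_zero (j - i)), smul_zero]
    simpa [rot] using hx

lemma isProd_mul (K : Subalgebra k C) : IsProd K (LinearMap.mul k C) 1 where
  mid c _ x y := by simp [mul_assoc]
  left c _ x y := by simp [mul_assoc]
  right c _ x y := by simp [mul_assoc]
  one_left c _ y := by simp
  one_right c _ y := by simp

/-- A graded `k`-module `(Xₙ)_{n ≥ 0}` with maps `b` of degree `-1` and `B` of degree `+1`. It is a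
mixed complex if `b² = 0`, `B² = 0` and `bB + Bb = 0`. -/
structure MixedDiagram (k : Type*) [CommRing k] where
  X : ℕ → Type*
  [addCommGroup : ∀ n, AddCommGroup (X n)]
  [module : ∀ n, Module k (X n)]
  b : ∀ n, X (n + 1) →ₗ[k] X n
  B : ∀ n, X n →ₗ[k] X (n + 1)

attribute [instance] MixedDiagram.addCommGroup MixedDiagram.module

/-- The Hochschild boundary of the normalized mixed complex of the `K`-algebra `C`. -/
def hochschild (K : Subalgebra k C) (n : ℕ) : CycTensor K (n + 1) →ₗ[k] CycTensor K n :=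
  descend (hochMul K (LinearMap.mul k C) n) (hochMul_descends (isProd_mul K) n)

/-- The Connes operator of the normalized mixed complex of the `K`-algebra `C`. -/
def connes (K : Subalgebra k C) (n : ℕ) : CycTensor K n →ₗ[k] CycTensor K (n + 1) :=
  descend (connesMul K n) (connesMul_descends K n)

variable {D : Type*} [Ring D] [Algebra k D]

/-- The multilinear form of the map induced by `f`. -/
def mapMul (L : Subalgebra k D) (f : C →ₐ[k] D) (n : ℕ) :
    MultilinearMap k (fun _ : Fin (n + 1) => C) (CycTensor L n) :=
  (cls L n).compLinearMap fun _ => f.toLinearMap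

lemma mapMul_descends {K : Subalgebra k C} {L : Subalgebra k D} (f : C →ₐ[k] D)
    (hf : ∀ c ∈ K, f c ∈ L) (n : ℕ) : Descends K (mapMul L f n) where
  balanced x j c hc := by
    refine cls_balanced j (hf c hc) (fun l => f (x l)) _ _ (fun l => ?_) (fun l => ?_) <;>
    · simp only [AlgHom.toLinearMap_apply, Function.update_apply]
      split_ifs <;> simp
  degen x j hj hx := cls_degen _ hj (hf _ hx)

/-- The map `C ⊗ C̄^{⊗ n} ⊗ → D ⊗ D̄^{⊗ n} ⊗` induced by `f : C → D`. -/
def mapCyc {K : Subalgebra k C} {L : Subalgebra k D} (f : C →ₐ[k] D)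
    (hf : ∀ c ∈ K, f c ∈ L) (n : ℕ) : CycTensor K n →ₗ[k] CycTensor L n :=
  descend (mapMul L f n) (mapMul_descends f hf n)

lemma cyc_hom_ext {K : Subalgebra k C} {n : ℕ} {V : Type*} [AddCommGroup V] [Module k V]
    {f g : CycTensor K n →ₗ[k] V} (h : ∀ x, f (cls K n x) = g (cls K n x)) : f = g := by
  refine LinearMap.ext_on (span_cls (K := K) (n := n)) ?_
  rintro _ ⟨x, rfl⟩
  exact h x

lemma mapCyc_cls {K : Subalgebra k C} {L : Subalgebra k D} (f : C →ₐ[k] D)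
    (hf : ∀ c ∈ K, f c ∈ L) (n : ℕ) (x : Fin (n + 1) → C) :
    mapCyc f hf n (cls K n x) = cls L n (fun l => f (x l)) := by
  rw [mapCyc, descend_cls]; rfl

lemma mapCyc_b {K : Subalgebra k C} {L : Subalgebra k D} (f : C →ₐ[k] D)
    (hf : ∀ c ∈ K, f c ∈ L) (n : ℕ) :
    mapCyc f hf n ∘ₗ hochschild K n = hochschild L n ∘ₗ mapCyc f hf (n + 1) := by
  refine cyc_hom_ext fun x => ?_
  have h : ∀ (j : Fin (n + 1)) (x : Fin (n + 2) → C),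
      (fun l => f (contr (LinearMap.mul k C) j x l)) =
        contr (LinearMap.mul k D) j (fun l => f (x l)) := by
    intro j x; funext l; simp only [contr]; split_ifs <;> simp
  simp only [LinearMap.comp_apply, hochschild, descend_cls, mapCyc_cls, hochMul_apply,
    map_add, map_sum, map_smul, h]
  rfl

lemma mapCyc_B {K : Subalgebra k C} {L : Subalgebra k D} (f : C →ₐ[k] D)
    (hf : ∀ c ∈ K, f c ∈ L) (n : ℕ) :
    mapCyc f hf (n + 1) ∘ₗ connes K n = connes L n ∘ₗ mapCyc f hf n := by
  refine cyc_hom_ext fun x => ?_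
  have h : ∀ (x : Fin (n + 1) → C), (fun l => f ((Fin.cons 1 x : Fin (n + 2) → C) l)) =
        (Fin.cons 1 (fun l => f (x l)) : Fin (n + 2) → D) := by
    intro x; funext l; refine Fin.cases ?_ (fun l => ?_) l <;> simp
  simp only [LinearMap.comp_apply, connes, descend_cls, mapCyc_cls, connesMul_apply,
    map_sum, map_smul, h]
  rfl

/-- The kernel of the morphism of normalized mixed complexes
`(C ⊗ C̄^{⊗ *} ⊗, b, B) → (D ⊗ D̄^{⊗ *} ⊗, b, B)` induced by `f`. -/
def relativeMixed {K : Subalgebra k C} {L : Subalgebra k D} (f : C →ₐ[k] D)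
    (hf : ∀ c ∈ K, f c ∈ L) : MixedDiagram k where
  X n := LinearMap.ker (mapCyc f hf n)
  b n := (hochschild K n).restrict fun z hz => by
    rw [LinearMap.mem_ker] at hz ⊢
    have := LinearMap.congr_fun (mapCyc_b f hf n) z
    simpa [hz] using this
  B n := (connes K n).restrict fun z hz => by
    rw [LinearMap.mem_ker] at hz ⊢
    have := LinearMap.congr_fun (mapCyc_B f hf n) z
    simpa [hz] using this

end normalized

section homology

/-- The homology `ker g / im f` at the middle of `f : U → V`, `g : V → W`. -/
abbrev Homology {U V W : Type*} [AddCommGroup U] [AddCommGroup V] [AddCommGroup W] [Module k U]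
    [Module k V] [Module k W] (f : U →ₗ[k] V) (g : V →ₗ[k] W) : Type _ :=
  LinearMap.ker g ⧸ (LinearMap.range f).submoduleOf (LinearMap.ker g)

namespace MixedDiagram

variable (𝓜 : MixedDiagram k) (S : Set ℤ)

/-- The pairs `(i, q)` with `i ∈ S` for which `X_q uⁱ` has total degree `n`. -/
abbrev TotIdx (S : Set ℤ) (n : ℤ) : Type := {i : ℤ × ℕ // i.1 ∈ S ∧ 2 * i.1 + i.2 = n}

/-- The degree `n` part `∏_{i ∈ S} X_{n - 2i} uⁱ` of the total complex of the double complex that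
consists of the columns `X uⁱ`, `i ∈ S`, of `BP(X, b, B)`. -/
abbrev Tot (n : ℤ) : Type _ := ∀ i : TotIdx S n, 𝓜.X i.1.2

open Classical in
/-- The component of the differential that comes from `B(x uⁱ⁺¹) = B(x) uⁱ`. -/
def totB {n m : ℤ} (h : m + 1 = n) : ∀ i : TotIdx S m, 𝓜.Tot S n →ₗ[k] 𝓜.X i.1.2
  | ⟨(_, 0), _⟩ => 0
  | ⟨(i, q + 1), hi⟩ =>
    if hS : i + 1 ∈ S then
      𝓜.B q ∘ₗ LinearMap.proj (φ := fun i : TotIdx S n => 𝓜.X i.1.2)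
        ⟨(i + 1, q), hS, by have := hi.2; push_cast at this ⊢; omega⟩
    else 0

/-- The differential `b + B`, where `b(x uⁱ) = b(x) uⁱ` and `B(x uⁱ⁺¹) = B(x) uⁱ`, the latter being
zero if one of the two columns has been deleted. -/
def totD {n m : ℤ} (h : m + 1 = n) : 𝓜.Tot S n →ₗ[k] 𝓜.Tot S m :=
  LinearMap.pi fun i =>
    𝓜.b i.1.2 ∘ₗ LinearMap.proj (φ := fun i : TotIdx S n => 𝓜.X i.1.2)
      ⟨(i.1.1, i.1.2 + 1), i.2.1, by have := i.2.2; push_cast; omega⟩ +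
    𝓜.totB S h i

/-- The homology in degree `n` of the total complex of the columns in `S`. -/
abbrev H (n : ℤ) : Type _ :=
  Homology (𝓜.totD S (n := n + 1) (m := n) rfl) (𝓜.totD S (n := n) (m := n - 1) (by omega))

/-- Hochschild homology: the homology of `(X, b)`, the column `u⁰`. -/
abbrev HH (n : ℤ) : Type _ := 𝓜.H {0} n
/-- Cyclic homology: the columns `uⁱ` with `i ≥ 0`, which form `BC`. -/
abbrev HC (n : ℤ) : Type _ := 𝓜.H (Set.Ici 0) n
/-- Periodic homology: all columns, which form `BP`. -/
abbrev HP (n : ℤ) : Type _ := 𝓜.H Set.univ n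
/-- Negative homology: the columns `uⁱ` with `i ≤ 0`, which form `BN`. -/
abbrev HN (n : ℤ) : Type _ := 𝓜.H (Set.Iic 0) n

end MixedDiagram

/-- A triple diagram of `k`-modules `X u v w` with `u ∈ ℤ` and `v, w ≥ 0` (the modules with `v < 0` or
`w < 0` being zero), and maps `dh`, `dv`, `dd` that lower `u`, `v`, `w` by one, respectively.
The maps are indexed by their target. -/
structure TripleDiagram (k : Type*) [CommRing k] where
  X : ℤ → ℕ → ℕ → Type*
  [addCommGroup : ∀ u v w, AddCommGroup (X u v w)]
  [module : ∀ u v w, Module k (X u v w)]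
  dh : ∀ u v w, X (u + 1) v w →ₗ[k] X u v w
  dv : ∀ u v w, X u (v + 1) w →ₗ[k] X u v w
  dd : ∀ u v w, X u v (w + 1) →ₗ[k] X u v w

attribute [instance] TripleDiagram.addCommGroup TripleDiagram.module

namespace TripleDiagram

variable (𝓧 : TripleDiagram k)

/-- The three maps have square zero and anticommute. -/
structure IsTripleComplex : Prop where
  dh_dh : ∀ u v w, 𝓧.dh u v w ∘ₗ 𝓧.dh (u + 1) v w = 0
  dv_dv : ∀ u v w, 𝓧.dv u v w ∘ₗ 𝓧.dv u (v + 1) w = 0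
  dd_dd : ∀ u v w, 𝓧.dd u v w ∘ₗ 𝓧.dd u v (w + 1) = 0
  dh_dv : ∀ u v w, 𝓧.dh u v w ∘ₗ 𝓧.dv (u + 1) v w + 𝓧.dv u v w ∘ₗ 𝓧.dh u (v + 1) w = 0
  dh_dd : ∀ u v w, 𝓧.dh u v w ∘ₗ 𝓧.dd (u + 1) v w + 𝓧.dd u v w ∘ₗ 𝓧.dh u v (w + 1) = 0
  dv_dd : ∀ u v w, 𝓧.dv u v w ∘ₗ 𝓧.dd u (v + 1) w + 𝓧.dd u v w ∘ₗ 𝓧.dv u v (w + 1) = 0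

/-- The triples of total degree `n`. -/
abbrev TotIdx (n : ℤ) : Type := {i : ℤ × ℕ × ℕ // i.1 + i.2.1 + i.2.2 = n}

/-- The degree `n` part `∏_{u + v + w = n} X u v w` of the total complex. -/
abbrev Tot (n : ℤ) : Type _ := ∀ i : TotIdx n, 𝓧.X i.1.1 i.1.2.1 i.1.2.2

/-- The projection of the total complex to one component. -/
abbrev totProj {n : ℤ} (u : ℤ) (v w : ℕ) (h : u + v + w = n) : 𝓧.Tot n →ₗ[k] 𝓧.X u v w :=
  LinearMap.proj (φ := fun i : TotIdx n => 𝓧.X i.1.1 i.1.2.1 i.1.2.2) ⟨(u, v, w), h⟩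

/-- The differential `dh + dv + dd` of the total complex. -/
def totD {n m : ℤ} (h : m + 1 = n) : 𝓧.Tot n →ₗ[k] 𝓧.Tot m :=
  LinearMap.pi fun ⟨(u, v, w), hi⟩ =>
    𝓧.dh u v w ∘ₗ 𝓧.totProj (u + 1) v w (by simp only at hi; omega) +
    𝓧.dv u v w ∘ₗ 𝓧.totProj u (v + 1) w (by simp only at hi; push_cast; omega) +
    𝓧.dd u v w ∘ₗ 𝓧.totProj u v (w + 1) (by simp only at hi; push_cast; omega)

/-- The homology of the total complex in degree `n`. -/
abbrev H (n : ℤ) : Type _ :=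
  Homology (𝓧.totD (n := n + 1) (m := n) rfl) (𝓧.totD (n := n) (m := n - 1) (by omega))

/-- `X u v w` if `u ∈ S`, and zero otherwise. -/
def truncMod (S : Set ℤ) (u : ℤ) (v w : ℕ) : Submodule k (𝓧.X u v w) where
  carrier := {x | u ∉ S → x = 0}
  add_mem' hx hy hu := by rw [hx hu, hy hu, add_zero]
  zero_mem' _ := rfl
  smul_mem' c x hx hu := by rw [hx hu, smul_zero]

open Classical in
/-- The map induced by `f`; zero if the target lies in a deleted column. -/
def truncMap (S : Set ℤ) {u u' : ℤ} {v v' w w' : ℕ} (f : 𝓧.X u v w →ₗ[k] 𝓧.X u' v' w') :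
    𝓧.truncMod S u v w →ₗ[k] 𝓧.truncMod S u' v' w' :=
  LinearMap.codRestrict _ (if u' ∈ S then f ∘ₗ (𝓧.truncMod S u v w).subtype else 0)
    fun x hu => by simp [hu]

/-- The diagram obtained by deleting the columns whose index `u` is not in `S`. For `S = {u ≤ l}` this
is the subdiagram `τ^l`, for `S = {u ≥ 0}` the quotient `τ_0` of the diagram by `τ^{-1}`, and for
`S = {0, 1}` the quotient `τ_0^1` of `τ^1` by `τ^{-1}`. -/
def trunc (S : Set ℤ) : TripleDiagram k where
  X u v w := 𝓧.truncMod S u v w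
  dh u v w := 𝓧.truncMap S (𝓧.dh u v w)
  dv u v w := 𝓧.truncMap S (𝓧.dv u v w)
  dd u v w := 𝓧.truncMap S (𝓧.dd u v w)

end TripleDiagram
end homology

/-- A cleft extension of the `k`-algebra `A`: a `k`-algebra `E` with morphisms of `k`-algebras
`p : E → A` and `i : A → E` such that `p ∘ i = id`. Then `E` is the direct sum of `i(A)`, a copy of
`A`, and of `M = ker p`, an `A`-bimodule through `i`, and the product `M × M → M` of `E` is the
associative `A`-bimodule map `m ⊗ m' ↦ m ▽ m'` with `E = A ⋉_▽ M`. -/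
structure CleftExtension (k A E : Type*) [CommRing k] [Ring A] [Algebra k A] [Ring E]
    [Algebra k E] where
  p : E →ₐ[k] A
  i : A →ₐ[k] E
  p_i : ∀ a, p (i a) = a

namespace CleftExtension

variable {A E : Type*} [Ring A] [Algebra k A] [Ring E] [Algebra k E]
  (𝓔 : CleftExtension k A E) (K : Subalgebra k A)

/-- The subalgebra `K` of `A`, viewed as a subalgebra of `E`. -/
abbrev base : Subalgebra k E := K.map 𝓔.i

/-- `M = ker p`. -/
abbrev M : Submodule k E := LinearMap.ker 𝓔.p.toLinearMap

/-- The copy `i(A)` of `A` in `E`. -/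
abbrev copyA : Submodule k E := LinearMap.range 𝓔.i.toLinearMap

lemma p_base : ∀ c ∈ 𝓔.base K, 𝓔.p c ∈ K := by
  rintro _ ⟨a, ha, rfl⟩
  exact (𝓔.p_i a).symm ▸ ha

/-- The mixed complex `ker ((E ⊗ Ē^{⊗ *} ⊗, b, B) → (A ⊗ Ā^{⊗ *} ⊗, b, B))`, whose homologies are those
of the `K`-algebra `E` relative to `M`; here `E / M` is identified with `A` by means of `p`. -/
def relMixed : MixedDiagram k := relativeMixed 𝓔.p (𝓔.p_base K)

/-- The projection of `E` onto `i(A)` along `M`. -/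
def piA : E →ₗ[k] E := 𝓔.i.toLinearMap ∘ₗ 𝓔.p.toLinearMap

/-- The projection of `E` onto `M` along `i(A)`. -/
def piM : E →ₗ[k] E := LinearMap.id - 𝓔.piA

/-- The bilinear map `x ▽ y` of `E`: the product of `E` if `x, y ∈ M`, and zero if `x ∈ A` or `y ∈ A`. -/
def tri : E →ₗ[k] E →ₗ[k] E := (LinearMap.mul k E).compl₁₂ 𝓔.piM 𝓔.piM

/-- The bilinear product `xy` of `E` that is the product of `E` if `x ∈ A` or `y ∈ A`, and zero if
`x, y ∈ M`. -/
def dot : E →ₗ[k] E →ₗ[k] E := LinearMap.mul k E - 𝓔.tri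

lemma piA_apply (x : E) : 𝓔.piA x = 𝓔.i (𝓔.p x) := rfl

lemma piM_apply (x : E) : 𝓔.piM x = x - 𝓔.i (𝓔.p x) := rfl

lemma tri_apply (x y : E) : 𝓔.tri x y = 𝓔.piM x * 𝓔.piM y := rfl

lemma dot_apply (x y : E) : 𝓔.dot x y = x * y - 𝓔.piM x * 𝓔.piM y := rfl

variable {K} in
lemma piA_of_mem {c : E} (hc : c ∈ 𝓔.base K) : 𝓔.piA c = c := by
  obtain ⟨a, -, rfl⟩ := hc
  exact congrArg 𝓔.i (𝓔.p_i a)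

lemma piA_mul (x y : E) : 𝓔.piA (x * y) = 𝓔.piA x * 𝓔.piA y := by simp [piA_apply]

variable {K} in
lemma piM_of_mem {c : E} (hc : c ∈ 𝓔.base K) : 𝓔.piM c = 0 := by
  rw [piM, LinearMap.sub_apply, 𝓔.piA_of_mem hc, LinearMap.id_apply, sub_self]

variable {K} in
lemma piM_mul_right {c : E} (hc : c ∈ 𝓔.base K) (x : E) : 𝓔.piM (x * c) = 𝓔.piM x * c := by
  simp only [piM, LinearMap.sub_apply, piA_mul, 𝓔.piA_of_mem hc, LinearMap.id_apply, sub_mul]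

variable {K} in
lemma piM_mul_left {c : E} (hc : c ∈ 𝓔.base K) (x : E) : 𝓔.piM (c * x) = c * 𝓔.piM x := by
  simp only [piM, LinearMap.sub_apply, piA_mul, 𝓔.piA_of_mem hc, LinearMap.id_apply, mul_sub]

lemma isProd_tri : IsProd (𝓔.base K) 𝓔.tri 0 where
  mid c hc x y := by simp [tri_apply, 𝓔.piM_mul_left hc, 𝓔.piM_mul_right hc, mul_assoc]
  left c hc x y := by simp [tri_apply, 𝓔.piM_mul_left hc, mul_assoc]
  right c hc x y := by simp [tri_apply, 𝓔.piM_mul_right hc, mul_assoc]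
  one_left c hc y := by simp [tri_apply, 𝓔.piM_of_mem hc]
  one_right c hc y := by simp [tri_apply, 𝓔.piM_of_mem hc]

lemma isProd_dot : IsProd (𝓔.base K) 𝓔.dot 1 where
  mid c hc x y := by simp [dot_apply, 𝓔.piM_mul_left hc, 𝓔.piM_mul_right hc, mul_assoc]
  left c hc x y := by simp [dot_apply, 𝓔.piM_mul_left hc, mul_assoc, mul_sub]
  right c hc x y := by simp [dot_apply, 𝓔.piM_mul_right hc, mul_assoc, sub_mul]
  one_left c hc y := by simp [dot_apply, 𝓔.piM_of_mem hc]
  one_right c hc y := by simp [dot_apply, 𝓔.piM_of_mem hc]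

/-- `b = ∑_{j ≤ n} μⱼ`, formed with the product `dot`. -/
def b (n : ℕ) : CycTensor (𝓔.base K) (n + 1) →ₗ[k] CycTensor (𝓔.base K) n :=
  descend (hochMul (𝓔.base K) 𝓔.dot n) (hochMul_descends (𝓔.isProd_dot K) n)

/-- `d = ∑_{j ≤ n} ϱⱼ`, formed with the product `tri`. -/
def d (n : ℕ) : CycTensor (𝓔.base K) (n + 1) →ₗ[k] CycTensor (𝓔.base K) n :=
  descend (hochMul (𝓔.base K) 𝓔.tri n) (hochMul_descends (𝓔.isProd_tri K) n)

/-- The sum `∑_{j < n} ϱⱼ`. -/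
def d' (n : ℕ) : CycTensor (𝓔.base K) (n + 1) →ₗ[k] CycTensor (𝓔.base K) n :=
  descend (hochMul' (𝓔.base K) 𝓔.tri n) (hochMul'_descends (𝓔.isProd_tri K) n)

/-- The maps whose tensor product over `l` selects the tensors such that the last entry in `M` is the
`i`-th one: the projection to `M` at `l = i`, the projection to `A` for `l > i`. -/
def lastProj {n : ℕ} (i l : Fin (n + 1)) : E →ₗ[k] E :=
  if l < i then LinearMap.id else if l = i then 𝓔.piM else 𝓔.piA

/-- The multilinear form of `t`. A simple tensor with entries in `A ∪ M`, not all of them in `A`, is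
mapped to `(-1)^{i n} xᵢ ⊗ ⋯ ⊗ xₙ ⊗ x₀ ⊗ ⋯ ⊗ xᵢ₋₁`, where `i` is the last index with `xᵢ ∈ M`: only
this one of the summands is different from zero. -/
def tMul (n : ℕ) : MultilinearMap k (fun _ : Fin (n + 1) => E) (CycTensor (𝓔.base K) n) :=
  ∑ i : Fin (n + 1), (-1 : k) ^ ((i : ℕ) * n) •
    ((cls (𝓔.base K) n).domDomCongr (Equiv.addRight i)).compLinearMap fun l => 𝓔.lastProj i l

lemma tMul_apply (n : ℕ) (x : Fin (n + 1) → E) :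
    𝓔.tMul K n x = ∑ i : Fin (n + 1), (-1 : k) ^ ((i : ℕ) * n) •
      cls (𝓔.base K) n (rot i fun l => 𝓔.lastProj i l (x l)) := by
  simp [tMul]
  rfl

variable {K} in
lemma lastProj_mul_right {n : ℕ} (i l : Fin (n + 1)) {c : E} (hc : c ∈ 𝓔.base K) (x : E) :
    𝓔.lastProj i l (x * c) = 𝓔.lastProj i l x * c := by
  unfold lastProj
  split_ifs
  · rfl
  · exact 𝓔.piM_mul_right hc x
  · rw [piA_mul, 𝓔.piA_of_mem hc]

variable {K} in
lemma lastProj_mul_left {n : ℕ} (i l : Fin (n + 1)) {c : E} (hc : c ∈ 𝓔.base K) (x : E) :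
    𝓔.lastProj i l (c * x) = c * 𝓔.lastProj i l x := by
  unfold lastProj
  split_ifs
  · rfl
  · exact 𝓔.piM_mul_left hc x
  · rw [piA_mul, 𝓔.piA_of_mem hc]

lemma tMul_descends (n : ℕ) : Descends (𝓔.base K) (𝓔.tMul K n) where
  balanced x j c hc := by
    simp only [tMul_apply]
    refine Finset.sum_congr rfl fun i _ => ?_
    congr 1
    refine cls_balanced (j - i) hc (rot i fun l => 𝓔.lastProj i l (x l)) _ _
      (fun l => ?_) (fun l => ?_)
    · simp only [rot, Function.update_apply, ← eq_sub_iff_add_eq]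
      split_ifs with h
      · rw [𝓔.lastProj_mul_right i _ hc, h, sub_add_cancel]
      · rfl
    · have e : j - i + 1 + i = j + 1 := by abel
      have e' : l + i = j + 1 ↔ l = j - i + 1 := by rw [← e]; simp
      simp only [rot, Function.update_apply, e, e']
      split_ifs with h
      · rw [𝓔.lastProj_mul_left i _ hc, h, e]
      · rfl
  degen x j hj hx := by
    rw [tMul_apply]
    refine Finset.sum_eq_zero fun i _ => ?_
    by_cases hij : j = i
    · subst hij
      rw [(cls (𝓔.base K) n).map_coord_zero 0, smul_zero]
      simp [rot, lastProj, 𝓔.piM_of_mem hx]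
    · rw [cls_degen _ (sub_ne_zero.2 hij), smul_zero]
      simp only [rot, sub_add_cancel, lastProj, if_neg hij]
      split_ifs
      · exact hx
      · rw [𝓔.piA_of_mem hx]; exact hx

/-- The map `t`. -/
def t (n : ℕ) : CycTensor (𝓔.base K) n →ₗ[k] CycTensor (𝓔.base K) n :=
  descend (𝓔.tMul K n) (𝓔.tMul_descends K n)

/-- `M ⊗ B^n_w ⊗ ⊆ E ⊗ Ē^{⊗ n} ⊗`, spanned by the tensors `x₀ ⊗ ⋯ ⊗ xₙ` such that `x₀ ∈ M`, exactly `w`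
of `x₁, …, xₙ` are in `M` and the other ones in `A`. It is zero if `n < w`. In bidegree `(v, w)` one
takes `n = v + w`. -/
def X (n w : ℕ) : Submodule k (CycTensor (𝓔.base K) n) :=
  Submodule.span k {z | ∃ (x : Fin (n + 1) → E) (S : Finset (Fin n)), S.card = w ∧
    x 0 ∈ 𝓔.M ∧ (∀ j, j ∈ S → x j.succ ∈ 𝓔.M) ∧ (∀ j, j ∉ S → x j.succ ∈ 𝓔.copyA) ∧
    z = cls (𝓔.base K) n x}

/-- The graded pieces `A`, `M`, `0`, `0`, … of `E`. -/
def gr : ℕ → Submodule k E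
  | 0 => 𝓔.copyA
  | 1 => 𝓔.M
  | _ => ⊥

lemma X_of_gr {n w : ℕ} (x : Fin (n + 1) → E) (c : Fin (n + 1) → ℕ) (hx : ∀ l, x l ∈ 𝓔.gr (c l))
    (h0 : c 0 ≠ 0) (hc : ∑ l, c l = w + 1) : cls (𝓔.base K) n x ∈ 𝓔.X K n w := by
  by_cases h : ∃ l, 2 ≤ c l
  · obtain ⟨l, hl⟩ := h
    have hl' := hx l
    obtain ⟨m, hm⟩ := Nat.exists_eq_add_of_le' hl
    rw [hm] at hl'
    rw [(cls (𝓔.base K) n).map_coord_zero l ((Submodule.mem_bot k).1 hl')]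
    exact Submodule.zero_mem _
  · push Not at h
    have h1 : c 0 = 1 := by have := h 0; omega
    rw [Fin.sum_univ_succ, h1] at hc
    refine Submodule.subset_span ⟨x, Finset.univ.filter fun j => c j.succ = 1, ?_, ?_, ?_, ?_, rfl⟩
    · rw [Finset.card_filter]
      have : ∀ j : Fin n, (if c j.succ = 1 then 1 else 0) = c j.succ := by
        intro j; have := h j.succ; split_ifs <;> omega
      simp only [this]; omega
    · have := hx 0; rwa [h1] at this
    · intro j hj
      have := hx j.succ
      rwa [(Finset.mem_filter.1 hj).2] at this
    · intro j hj
      have hj' : c j.succ = 0 := by have := h j.succ; simp at hj; omega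
      have := hx j.succ
      rwa [hj'] at this

lemma X_le {n w : ℕ} {N : Submodule k (CycTensor (𝓔.base K) n)}
    (h : ∀ (x : Fin (n + 1) → E) (c : Fin (n + 1) → ℕ), (∀ l, x l ∈ 𝓔.gr (c l)) → c 0 = 1 →
      ∑ l, c l = w + 1 → cls (𝓔.base K) n x ∈ N) : 𝓔.X K n w ≤ N := by
  refine Submodule.span_le.2 ?_
  rintro z ⟨x, S, hS, h0, h1, h2, rfl⟩
  classical
  refine h x (Fin.cons 1 fun j => if j ∈ S then 1 else 0) ?_ rfl ?_
  · intro l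
    refine Fin.cases ?_ (fun j => ?_) l
    · exact h0
    · rw [Fin.cons_succ]
      split_ifs with hj
      · exact h1 j hj
      · exact h2 j hj
  · rw [Fin.sum_univ_succ]
    simp [hS, add_comm]

lemma piM_gr_zero {x : E} (hx : x ∈ 𝓔.gr 0) : 𝓔.piM x = 0 := by
  obtain ⟨a, rfl⟩ := hx
  simp [piM_apply, 𝓔.p_i]

lemma piM_gr_one {x : E} (hx : x ∈ 𝓔.gr 1) : 𝓔.piM x = x := by
  have hx' : 𝓔.p x = 0 := hx
  simp [piM_apply, hx']

lemma piM_gr {a : ℕ} {x : E} (hx : x ∈ 𝓔.gr a) : 𝓔.piM x ∈ 𝓔.gr a := by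
  match a, hx with
  | 0, hx => rw [𝓔.piM_gr_zero hx]; exact Submodule.zero_mem _
  | 1, hx => rw [𝓔.piM_gr_one hx]; exact hx
  | a + 2, hx => rw [(Submodule.mem_bot k).1 hx, map_zero]; exact Submodule.zero_mem _

lemma piA_gr {a : ℕ} {x : E} (hx : x ∈ 𝓔.gr a) : 𝓔.piA x ∈ 𝓔.gr a := by
  have : 𝓔.piA x = x - 𝓔.piM x := by simp [piM_apply, piA_apply]
  rw [this]
  exact Submodule.sub_mem _ hx (𝓔.piM_gr hx)

lemma lastProj_gr {n : ℕ} (i l : Fin (n + 1)) {a : ℕ} {x : E} (hx : x ∈ 𝓔.gr a) :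
    𝓔.lastProj i l x ∈ 𝓔.gr a := by
  unfold lastProj
  split_ifs
  exacts [hx, 𝓔.piM_gr hx, 𝓔.piA_gr hx]

lemma dot_gr {a c : ℕ} {x y : E} (hx : x ∈ 𝓔.gr a) (hy : y ∈ 𝓔.gr c) :
    𝓔.dot x y ∈ 𝓔.gr (a + c) := by
  match a, c, hx, hy with
  | a + 2, c, hx, hy =>
    rw [(Submodule.mem_bot k).1 hx, map_zero]; exact Submodule.zero_mem _
  | a, c + 2, hx, hy =>
    rw [(Submodule.mem_bot k).1 hy, map_zero]; exact Submodule.zero_mem _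
  | 0, 0, hx, hy =>
    rw [dot_apply, 𝓔.piM_gr_zero hx, zero_mul, sub_zero]
    obtain ⟨x, rfl⟩ := hx
    obtain ⟨y, rfl⟩ := hy
    exact ⟨x * y, by simp⟩
  | 0, 1, hx, hy =>
    rw [dot_apply, 𝓔.piM_gr_zero hx, zero_mul, sub_zero]
    have hy' : 𝓔.p y = 0 := hy
    change 𝓔.p (x * y) = 0
    rw [map_mul, hy', mul_zero]
  | 1, 0, hx, hy =>
    rw [dot_apply, 𝓔.piM_gr_zero hy, mul_zero, sub_zero]
    have hx' : 𝓔.p x = 0 := hx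
    change 𝓔.p (x * y) = 0
    rw [map_mul, hx', zero_mul]
  | 1, 1, hx, hy =>
    rw [dot_apply, 𝓔.piM_gr_one hx, 𝓔.piM_gr_one hy, sub_self]
    exact Submodule.zero_mem _

lemma tri_mem (x y : E) : 𝓔.tri x y ∈ 𝓔.gr 1 := by
  change 𝓔.p (𝓔.tri x y) = 0
  simp [tri_apply, piM_apply, 𝓔.p_i]

/-- The degrees of the entries after two neighbours have been multiplied. -/
def contrDeg {n : ℕ} (j : Fin (n + 1)) (c : Fin (n + 2) → ℕ) : Fin (n + 1) → ℕ := fun l =>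
  if l < j then c l.castSucc else if l = j then c l.castSucc + c l.succ else c l.succ

lemma sum_contrDeg {n : ℕ} (j : Fin (n + 1)) (c : Fin (n + 2) → ℕ) :
    ∑ l, contrDeg j c l = ∑ l, c l := by
  rw [Fin.sum_univ_succAbove c j.succ]
  have : ∀ l, contrDeg j c l = (if l = j then c j.succ else 0) + c (j.succ.succAbove l) := by
    intro l
    unfold contrDeg
    split_ifs with h1 h2 h3
    · exact absurd h1 (by simp [h2])
    · rw [Fin.succAbove_of_castSucc_lt _ _ (by
        rw [Fin.lt_def] at h1 ⊢; simp only [Fin.val_castSucc, Fin.val_succ]; omega), zero_add]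
    · subst h3
      rw [Fin.succAbove_of_castSucc_lt _ _ (by
        rw [Fin.lt_def]; simp), add_comm]
    · rw [Fin.succAbove_of_le_castSucc _ _ (by
        have := lt_of_le_of_ne (not_lt.1 h1) (Ne.symm h3)
        rw [Fin.lt_def] at this
        rw [Fin.le_def]; simp only [Fin.val_castSucc, Fin.val_succ]; omega), zero_add]
  simp only [this, Finset.sum_add_distrib]
  simp

lemma dot_contr_mem {n w : ℕ} (j : Fin (n + 1)) (x : Fin (n + 2) → E) (c : Fin (n + 2) → ℕ)
    (hx : ∀ l, x l ∈ 𝓔.gr (c l)) (h0 : c 0 ≠ 0 ∨ (j = 0 ∧ c 1 ≠ 0)) (hc : ∑ l, c l = w + 1) :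
    cls (𝓔.base K) n (contr 𝓔.dot j x) ∈ 𝓔.X K n w := by
  refine 𝓔.X_of_gr K _ (contrDeg j c) (fun l => ?_) ?_ ((sum_contrDeg j c).trans hc)
  · unfold contr contrDeg
    split_ifs
    exacts [hx _, 𝓔.dot_gr (hx _) (hx _), hx _]
  · unfold contrDeg
    obtain h0 | ⟨rfl, h0⟩ := h0
    · split_ifs with h1 h2
      · exact h0
      · simp only [Fin.castSucc_zero]; omega
      · exact absurd (Fin.pos_of_ne_zero (Ne.symm h2)) h1
    · simp only [lt_self_iff_false, if_false, if_true, Fin.castSucc_zero, Fin.succ_zero_eq_one]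
      omega

lemma tri_contr_mem {n w : ℕ} (j : Fin (n + 1)) (x : Fin (n + 2) → E) (c : Fin (n + 2) → ℕ)
    (hx : ∀ l, x l ∈ 𝓔.gr (c l)) (h0 : c 0 ≠ 0 ∨ j = 0) (hc : ∑ l, c l = w + 2) :
    cls (𝓔.base K) n (contr 𝓔.tri j x) ∈ 𝓔.X K n w := by
  by_cases h : 𝓔.tri (x j.castSucc) (x j.succ) = 0
  · rw [(cls (𝓔.base K) n).map_coord_zero j (by simp [contr, h])]
    exact Submodule.zero_mem _
  have key : ∀ l, 𝓔.piM (x l) ≠ 0 → c l = 1 := by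
    intro l hl
    have := hx l
    match hcl : c l with
    | 0 => rw [hcl] at this; exact absurd (𝓔.piM_gr_zero this) hl
    | 1 => rfl
    | m + 2 =>
      rw [hcl] at this
      rw [(Submodule.mem_bot k).1 this, map_zero] at hl
      exact absurd rfl hl
  have h1 : c j.castSucc = 1 := key _ fun h' => h (by rw [tri_apply, h', zero_mul])
  have h2 : c j.succ = 1 := key _ fun h' => h (by rw [tri_apply, h', mul_zero])
  have hs := sum_contrDeg j c
  have hcj : contrDeg j c j = 2 := by simp [contrDeg, h1, h2]
  have hs' : ∑ l, Function.update (contrDeg j c) j 1 l = w + 1 := by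
    rw [Finset.sum_update_of_mem (Finset.mem_univ j)]
    have := Finset.add_sum_erase Finset.univ (contrDeg j c) (Finset.mem_univ j)
    rw [Finset.erase_eq] at this
    omega
  refine 𝓔.X_of_gr K _ (Function.update (contrDeg j c) j 1) (fun l => ?_) ?_ hs'
  · rw [Function.update_apply]
    unfold contr contrDeg
    split_ifs with e1 e2 <;> first
      | exact hx _
      | exact 𝓔.tri_mem _ _
      | exact absurd e2 (by simp [e1])
  · rw [Function.update_apply]
    split_ifs with e1
    · simp
    · have hj : (0 : Fin (n + 1)) < j := Fin.pos_of_ne_zero (Ne.symm e1)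
      obtain h0 | h0 := h0
      · simpa [contrDeg, hj] using h0
      · exact absurd h0.symm e1

lemma rot_last_one {Y : Type*} {n : ℕ} (x : Fin (n + 2) → Y) :
    rot (Fin.last (n + 1)) x 1 = x 0 := by
  simp only [rot]; congr 1
  exact Fin.ext (by rw [val_add_last]; simp)

lemma sum_rot {n : ℕ} (i : Fin (n + 1)) (c : Fin (n + 1) → ℕ) : ∑ l, rot i c l = ∑ l, c l :=
  Equiv.sum_comp (Equiv.addRight i) c

lemma b_mem (n w : ℕ) : ∀ z ∈ 𝓔.X K (n + 1) w, 𝓔.b K n z ∈ 𝓔.X K n w := by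
  refine 𝓔.X_le K (N := (𝓔.X K n w).comap (𝓔.b K n)) fun x c hx h0 hc => ?_
  rw [Submodule.mem_comap, b, descend_cls, hochMul_apply]
  refine Submodule.add_mem _ (Submodule.sum_mem _ fun j _ => Submodule.smul_mem _ _ ?_)
    (Submodule.smul_mem _ _ ?_)
  · exact 𝓔.dot_contr_mem K j x c hx (Or.inl (by omega)) hc
  · exact 𝓔.dot_contr_mem K 0 _ (rot (Fin.last (n + 1)) c) (fun l => hx _)
      (Or.inr ⟨rfl, by rw [rot_last_one]; omega⟩) ((sum_rot _ c).trans hc)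

lemma d_mem (n w : ℕ) : ∀ z ∈ 𝓔.X K (n + 1) (w + 1), 𝓔.d K n z ∈ 𝓔.X K n w := by
  refine 𝓔.X_le K (N := (𝓔.X K n w).comap (𝓔.d K n)) fun x c hx h0 hc => ?_
  rw [Submodule.mem_comap, d, descend_cls, hochMul_apply]
  refine Submodule.add_mem _ (Submodule.sum_mem _ fun j _ => Submodule.smul_mem _ _ ?_)
    (Submodule.smul_mem _ _ ?_)
  · exact 𝓔.tri_contr_mem K j x c hx (Or.inl (by omega)) hc
  · exact 𝓔.tri_contr_mem K 0 _ (rot (Fin.last (n + 1)) c) (fun l => hx _)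
      (Or.inr rfl) ((sum_rot _ c).trans hc)

lemma d'_mem (n w : ℕ) : ∀ z ∈ 𝓔.X K (n + 1) (w + 1), 𝓔.d' K n z ∈ 𝓔.X K n w := by
  refine 𝓔.X_le K (N := (𝓔.X K n w).comap (𝓔.d' K n)) fun x c hx h0 hc => ?_
  rw [Submodule.mem_comap, d', descend_cls, hochMul'_apply]
  exact Submodule.sum_mem _ fun j _ => Submodule.smul_mem _ _
    (𝓔.tri_contr_mem K j x c hx (Or.inl (by omega)) hc)

lemma t_mem (n w : ℕ) : ∀ z ∈ 𝓔.X K n w, 𝓔.t K n z ∈ 𝓔.X K n w := by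
  refine 𝓔.X_le K (N := (𝓔.X K n w).comap (𝓔.t K n)) fun x c hx h0 hc => ?_
  rw [Submodule.mem_comap, t, descend_cls, tMul_apply]
  refine Submodule.sum_mem _ fun i _ => Submodule.smul_mem _ _ ?_
  by_cases hi : c i = 0
  · rw [(cls (𝓔.base K) n).map_coord_zero 0]
    · exact Submodule.zero_mem _
    · have := hx i
      rw [hi] at this
      simp [rot, lastProj, 𝓔.piM_gr_zero this]
  · exact 𝓔.X_of_gr K _ (rot i c) (fun l => 𝓔.lastProj_gr _ _ (hx _)) (by simpa [rot] using hi)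
      ((sum_rot i c).trans hc)

/-- `t` on `M ⊗ B^n_w ⊗`. -/
def tX (n w : ℕ) : 𝓔.X K n w →ₗ[k] 𝓔.X K n w := (𝓔.t K n).restrict (𝓔.t_mem K n w)

/-- `N = id + t + ⋯ + t^w` on `M ⊗ B^n_w ⊗`. -/
def NX (n w : ℕ) : 𝓔.X K n w →ₗ[k] 𝓔.X K n w := ∑ l ∈ Finset.range (w + 1), 𝓔.tX K n w ^ l

/-- `b` on `M ⊗ B^n_w ⊗`. -/
def bX (n w : ℕ) : 𝓔.X K (n + 1) w →ₗ[k] 𝓔.X K n w := (𝓔.b K n).restrict (𝓔.b_mem K n w)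

/-- `d` on `M ⊗ B^n_w ⊗`. -/
def dX (n w : ℕ) : 𝓔.X K (n + 1) (w + 1) →ₗ[k] 𝓔.X K n w := (𝓔.d K n).restrict (𝓔.d_mem K n w)

/-- The restriction to `M ⊗ B^n_w ⊗` of the sum `∑_{j < n} ϱⱼ`. -/
def dX' (n w : ℕ) : 𝓔.X K (n + 1) (w + 1) →ₗ[k] 𝓔.X K n w :=
  (𝓔.d' K n).restrict (𝓔.d'_mem K n w)

/-- Transport along an equality `m = n`. -/
def castX {m n : ℕ} (h : m = n) (w : ℕ) : 𝓔.X K m w →ₗ[k] 𝓔.X K n w :=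
  match n, h with
  | _, rfl => LinearMap.id

/-- The triple diagram. The module in position `(u, v, w)` is `X_{v w} = M ⊗ B^{v + w}_w ⊗`. The faces
with even `u` are `(X, b, d)`, those with odd `u` are `(X, -b, -d')`; the map from column `u + 1` to
column `u` is `id - t` if `u` is even, and `N` if `u` is odd. -/
def diagram : TripleDiagram k where
  X _ v w := 𝓔.X K (v + w) w
  dh u v w := if Even u then LinearMap.id - 𝓔.tX K (v + w) w else 𝓔.NX K (v + w) w
  dv u v w :=
    (if Even u then 𝓔.bX K (v + w) w else -𝓔.bX K (v + w) w) ∘ₗ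
      𝓔.castX K (show v + 1 + w = v + w + 1 by omega) w
  dd u v w := if Even u then 𝓔.dX K (v + w) w else -𝓔.dX' K (v + w) w

end CleftExtension

end Cleft

end

/-! Write ∂ = b + d for the Hochschild boundary of E, and let `F` be the span of the tensors with x₀
∈ M, that is, the sum of the modules X_{vw} with v + w = n. The proof rests on a truncated Connes
operator `Phi`: if j is the last index with xⱼ ∈ M, then `Phi` keeps from B only the summands ± 1 ⊗
xₛ₊₁ ⊗ ⋯ ⊗ xₙ ⊗ x₀ ⊗ ⋯ ⊗ xₛ with s ≥ j.

Two identities carry everything. On `F` in positive degrees, ∂ Phi = id - t - Phi (b + d')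
(`hochschild_Phi_of_mem_F`): the faces next to the inserted unit telescope to id - t, and the other
faces give `Phi` of the faces of the tensor, except that the wrap-around product of xₙ ∈ M with x₀ ∈
M is lost, which replaces d by d'. On X_{vw}, B = Phi N (`connes_eq_Phi_N`): the powers of t let
each of the w + 1 entries in M take the role of the last one, and the corresponding ranges of s
partition 0, …, n.

Hence (y, z) ↦ y + Phi z, from the columns 2i and 2i + 1 of the triple diagram to the column uⁱ of
the relative mixed complex, is compatible with the differentials; here B Phi = 0 by normalization.
It is injective, because `projF` and `eps` recover y and z from y + Phi z. Its cokernel is acyclic: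
on the whole relative complex ∂ Phi + Phi ∂ - id takes values in F + Phi(F) (`homotopy_mem`), and B
Phi = Phi B = 0, so `Phi` is a contracting homotopy of the cokernel. All of this happens column by
column in uⁱ, so it holds for the columns i ∈ S with S arbitrary and for direct products. The sets S
= {0}, i ≥ 0, ℤ and i ≤ 0 yield the four isomorphisms.

The relations of the triple complex come from the same identities. One inserts them into ∂² = 0 and
∂B + B∂ = 0, compares the parts in `F` and in Phi(F), and then separates by the number of entries in
M, which b and t preserve and d and d' lower by one. -/

noncomputable section

namespace Cleft

variable {k C : Type*} [CommRing k] [Ring C] [Algebra k C]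

/-! ### Cyclic faces and the square of the Hochschild boundary -/

section faces

/-- The `i`-th cyclic face: `xᵢ` and `xᵢ₊₁` are multiplied, the last entry being followed by the first
one. -/
def cface {n : ℕ} (i : Fin (n + 2)) (x : Fin (n + 2) → C) : Fin (n + 1) → C := fun l =>
  if (i : ℕ) = n + 1 then (if (l : ℕ) = 0 then x (Fin.last _) * x 0 else x l.castSucc)
  else if (l : ℕ) < i then x l.castSucc
  else if (l : ℕ) = i then x l.castSucc * x l.succ else x l.succ

lemma contr_mul_eq_cface {n : ℕ} (j : Fin (n + 1)) (x : Fin (n + 2) → C) :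
    contr (LinearMap.mul k C) j x = cface j.castSucc x := by
  funext l
  have := j.2
  simp only [contr, cface, Fin.lt_def, Fin.ext_iff, Fin.val_castSucc, LinearMap.mul_apply']
  rw [if_neg (by omega : ¬ (j : ℕ) = n + 1)]

lemma rot_apply_eq {X : Type*} {n : ℕ} (i : Fin (n + 1)) (y : ℕ → X) (l : Fin (n + 1)) :
    rot i (fun l : Fin (n + 1) => y l) l =
      if (l : ℕ) + i < n + 1 then y (l + i) else y (l + i - (n + 1)) := by
  have hl := l.2
  have hi := i.2
  simp only [rot, Fin.val_add]
  split_ifs with h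
  · rw [Nat.mod_eq_of_lt h]
  · rw [Nat.mod_eq_sub_mod (by omega), Nat.mod_eq_of_lt (by omega)]

lemma contr_zero_rot_last (μ : C →ₗ[k] C →ₗ[k] C) {n : ℕ} (x : Fin (n + 2) → C)
    (l : Fin (n + 1)) : contr μ 0 (rot (Fin.last (n + 1)) x) l =
      if (l : ℕ) = 0 then μ (x (Fin.last _)) (x 0) else x l.castSucc := by
  obtain ⟨y, rfl⟩ := exists_nat_ext x
  have := l.2
  simp only [contr, rot_apply_eq, Fin.lt_def, Fin.ext_iff, Fin.val_castSucc, Fin.val_succ,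
    Fin.val_zero, Fin.val_last]
  grind

lemma contr_mul_rot_last {n : ℕ} (x : Fin (n + 2) → C) :
    contr (LinearMap.mul k C) 0 (rot (Fin.last (n + 1)) x) = cface (Fin.last (n + 1)) x := by
  funext l
  rw [contr_zero_rot_last]
  simp [cface]

lemma hochschild_cls (K : Subalgebra k C) {n : ℕ} (x : Fin (n + 2) → C) :
    hochschild K n (cls K (n + 1) x) =
      ∑ i : Fin (n + 2), (-1 : k) ^ (i : ℕ) • cls K n (cface i x) := by
  rw [hochschild, descend_cls, hochMul_apply,
    Fin.sum_univ_castSucc (fun i : Fin (n + 2) => (-1 : k) ^ (i : ℕ) • cls K n (cface i x)),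
    contr_mul_rot_last]
  simp only [contr_mul_eq_cface, Fin.val_castSucc, Fin.val_last]

/-- The wrap-around face obeys the same simplicial identities as the others; associativity enters
where the two products share an entry. -/
lemma cface_cface {n : ℕ} (i j : Fin (n + 2)) (h : i ≤ j) (x : Fin (n + 3) → C) :
    cface i (cface j.succ x) = cface j (cface i.castSucc x) := by
  obtain ⟨y, rfl⟩ := exists_nat_ext x
  funext l
  have := i.2
  have := j.2
  have := l.2
  rw [Fin.le_def] at h
  simp only [cface, Fin.val_castSucc, Fin.val_succ, Fin.val_last, Fin.val_zero]
  grind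

/-- For i ≤ j the terms at (i, j + 1) and (j, i) agree up to sign and cancel; every pair of indices
is of exactly one of the two kinds. -/
lemma sum_simplicial_eq_zero {V : Type*} [AddCommGroup V] [Module k V] {m : ℕ}
    (f : Fin (m + 1) → Fin (m + 2) → V)
    (hf : ∀ i j : Fin (m + 1), i ≤ j → f i j.succ = f j i.castSucc) :
    ∑ j : Fin (m + 2), ∑ i : Fin (m + 1), ((-1 : k) ^ (j : ℕ) * (-1 : k) ^ (i : ℕ)) • f i j = 0 := by
  have hsplit : ∀ (i : Fin (m + 1)) (h : Fin (m + 2) → V), ∑ j, h j =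
      (∑ j : Fin (m + 1), if i ≤ j then h j.succ else 0) +
        ∑ j : Fin (m + 1), if j ≤ i then h j.castSucc else 0 := by
    intro i h
    have h1 : ∑ j, h j = (∑ j : Fin (m + 2), if (i : ℕ) < j then h j else 0) +
        ∑ j : Fin (m + 2), if (j : ℕ) ≤ i then h j else 0 := by
      rw [← Finset.sum_add_distrib]
      refine Finset.sum_congr rfl fun j _ => ?_
      split_ifs <;> first | omega | simp
    have := i.2
    rw [h1, Fin.sum_univ_succ, Fin.sum_univ_castSucc (fun j => if (j : ℕ) ≤ i then h j else 0)]
    simp only [Fin.val_zero, Fin.val_last, Fin.val_succ, Fin.val_castSucc, Fin.le_def,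
      not_lt_zero, if_false, zero_add]
    rw [if_neg (by omega : ¬ m + 1 ≤ (i : ℕ)), add_zero]
    congr 1
    exact Finset.sum_congr rfl fun j _ => by simp only [Nat.lt_succ_iff]
  rw [Finset.sum_comm]
  simp only [fun i => hsplit i fun j => ((-1 : k) ^ (j : ℕ) * (-1 : k) ^ (i : ℕ)) • f i j]
  rw [Finset.sum_add_distrib, Finset.sum_comm, ← Finset.sum_add_distrib]
  refine Finset.sum_eq_zero fun i _ => ?_
  rw [← Finset.sum_add_distrib]
  refine Finset.sum_eq_zero fun j _ => ?_
  split_ifs with h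
  · rw [hf _ _ h, ← add_smul, Fin.val_succ, Fin.val_castSucc, pow_succ]
    ring_nf
    simp
  · simp

lemma hochschild_hochschild (K : Subalgebra k C) (n : ℕ) (z : CycTensor K (n + 2)) :
    hochschild K n (hochschild K (n + 1) z) = 0 := by
  suffices h : hochschild K n ∘ₗ hochschild K (n + 1) = 0 from LinearMap.congr_fun h z
  refine cyc_hom_ext fun x => ?_
  simp only [LinearMap.comp_apply, hochschild_cls, map_sum, map_smul, Finset.smul_sum, smul_smul,
    LinearMap.zero_apply]
  exact sum_simplicial_eq_zero (fun i j => cls K n (cface i (cface j x)))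
    fun i j h => congrArg _ (cface_cface i j h x)

end faces

/-! ### Signed rotations, insertions of the unit, and the relations of the mixed complex -/

section rotations

variable (K : Subalgebra k C)

/-- `(-1)^{r n} xᵣ ⊗ ⋯ ⊗ xₙ ⊗ x₀ ⊗ ⋯ ⊗ xᵣ₋₁`, the index `r` being read modulo `n + 1`. -/
def srot (n r : ℕ) (x : Fin (n + 1) → C) : CycTensor K n :=
  (-1 : k) ^ (r * n) • cls K n (rot (Fin.ofNat (n + 1) r) x)

/-- `(-1)^{(s + 1) n} 1 ⊗ xₛ₊₁ ⊗ ⋯ ⊗ xₙ ⊗ x₀ ⊗ ⋯ ⊗ xₛ`. -/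
def sins (n : ℕ) (s : Fin (n + 1)) (x : Fin (n + 1) → C) : CycTensor K (n + 1) :=
  (-1 : k) ^ (((s : ℕ) + 1) * n) • cls K (n + 1) (Fin.cons 1 (rot (s + 1) x))

lemma neg_one_pow_congr {a b : ℕ} (h : a % 2 = b % 2) : (-1 : k) ^ a = (-1) ^ b := by
  rw [neg_one_pow_eq_pow_mod_two, h, ← neg_one_pow_eq_pow_mod_two]

lemma rot_zero {X : Type*} {n : ℕ} (x : Fin (n + 1) → X) : rot 0 x = x := by
  funext l; simp [rot]

lemma ofNat_val_add_one {n : ℕ} (s : Fin (n + 1)) :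
    Fin.ofNat (n + 1) ((s : ℕ) + 1) = s + 1 := by
  apply Fin.ext
  rw [val_add_one']
  have := s.2
  simp only [Fin.ofNat]
  split_ifs with h
  · simp [h]
  · exact Nat.mod_eq_of_lt (by omega)

@[simp] lemma srot_zero {n : ℕ} (x : Fin (n + 1) → C) : srot K n 0 x = cls K n x := by
  have : Fin.ofNat (n + 1) 0 = 0 := rfl
  rw [srot, this, rot_zero]; simp

@[simp] lemma srot_full {n : ℕ} (x : Fin (n + 1) → C) : srot K n (n + 1) x = cls K n x := by
  have h : Fin.ofNat (n + 1) (n + 1) = 0 := Fin.ext (by simp [Fin.ofNat])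
  rw [srot, h, rot_zero, mul_comm, (Nat.even_mul_succ_self n).neg_one_pow, one_smul]

/-- The summation index is shifted by one, so that s is the position of the entry that ends up last.
The summand i = 0 becomes s = n, whose sign (-1)^{(n + 1) n} is 1. -/
lemma connes_cls {n : ℕ} (x : Fin (n + 1) → C) :
    connes K n (cls K n x) = ∑ s, sins K n s x := by
  rw [connes, descend_cls, connesMul_apply, ← Equiv.sum_comp (Equiv.addRight (1 : Fin (n + 1)))]
  refine Finset.sum_congr rfl fun s _ => ?_
  rw [sins, Equiv.coe_addRight]
  congr 1
  rw [val_add_one']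
  split_ifs with h
  · rw [h, mul_comm (n + 1), (Nat.even_mul_succ_self n).neg_one_pow]; simp
  · rfl

/-- With s = `i.succAbove s'`, the two cases tell whether or not counting j steps on from s + 1
passes from the last entry to x₀. -/
lemma succAbove_add_eq {n : ℕ} {i : Fin (n + 2)} {s' j : Fin (n + 1)}
    (hi : i = i.succAbove s' + 1 + j.castSucc) :
    ((s' : ℕ) < i ∧ (i.succAbove s' : ℕ) = s' ∧ (i : ℕ) = s' + 1 + j) ∨
      ((i : ℕ) ≤ s' ∧ (i.succAbove s' : ℕ) = s' + 1 ∧ (i : ℕ) + n = s' + j) := by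
  have h1 := i.2
  have h2 := s'.2
  have h3 := j.2
  have hi' := congrArg Fin.val hi
  rw [Fin.val_add, val_add_one', Fin.val_castSucc] at hi'
  rcases lt_or_ge (s' : ℕ) i with h | h
  · have e : (i.succAbove s' : ℕ) = s' := by
      rw [Fin.succAbove_of_castSucc_lt _ _ (by simpa [Fin.lt_def] using h), Fin.val_castSucc]
    refine Or.inl ⟨h, e, ?_⟩
    rw [e, if_neg (by omega)] at hi'
    rcases lt_or_ge ((s' : ℕ) + 1 + j) (n + 1 + 1) with h4 | h4
    · rwa [Nat.mod_eq_of_lt h4] at hi'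
    · rw [Nat.mod_eq_sub_mod h4, Nat.mod_eq_of_lt (by omega)] at hi'
      omega
  · have e : (i.succAbove s' : ℕ) = s' + 1 := by
      rw [Fin.succAbove_of_le_castSucc _ _ (by simpa [Fin.le_def] using h), Fin.val_succ]
    refine Or.inr ⟨h, e, ?_⟩
    rw [e] at hi'
    split_ifs at hi' with h5
    · rw [Nat.mod_eq_of_lt (by omega)] at hi'
      omega
    · rcases lt_or_ge ((s' : ℕ) + 1 + 1 + j) (n + 1 + 1) with h4 | h4
      · rw [Nat.mod_eq_of_lt h4] at hi'
        omega
      · rw [Nat.mod_eq_sub_mod h4, Nat.mod_eq_of_lt (by omega)] at hi'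
        omega

/-- Once xᵢ and its successor have been multiplied, the entry with index `i.succAbove s'` has index
s'; so it makes no difference whether one rotates or multiplies first. -/
lemma rot_succAbove_cface {n : ℕ} (i : Fin (n + 2)) (s' j : Fin (n + 1))
    (hi : i = i.succAbove s' + 1 + j.castSucc) (x : Fin (n + 2) → C) :
    cface j.castSucc (rot (i.succAbove s' + 1) x) = rot (s' + 1) (cface i x) := by
  obtain ⟨y, rfl⟩ := exists_nat_ext x
  -- The contracted tuple is extended to a sequence on ℕ, which makes its rotation an explicit case
  -- distinction as well.
  obtain ⟨y', hy'⟩ : ∃ y' : ℕ → C, y' = fun l =>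
      if (i : ℕ) = n + 1 then (if l = 0 then y (n + 1) * y 0 else y l)
      else if l < i then y l else if l = i then y l * y (l + 1) else y (l + 1) := ⟨_, rfl⟩
  have hc : cface i (fun l => y l) = fun l : Fin (n + 1) => y' l := by
    funext l
    simp only [hy', cface, Fin.val_castSucc, Fin.val_succ, Fin.val_last, Fin.val_zero]
  rw [hc]
  funext l
  have h1 := i.2
  have h2 := s'.2
  have h3 := j.2
  have h4 := l.2
  have hS := val_add_one' (i.succAbove s')
  have hT := val_add_one' s'
  generalize i.succAbove s' + 1 = a at hS ⊢
  generalize s' + 1 = c at hT ⊢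
  rw [rot_apply_eq]
  simp only [cface, rot_apply_eq, Fin.val_castSucc, Fin.val_succ, hy', h3.ne, if_false]
  obtain ⟨h, e, h'⟩ | ⟨h, e, h'⟩ := succAbove_add_eq hi
  · rw [e, if_neg (by omega)] at hS
    by_cases hn : (s' : ℕ) = n
    · rw [if_pos hn] at hT
      rw [hS, hT]
      clear hS hT hc hi
      grind
    · rw [if_neg hn] at hT
      rw [hS, hT]
      clear hS hT hc hi
      grind
  · rw [e] at hS
    by_cases hn : (s' : ℕ) = n
    · rw [if_pos (by omega)] at hS
      rw [if_pos hn] at hT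
      rw [hS, hT]
      clear hS hT hc hi
      grind
    · rw [if_neg (by omega)] at hS
      rw [if_neg hn] at hT
      rw [hS, hT]
      clear hS hT hc hi
      grind

/-- The two faces at the unit only remove it: the first leaves the rotation that starts at s + 1,
the last one moves xₛ to the front. The inner faces do not touch the unit. -/
lemma hochschild_sins_aux {n : ℕ} (x : Fin (n + 2) → C) (s : Fin (n + 2)) :
    hochschild K (n + 1) (sins K (n + 1) s x) = srot K (n + 1) (s + 1) x - srot K (n + 1) s x +
      ∑ j : Fin (n + 1), (-1 : k) ^ (((s : ℕ) + 1) * (n + 1) + (j + 1)) •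
        cls K (n + 1) (Fin.cons 1 (cface j.castSucc (rot (s + 1) x))) := by
  have hfirst : cface 0 (Fin.cons 1 (rot (s + 1) x) : Fin (n + 3) → C) = rot (s + 1) x := by
    funext l
    unfold cface
    rw [if_neg (by simp), if_neg (by simp)]
    by_cases h : (l : ℕ) = 0
    · obtain rfl : l = 0 := Fin.ext h
      rw [if_pos (by simp), Fin.castSucc_zero, Fin.cons_zero, one_mul, Fin.cons_succ]
    · rw [if_neg (by simpa using h), Fin.cons_succ]
  have hlast : cface (Fin.last (n + 2)) (Fin.cons 1 (rot (s + 1) x) : Fin (n + 3) → C) =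
      rot s x := by
    funext l
    simp only [cface, Fin.val_last, if_true]
    split_ifs with h
    · obtain rfl : l = 0 := Fin.ext h
      rw [← Fin.succ_last, Fin.cons_succ, Fin.cons_zero, mul_one]
      simp only [rot]
      congr 1
      rw [add_comm s 1, ← add_assoc, Fin.last_add_one]
    · obtain ⟨l', rfl⟩ : ∃ l' : Fin (n + 1), l = l'.succ := Fin.exists_succ_eq.2 (fun h' => h (by simp [h']))|>.imp fun _ => Eq.symm
      rw [← Fin.succ_castSucc, Fin.cons_succ]
      simp only [rot]
      congr 1
      rw [add_comm s 1, ← add_assoc]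
      simp
  have hmid : ∀ j : Fin (n + 1), cface j.castSucc.succ (Fin.cons 1 (rot (s + 1) x) : Fin (n + 3) → C) =
      Fin.cons 1 (cface j.castSucc (rot (s + 1) x)) := by
    intro j
    have := j.2
    funext l
    refine Fin.cases ?_ (fun l => ?_) l
    · have hj : (j : ℕ) ≠ n + 1 := by omega
      simp [cface, hj]
    · simp only [cface, Fin.val_succ, Fin.val_castSucc, Fin.cons_succ, ← Fin.succ_castSucc]
      grind
  rw [sins, map_smul, hochschild_cls, Fin.sum_univ_succ, Fin.sum_univ_castSucc, hfirst,
    Fin.succ_last, hlast]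
  simp only [hmid, Fin.val_succ, Fin.val_castSucc, Fin.val_last, smul_add, Finset.smul_sum,
    smul_smul, srot, ofNat_val_add_one, Fin.val_zero, pow_zero, mul_one, Fin.ofNat_val_eq_self,
    ← pow_add]
  rw [neg_one_pow_congr (k := k) (b := (s : ℕ) * (n + 1) + 1) (a := ((s : ℕ) + 1) * (n + 1) + (n + 1 + 1)) (by grind), pow_succ]
  simp only [mul_neg, mul_one, neg_smul]
  abel

/-- The set `P` is arbitrary because two cases are needed: all s for ∂B + B∂ = 0, and s ≥ j for
`Phi`. An inner face multiplies xᵢ and its successor for some i ≠ s, since the unit separates xₛ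
from its successor; the pairs with i ≠ s are reindexed as (`i.succAbove s'`, i). -/
lemma hochschild_sins {n : ℕ} (x : Fin (n + 2) → C) (P : Fin (n + 2) → Prop) [DecidablePred P] :
    hochschild K (n + 1) (∑ s, if P s then sins K (n + 1) s x else 0) =
      (∑ s : Fin (n + 2), if P s then srot K (n + 1) (s + 1) x - srot K (n + 1) s x else 0) -
      ∑ i : Fin (n + 2), (-1 : k) ^ (i : ℕ) •
        ∑ s : Fin (n + 1), if P (i.succAbove s) then sins K n s (cface i x) else 0 := by
  -- The negative of what the product at position i contributes to the boundary of the insertion s.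
  -- A preimage s' under `i.succAbove` is missing exactly for i = s, and there the value is 0.
  let f : Fin (n + 2) → Fin (n + 2) → CycTensor K (n + 1) := fun s i =>
    if h : ∃ s', i.succAbove s' = s then (-1 : k) ^ (i : ℕ) • sins K n h.choose (cface i x) else 0
  have hf : ∀ i s', f (i.succAbove s') i = (-1 : k) ^ (i : ℕ) • sins K n s' (cface i x) := by
    intro i s'
    have h : ∃ s'', i.succAbove s'' = i.succAbove s' := ⟨s', rfl⟩
    have h' : h.choose = s' := Fin.succAbove_right_injective h.choose_spec
    simp only [f]
    rw [dif_pos h, h']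
  have hf0 : ∀ i, f i i = 0 := fun i => dif_neg fun ⟨s', h⟩ => Fin.succAbove_ne i s' h
  have hin : ∀ s, hochschild K (n + 1) (sins K (n + 1) s x) =
      srot K (n + 1) (s + 1) x - srot K (n + 1) s x - ∑ i, f s i := by
    intro s
    rw [hochschild_sins_aux, sub_eq_add_neg _ (∑ i, f s i),
      ← Equiv.sum_comp (Equiv.addLeft (s + 1)) (f s),
      Fin.sum_univ_castSucc fun j => f s (Equiv.addLeft (s + 1) j)]
    -- Positions are counted cyclically from s + 1; the last one reached is s itself, whose term
    -- vanishes.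
    have h0 : s + 1 + Fin.last (n + 1) = s :=
      (add_assoc _ _ _).trans (by rw [add_comm 1 (Fin.last (n + 1)), Fin.last_add_one, add_zero])
    simp only [Equiv.coe_addLeft, h0, hf0, add_zero, ← Finset.sum_neg_distrib]
    congr 1
    refine Finset.sum_congr rfl fun j _ => ?_
    obtain ⟨i, hi⟩ : ∃ i, i = s + 1 + j.castSucc := ⟨_, rfl⟩
    have hne : s ≠ i := by
      intro h
      rw [← h] at hi
      have h'' := congrArg Fin.val ((add_right_injective (s + 1)) (hi.symm.trans h0.symm))
      have := j.2
      rw [Fin.val_castSucc, Fin.val_last] at h''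
      omega
    obtain ⟨s', rfl⟩ := Fin.exists_succAbove_eq hne
    rw [← hi, hf, rot_succAbove_cface i s' j hi, sins, smul_smul, ← neg_smul]
    congr 1
    rw [← pow_add, ← mul_neg_one ((-1 : k) ^ _), ← pow_succ]
    apply neg_one_pow_congr
    obtain ⟨h, e, h'⟩ | ⟨h, e, h'⟩ := succAbove_add_eq hi <;> rw [e] <;> grind
  have hL : hochschild K (n + 1) (∑ s, if P s then sins K (n + 1) s x else 0) =
      (∑ s : Fin (n + 2), if P s then srot K (n + 1) (s + 1) x - srot K (n + 1) s x else 0) -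
        ∑ s, ∑ i, if P s then f s i else 0 := by
    rw [map_sum, ← Finset.sum_sub_distrib]
    refine Finset.sum_congr rfl fun s _ => ?_
    split_ifs
    · exact hin s
    · simp
  rw [hL, Finset.sum_comm]
  congr 1
  refine Finset.sum_congr rfl fun i _ => ?_
  rw [Fin.sum_univ_succAbove _ i, hf0, Finset.smul_sum]
  simp only [ite_self, zero_add, hf, smul_ite, smul_zero]

lemma sum_srot_sub {n j : ℕ} (hj : j ≤ n + 1) (x : Fin (n + 1) → C) :
    (∑ s : Fin (n + 1), if j ≤ (s : ℕ) then srot K n (s + 1) x - srot K n s x else 0) =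
      cls K n x - srot K n j x := by
  rw [Fin.sum_univ_eq_sum_range
    (fun s => if j ≤ s then srot K n (s + 1) x - srot K n s x else 0), ← Finset.sum_filter]
  have : Finset.filter (fun s => j ≤ s) (Finset.range (n + 1)) = Finset.Ico j (n + 1) := by
    ext; simp; omega
  rw [this, Finset.sum_Ico_sub (fun s => srot K n s x) hj, srot_full]

lemma hochschild_sins_zero (x : Fin 1 → C) : hochschild K 0 (sins K 0 0 x) = 0 := by
  rw [sins, map_smul, hochschild_cls, Fin.sum_univ_two]
  have h0 : cface 0 (Fin.cons 1 (rot (0 + 1) x) : Fin 2 → C) = x := by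
    funext l
    obtain rfl : l = 0 := Fin.ext (by omega)
    simp [cface, rot, Fin.eq_zero]
  have h1 : cface 1 (Fin.cons 1 (rot (0 + 1) x) : Fin 2 → C) = x := by
    funext l
    obtain rfl : l = 0 := Fin.ext (by omega)
    simp only [cface, Fin.val_zero, if_true, Fin.val_one, zero_add]
    rw [Fin.cons_zero, mul_one, ← Fin.succ_last, Fin.cons_succ]
    exact congrArg x (Fin.ext (by omega))
  rw [h0, h1]
  simp

/-- With all insertions present, the rotations telescope around a full turn to 0, and only the inner
faces remain. -/
lemma hochschild_connes (n : ℕ) (z : CycTensor K (n + 1)) :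
    hochschild K (n + 1) (connes K (n + 1) z) + connes K n (hochschild K n z) = 0 := by
  suffices h : hochschild K (n + 1) ∘ₗ connes K (n + 1) + connes K n ∘ₗ hochschild K n = 0 from
    LinearMap.congr_fun h z
  refine cyc_hom_ext fun x => ?_
  have h := hochschild_sins K x (fun _ => True)
  have h' := sum_srot_sub K (Nat.zero_le (n + 1 + 1)) x
  simp only [zero_le, if_true, srot_zero, sub_self] at h h'
  simp only [LinearMap.add_apply, LinearMap.comp_apply, connes_cls, h, h', hochschild_cls, map_sum,
    map_smul, LinearMap.zero_apply, zero_sub, neg_add_cancel]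

lemma hochschild_connes_zero (z : CycTensor K 0) : hochschild K 0 (connes K 0 z) = 0 := by
  suffices h : hochschild K 0 ∘ₗ connes K 0 = 0 from LinearMap.congr_fun h z
  refine cyc_hom_ext fun x => ?_
  rw [LinearMap.comp_apply, connes_cls, Fin.sum_univ_one, hochschild_sins_zero]
  rfl

/-- The unit in front moves every entry, x₀ included, to a position where elements of K vanish. This
is the source of B² = 0, B Phi = 0, Phi B = 0 and Phi² = 0. -/
lemma sins_of_mem {n : ℕ} (s : Fin (n + 1)) (x : Fin (n + 1) → C) {j : Fin (n + 1)}
    (h : x j ∈ K) : sins K n s x = 0 := by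
  rw [sins, cls_degen _ (Fin.succ_ne_zero (j - (s + 1))), smul_zero]
  simpa [rot] using h

lemma connes_connes (n : ℕ) (z : CycTensor K n) : connes K (n + 1) (connes K n z) = 0 := by
  suffices h : connes K (n + 1) ∘ₗ connes K n = 0 from LinearMap.congr_fun h z
  refine cyc_hom_ext fun x => ?_
  rw [LinearMap.comp_apply, connes_cls, map_sum]
  refine Finset.sum_eq_zero fun s _ => ?_
  rw [sins, map_smul, connes_cls, Finset.sum_eq_zero fun s _ => ?_, smul_zero]
  exact sins_of_mem K s _ (j := 0) (by simp)

end rotations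

/-! ### Operations on tensors, and the span of the tensors that start with 1 -/

section tensorMaps

/-- `f` is a map of `K`-bimodules that preserves `K`. -/
structure IsBimoduleMap (K : Subalgebra k C) (f : C →ₗ[k] C) : Prop where
  right : ∀ c ∈ K, ∀ x, f (x * c) = f x * c
  left : ∀ c ∈ K, ∀ x, f (c * x) = c * f x
  map_mem : ∀ c ∈ K, f c ∈ K

lemma isBimoduleMap_id (K : Subalgebra k C) : IsBimoduleMap K (LinearMap.id : C →ₗ[k] C) :=
  ⟨fun _ _ _ => rfl, fun _ _ _ => rfl, fun _ h => h⟩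

lemma compLinearMap_descends {K : Subalgebra k C} {n : ℕ} {f : Fin (n + 1) → C →ₗ[k] C}
    (hf : ∀ l, IsBimoduleMap K (f l)) : Descends K ((cls K n).compLinearMap f) where
  balanced x j c hc := by
    refine cls_balanced j hc (fun l => f l (x l)) _ _ (fun l => ?_) (fun l => ?_)
    · simp only [Function.update_apply]
      split_ifs with h
      · rw [h, (hf _).right c hc]
      · rfl
    · simp only [Function.update_apply]
      split_ifs with h
      · rw [h, (hf _).left c hc]
      · rfl
  degen x j hj hx := cls_degen _ hj ((hf j).map_mem _ hx)

/-- `x₀ ⊗ ⋯ ⊗ xₙ ↦ f₀(x₀) ⊗ ⋯ ⊗ fₙ(xₙ)` for maps of `K`-bimodules `fₗ` that preserve `K`. -/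
def tmap {K : Subalgebra k C} {n : ℕ} (f : Fin (n + 1) → C →ₗ[k] C)
    (hf : ∀ l, IsBimoduleMap K (f l)) : CycTensor K n →ₗ[k] CycTensor K n :=
  descend ((cls K n).compLinearMap f) (compLinearMap_descends hf)

@[simp] lemma tmap_cls {K : Subalgebra k C} {n : ℕ} (f : Fin (n + 1) → C →ₗ[k] C)
    (hf : ∀ l, IsBimoduleMap K (f l)) (x : Fin (n + 1) → C) :
    tmap f hf (cls K n x) = cls K n fun l => f l (x l) := by
  rw [tmap, descend_cls]; rfl

/-- The multilinear form of the insertion of `1` in front of a rotated tensor. -/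
def insMul (K : Subalgebra k C) (n : ℕ) (s : Fin (n + 1)) :
    MultilinearMap k (fun _ : Fin (n + 1) => C) (CycTensor K (n + 1)) :=
  (-1 : k) ^ (((s : ℕ) + 1) * n) • ((cls K (n + 1)).curryLeft 1).domDomCongr (Equiv.addRight (s + 1))

lemma insMul_apply (K : Subalgebra k C) (n : ℕ) (s : Fin (n + 1)) (x : Fin (n + 1) → C) :
    insMul K n s x = sins K n s x := by
  rw [insMul, smul_apply]
  rfl

lemma insMul_descends (K : Subalgebra k C) (n : ℕ) (s : Fin (n + 1)) :
    Descends K (insMul K n s) where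
  balanced x j c hc := by
    simp only [insMul_apply, sins]
    congr 1
    have h := cons_one_balanced (rot (s + 1) x) (j - (s + 1)) c hc
    have h1 : rot (s + 1) x (j - (s + 1)) = x j := by simp [rot]
    have h2 : rot (s + 1) x (j - (s + 1) + 1) = x (j + 1) := by
      simp only [rot]; congr 1; abel
    rw [h1, h2] at h
    rw [rot_update, rot_update, h]; congr 3; abel
  degen x j hj hx := by rw [insMul_apply, sins_of_mem K s x hx]

/-- `x₀ ⊗ ⋯ ⊗ xₙ ↦ (-1)^{(s + 1) n} 1 ⊗ xₛ₊₁ ⊗ ⋯ ⊗ xₙ ⊗ x₀ ⊗ ⋯ ⊗ xₛ` -/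
def ins (K : Subalgebra k C) (n : ℕ) (s : Fin (n + 1)) : CycTensor K n →ₗ[k] CycTensor K (n + 1) :=
  descend (insMul K n s) (insMul_descends K n s)

@[simp] lemma ins_cls (K : Subalgebra k C) (n : ℕ) (s : Fin (n + 1)) (x : Fin (n + 1) → C) :
    ins K n s (cls K n x) = sins K n s x := by
  rw [ins, descend_cls, insMul_apply]

/-- The span of the tensors `1 ⊗ x₀ ⊗ ⋯ ⊗ xₙ`. -/
def unitSpan (K : Subalgebra k C) (n : ℕ) : Submodule k (CycTensor K (n + 1)) :=
  Submodule.span k (Set.range fun x : Fin (n + 1) → C => cls K (n + 1) (Fin.cons 1 x))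

lemma sins_mem_unitSpan (K : Subalgebra k C) (n : ℕ) (s : Fin (n + 1)) (x : Fin (n + 1) → C) :
    sins K n s x ∈ unitSpan K n :=
  Submodule.smul_mem _ _ (Submodule.subset_span ⟨_, rfl⟩)

lemma mem_of_forall_cls {K : Subalgebra k C} {n : ℕ} {N : Submodule k (CycTensor K n)}
    (h : ∀ x, cls K n x ∈ N) (z : CycTensor K n) : z ∈ N := by
  have : (⊤ : Submodule k (CycTensor K n)) ≤ N := by
    rw [← span_cls, Submodule.span_le]
    rintro _ ⟨x, rfl⟩
    exact h x
  exact this trivial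

lemma connes_mem_unitSpan (K : Subalgebra k C) (n : ℕ) (z : CycTensor K n) :
    connes K n z ∈ unitSpan K n := by
  refine mem_of_forall_cls (N := (unitSpan K n).comap (connes K n)) (fun x => ?_) z
  rw [Submodule.mem_comap, connes_cls]
  exact Submodule.sum_mem _ fun s _ => sins_mem_unitSpan K n s x

lemma eq_zero_of_mem_unitSpan {K : Subalgebra k C} {n : ℕ} {V : Type*} [AddCommGroup V]
    [Module k V] (f : CycTensor K (n + 1) →ₗ[k] V) (hf : ∀ x, f (cls K (n + 1) (Fin.cons 1 x)) = 0)
    {z : CycTensor K (n + 1)} (hz : z ∈ unitSpan K n) : f z = 0 := by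
  have : unitSpan K n ≤ LinearMap.ker f := by
    rw [unitSpan, Submodule.span_le]
    rintro _ ⟨x, rfl⟩
    exact hf x
  exact this hz

lemma connes_of_mem_unitSpan {K : Subalgebra k C} {n : ℕ} {z : CycTensor K (n + 1)}
    (hz : z ∈ unitSpan K n) : connes K (n + 1) z = 0 := by
  refine eq_zero_of_mem_unitSpan _ (fun x => ?_) hz
  rw [connes_cls]
  exact Finset.sum_eq_zero fun s _ => sins_of_mem K s _ (j := 0) (by simp)

lemma rot_rot {X : Type*} {n : ℕ} (a c : Fin (n + 1)) (x : Fin (n + 1) → X) :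
    rot a (rot c x) = rot (a + c) x := by
  funext l; simp only [rot, add_assoc]

end tensorMaps

namespace CleftExtension

variable {A E : Type*} [Ring A] [Algebra k A] [Ring E] [Algebra k E]
  (𝓔 : CleftExtension k A E) (K : Subalgebra k A)

/-! ### Splitting a tensor at its last entry in M -/

section projections

lemma isBimoduleMap_piA : IsBimoduleMap (𝓔.base K) 𝓔.piA where
  right c hc x := by rw [piA_mul, 𝓔.piA_of_mem hc]
  left c hc x := by rw [piA_mul, 𝓔.piA_of_mem hc]
  map_mem c hc := by rw [𝓔.piA_of_mem hc]; exact hc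

lemma isBimoduleMap_piM : IsBimoduleMap (𝓔.base K) 𝓔.piM where
  right c hc x := 𝓔.piM_mul_right hc x
  left c hc x := 𝓔.piM_mul_left hc x
  map_mem c hc := by rw [𝓔.piM_of_mem hc]; exact zero_mem _

lemma piA_add_piM (x : E) : 𝓔.piA x + 𝓔.piM x = x := by simp [piA_apply, piM_apply]

lemma piA_of_mem_M {x : E} (hx : x ∈ 𝓔.M) : 𝓔.piA x = 0 := by
  have hx' : 𝓔.p x = 0 := hx
  rw [piA_apply, hx', map_zero]

lemma piM_of_mem_M {x : E} (hx : x ∈ 𝓔.M) : 𝓔.piM x = x := 𝓔.piM_gr_one hx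

lemma piM_of_mem_A {x : E} (hx : x ∈ 𝓔.copyA) : 𝓔.piM x = 0 := 𝓔.piM_gr_zero hx

lemma piA_of_mem_A {x : E} (hx : x ∈ 𝓔.copyA) : 𝓔.piA x = x := by
  have := 𝓔.piA_add_piM x
  rwa [𝓔.piM_of_mem_A hx, add_zero] at this

lemma piA_mem (x : E) : 𝓔.piA x ∈ 𝓔.copyA := ⟨𝓔.p x, rfl⟩

lemma piM_mem (x : E) : 𝓔.piM x ∈ 𝓔.M := by
  change 𝓔.p (𝓔.piM x) = 0
  simp [piM_apply, 𝓔.p_i]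

lemma mul_mem_M_left {x y : E} (hx : x ∈ 𝓔.M) : x * y ∈ 𝓔.M := by
  have hx' : 𝓔.p x = 0 := hx
  change 𝓔.p (x * y) = 0
  rw [map_mul, hx', zero_mul]

lemma mul_mem_M_right {x y : E} (hy : y ∈ 𝓔.M) : x * y ∈ 𝓔.M := by
  have hy' : 𝓔.p y = 0 := hy
  change 𝓔.p (x * y) = 0
  rw [map_mul, hy', mul_zero]

lemma mul_mem_copyA {x y : E} (hx : x ∈ 𝓔.copyA) (hy : y ∈ 𝓔.copyA) : x * y ∈ 𝓔.copyA := by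
  obtain ⟨x, rfl⟩ := hx
  obtain ⟨y, rfl⟩ := hy
  exact ⟨x * y, by simp⟩

lemma piM_one : 𝓔.piM 1 = 0 := by simp [piM_apply]

lemma piA_one : 𝓔.piA 1 = 1 := by simp [piA_apply]

lemma isBimoduleMap_lastProj {n : ℕ} (i l : Fin (n + 1)) :
    IsBimoduleMap (𝓔.base K) (𝓔.lastProj i l) := by
  unfold lastProj
  split_ifs
  exacts [isBimoduleMap_id _, 𝓔.isBimoduleMap_piM K, 𝓔.isBimoduleMap_piA K]

/-- The projection to `A` in the positions `≥ r`. -/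
def cut {n : ℕ} (r : ℕ) (l : Fin (n + 1)) : E →ₗ[k] E := if (l : ℕ) < r then LinearMap.id else 𝓔.piA

lemma isBimoduleMap_cut {n : ℕ} (r : ℕ) (l : Fin (n + 1)) :
    IsBimoduleMap (𝓔.base K) (𝓔.cut r l) := by
  unfold cut
  split_ifs
  exacts [isBimoduleMap_id _, 𝓔.isBimoduleMap_piA K]

/-- Multilinearity in position r alone, where xᵣ is the sum of its parts in A and M. Summed over r
it telescopes. -/
lemma cls_cut_succ {n : ℕ} (r : Fin (n + 1)) (x : Fin (n + 1) → E) :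
    cls (𝓔.base K) n (fun l => 𝓔.cut ((r : ℕ) + 1) l (x l)) =
      cls (𝓔.base K) n (fun l => 𝓔.cut r l (x l)) +
        cls (𝓔.base K) n (fun l => 𝓔.lastProj r l (x l)) := by
  set y : Fin (n + 1) → E := fun l => 𝓔.cut r l (x l) with hy
  have h1 : (fun l => 𝓔.cut ((r : ℕ) + 1) l (x l)) = Function.update y r (𝓔.piA (x r) + 𝓔.piM (x r)) := by
    funext l
    rw [piA_add_piM]
    by_cases h : l = r
    · subst h; simp [cut]
    · have h' : (l : ℕ) ≠ r := fun h' => h (Fin.ext h')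
      rw [Function.update_of_ne h]
      simp only [hy, cut]
      congr 1
      have : (l : ℕ) < r + 1 ↔ (l : ℕ) < r := by omega
      simp only [this]
  have h2 : Function.update y r (𝓔.piA (x r)) = y := by
    conv_rhs => rw [← Function.update_eq_self r y]
    simp [hy, cut]
  have h3 : Function.update y r (𝓔.piM (x r)) = fun l => 𝓔.lastProj r l (x l) := by
    funext l
    by_cases h : l = r
    · subst h; simp [lastProj]
    · rw [Function.update_of_ne h]
      simp only [hy, cut, lastProj, h, if_false, Fin.lt_def]
  rw [h1, MultilinearMap.map_update_add, h2, h3]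

variable {K} in
lemma i_mem_base : ∀ c ∈ K, 𝓔.i c ∈ 𝓔.base K := fun c hc => Subalgebra.mem_map.2 ⟨c, hc, rfl⟩

lemma mapCyc_i_mapCyc_p {n : ℕ} (z : CycTensor (𝓔.base K) n) :
    tmap (K := 𝓔.base K) (fun _ => 𝓔.piA) (fun _ => 𝓔.isBimoduleMap_piA K) z =
      mapCyc (K := K) (L := 𝓔.base K) 𝓔.i 𝓔.i_mem_base n
        (mapCyc 𝓔.p (𝓔.p_base K) n z) := by
  revert z
  refine LinearMap.congr_fun (g := mapCyc (K := K) (L := 𝓔.base K) 𝓔.i 𝓔.i_mem_base n ∘ₗ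
    mapCyc 𝓔.p (𝓔.p_base K) n) (cyc_hom_ext fun x => ?_)
  rw [LinearMap.comp_apply, mapCyc_cls, mapCyc_cls, tmap_cls]
  rfl

/-- The telescoped decomposition has one more term, with all entries projected to A; it factors
through the map induced by `p` and so vanishes here. Thus linear statements on the relative complex
may be checked on tensors with a last entry in M. -/
lemma sum_lastProj_of_mem_ker {n : ℕ} {z : CycTensor (𝓔.base K) n}
    (hz : mapCyc 𝓔.p (𝓔.p_base K) n z = 0) :
    ∑ j, tmap (𝓔.lastProj j) (fun l => 𝓔.isBimoduleMap_lastProj K j l) z = z := by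
  have key : ∀ z : CycTensor (𝓔.base K) n,
      ∑ j, tmap (𝓔.lastProj j) (fun l => 𝓔.isBimoduleMap_lastProj K j l) z +
        tmap (fun _ => 𝓔.piA) (fun _ => 𝓔.isBimoduleMap_piA K) z = z := by
    suffices h : (∑ j, tmap (𝓔.lastProj j) (fun l => 𝓔.isBimoduleMap_lastProj K j l)) +
        tmap (fun _ => 𝓔.piA) (fun _ => 𝓔.isBimoduleMap_piA K) =
          (LinearMap.id : CycTensor (𝓔.base K) n →ₗ[k] _) by
      intro z
      simpa using LinearMap.congr_fun h z
    refine cyc_hom_ext fun x => ?_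
    simp only [LinearMap.add_apply, LinearMap.sum_apply, tmap_cls, LinearMap.id_apply]
    have h : ∀ j : Fin (n + 1), cls (𝓔.base K) n (fun l => 𝓔.lastProj j l (x l)) =
        cls (𝓔.base K) n (fun l => 𝓔.cut ((j : ℕ) + 1) l (x l)) -
          cls (𝓔.base K) n (fun l => 𝓔.cut j l (x l)) := fun j => by
      rw [cls_cut_succ, add_sub_cancel_left]
    simp only [h]
    rw [Fin.sum_univ_eq_sum_range (fun j => cls (𝓔.base K) n (fun l => 𝓔.cut (j + 1) l (x l)) -
          cls (𝓔.base K) n (fun l => 𝓔.cut j l (x l))),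
      Finset.sum_range_sub (fun j => cls (𝓔.base K) n (fun l => 𝓔.cut j l (x l)))]
    have h0 : (fun l : Fin (n + 1) => 𝓔.cut 0 l (x l)) = fun l => 𝓔.piA (x l) := by
      funext l; simp [cut]
    have h1 : (fun l : Fin (n + 1) => 𝓔.cut (n + 1) l (x l)) = x := by
      funext l; rw [cut, if_pos l.2, LinearMap.id_apply]
    rw [h0, h1, sub_add_cancel]
  have h := key z
  rwa [mapCyc_i_mapCyc_p, hz, map_zero, add_zero] at h

end projections

/-! ### The truncated Connes operator on tensors with a last entry in M -/

section homotopy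

/-- The position of the last entry in `M`. -/
structure IsLast {n : ℕ} (x : Fin (n + 1) → E) (j : Fin (n + 1)) : Prop where
  mem : x j ∈ 𝓔.M
  mem_A : ∀ l, j < l → x l ∈ 𝓔.copyA

variable {𝓔} in
lemma isLast_lastProj {n : ℕ} (x : Fin (n + 1) → E) (j : Fin (n + 1)) :
    𝓔.IsLast (fun l => 𝓔.lastProj j l (x l)) j where
  mem := by simpa [lastProj] using 𝓔.piM_mem (x j)
  mem_A l hl := by
    simp only [lastProj, if_neg (not_lt.2 hl.le), if_neg hl.ne']
    exact 𝓔.piA_mem _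

/-- The sum of the tensors `± 1 ⊗ xₛ₊₁ ⊗ ⋯ ⊗ xₙ ⊗ x₀ ⊗ ⋯ ⊗ xₛ` over those `s` for which
`xₛ₊₁, …, xₙ` are in `A`. -/
def Phi (n : ℕ) : CycTensor (𝓔.base K) n →ₗ[k] CycTensor (𝓔.base K) (n + 1) :=
  ∑ s : Fin (n + 1), ins (𝓔.base K) n s ∘ₗ
    tmap (𝓔.cut ((s : ℕ) + 1)) (fun l => 𝓔.isBimoduleMap_cut K _ l)

lemma Phi_cls {n : ℕ} (x : Fin (n + 1) → E) : 𝓔.Phi K n (cls (𝓔.base K) n x) =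
    ∑ s : Fin (n + 1), sins (𝓔.base K) n s (fun l => 𝓔.cut ((s : ℕ) + 1) l (x l)) := by
  simp [Phi]

variable {𝓔} in
-- If s < j, the projections to A beyond s kill xⱼ ∈ M; if s ≥ j, they act on entries that are
-- already in A.
lemma Phi_cls_of_isLast {n : ℕ} {x : Fin (n + 1) → E} {j : Fin (n + 1)} (h : 𝓔.IsLast x j) :
    𝓔.Phi K n (cls (𝓔.base K) n x) =
      ∑ s : Fin (n + 1), if (j : ℕ) ≤ s then sins (𝓔.base K) n s x else 0 := by
  rw [Phi_cls]
  refine Finset.sum_congr rfl fun s _ => ?_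
  split_ifs with hs
  · congr 1
    funext l
    unfold cut
    split_ifs with hl
    · rfl
    · exact 𝓔.piA_of_mem_A (h.mem_A l (by rw [Fin.lt_def]; omega))
  · refine sins_of_mem _ s _ (j := j) ?_
    rw [cut, if_neg (by omega), 𝓔.piA_of_mem_M h.mem]
    exact zero_mem _

variable {𝓔} in
lemma t_cls_of_isLast {n : ℕ} {x : Fin (n + 1) → E} {j : Fin (n + 1)} (h : 𝓔.IsLast x j) :
    𝓔.t K n (cls (𝓔.base K) n x) = srot (𝓔.base K) n j x := by
  rw [t, descend_cls, tMul_apply, Finset.sum_eq_single j]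
  · rw [srot, Fin.ofNat_val_eq_self]
    congr 3
    funext l
    unfold lastProj
    split_ifs with h1 h2
    · rfl
    · rw [h2, 𝓔.piM_of_mem_M h.mem]
    · exact 𝓔.piA_of_mem_A (h.mem_A l (lt_of_le_of_ne (not_lt.1 h1) (Ne.symm h2)))
  · intro i _ hij
    rcases lt_or_gt_of_ne hij with hlt | hlt
    · rw [(cls (𝓔.base K) n).map_coord_zero (j - i), smul_zero]
      simp only [rot, sub_add_cancel, lastProj]
      rw [if_neg (not_lt.2 hlt.le), if_neg hlt.ne', 𝓔.piA_of_mem_M h.mem]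
    · rw [(cls (𝓔.base K) n).map_coord_zero 0, smul_zero]
      simp [rot, lastProj, 𝓔.piM_of_mem_A (h.mem_A i hlt)]
  · simp

lemma Phi_mem_unitSpan {n : ℕ} (z : CycTensor (𝓔.base K) n) :
    𝓔.Phi K n z ∈ unitSpan (𝓔.base K) n := by
  refine mem_of_forall_cls (N := (unitSpan (𝓔.base K) n).comap (𝓔.Phi K n)) (fun x => ?_) z
  rw [Submodule.mem_comap, Phi_cls]
  exact Submodule.sum_mem _ fun s _ => sins_mem_unitSpan _ n s _

lemma Phi_of_mem_unitSpan {n : ℕ} {z : CycTensor (𝓔.base K) (n + 1)}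
    (hz : z ∈ unitSpan (𝓔.base K) n) : 𝓔.Phi K (n + 1) z = 0 := by
  refine eq_zero_of_mem_unitSpan _ (fun x => ?_) hz
  rw [Phi_cls]
  refine Finset.sum_eq_zero fun s _ => sins_of_mem _ s _ (j := 0) ?_
  rw [cut, Fin.cons_zero]
  simp

/-- After applying `p`, the projections to A become invisible, so `Phi` lies over the full Connes
operator of A. In particular it preserves the relative complex. -/
lemma mapCyc_Phi {n : ℕ} (z : CycTensor (𝓔.base K) n) :
    mapCyc 𝓔.p (𝓔.p_base K) (n + 1) (𝓔.Phi K n z) =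
      connes K n (mapCyc 𝓔.p (𝓔.p_base K) n z) := by
  suffices h : mapCyc 𝓔.p (𝓔.p_base K) (n + 1) ∘ₗ 𝓔.Phi K n =
      connes K n ∘ₗ mapCyc 𝓔.p (𝓔.p_base K) n from LinearMap.congr_fun h z
  refine cyc_hom_ext fun x => ?_
  rw [LinearMap.comp_apply, LinearMap.comp_apply, Phi_cls, mapCyc_cls, connes_cls, map_sum]
  refine Finset.sum_congr rfl fun s _ => ?_
  rw [sins, sins, map_smul, mapCyc_cls]
  congr 2
  funext l
  refine Fin.cases ?_ (fun l => ?_) l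
  · simp
  · simp only [Fin.cons_succ, rot, cut]
    split_ifs
    · rfl
    · rw [piA_apply, 𝓔.p_i]

variable {𝓔} in
-- A product with a factor in the ideal M is in M, so the last entry in M survives a face. The
-- excluded case is the wrap-around face with j the last index, which absorbs that entry into
-- position 0. The condition on `i.succAbove s` says that the insertions used by `Phi` before and
-- after the face correspond.
lemma IsLast.cface {n : ℕ} {x : Fin (n + 2) → E} {j : Fin (n + 2)} (h : 𝓔.IsLast x j)
    (i : Fin (n + 2)) (hij : ¬ (i = Fin.last _ ∧ j = Fin.last _)) :
    ∃ j' : Fin (n + 1), 𝓔.IsLast (cface i x) j' ∧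
      ∀ s : Fin (n + 1), (j' : ℕ) ≤ s ↔ (j : ℕ) ≤ i.succAbove s := by
  have hi := i.2
  have hj := j.2
  have hs : ∀ s : Fin (n + 1), (i.succAbove s : ℕ) = if (s : ℕ) < i then (s : ℕ) else s + 1 := by
    intro s
    unfold Fin.succAbove
    simp only [Fin.lt_def, Fin.val_castSucc]
    split_ifs <;> simp
  rcases lt_or_ge (i : ℕ) j with hlt | hge
  -- A product to the left of xⱼ shifts it to j - 1, where it is the right-hand factor if i = j - 1.
  · refine ⟨⟨j - 1, by omega⟩, ⟨?_, fun l hl => ?_⟩, fun s => ?_⟩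
    · unfold Cleft.cface
      rw [if_neg (by omega), if_neg (by simp only; omega)]
      have e : (⟨j - 1, by omega⟩ : Fin (n + 1)).succ = j := Fin.ext (by simp; omega)
      rw [e]
      split_ifs
      · exact 𝓔.mul_mem_M_right h.mem
      · exact h.mem
    · rw [Fin.lt_def] at hl
      simp only at hl
      unfold Cleft.cface
      rw [if_neg (by omega), if_neg (by omega), if_neg (by omega)]
      exact h.mem_A _ (by rw [Fin.lt_def, Fin.val_succ]; omega)
    · rw [hs]
      simp only
      split_ifs <;> omega
  · have hjn : (j : ℕ) < n + 1 := by
      by_contra hc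
      exact hij ⟨Fin.ext (by rw [Fin.val_last]; omega), Fin.ext (by rw [Fin.val_last]; omega)⟩
    refine ⟨⟨j, hjn⟩, ⟨?_, fun l hl => ?_⟩, fun s => ?_⟩
    · have e : (⟨j, hjn⟩ : Fin (n + 1)).castSucc = j := rfl
      unfold Cleft.cface
      rw [e]
      split_ifs with h1 h2 h3 h4
      · have e0 : j = 0 := Fin.ext h2
        exact 𝓔.mul_mem_M_right (e0 ▸ h.mem)
      · exact h.mem
      · exact h.mem
      · exact 𝓔.mul_mem_M_left h.mem
      · simp only at h3 h4; omega
    · rw [Fin.lt_def] at hl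
      simp only at hl
      have a1 := h.mem_A l.castSucc (by rw [Fin.lt_def, Fin.val_castSucc]; omega)
      have a2 := h.mem_A l.succ (by rw [Fin.lt_def, Fin.val_succ]; omega)
      unfold Cleft.cface
      split_ifs with h1 h2 h3 h4
      · omega
      · exact a1
      · exact a1
      · exact 𝓔.mul_mem_copyA a1 a2
      · exact a2
    · rw [hs]
      simp only
      split_ifs <;> omega

variable {𝓔} in
-- For j the last index, no insertion s ≥ j is compatible with the wrap-around face, so this face
-- contributes nothing and has to be removed from ∂x. All other faces commute with `Phi` by
-- `IsLast.cface`, and the rotations telescope from j to the full turn.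
lemma hochschild_Phi_cls {n : ℕ} {x : Fin (n + 2) → E} {j : Fin (n + 2)} (h : 𝓔.IsLast x j) :
    hochschild (𝓔.base K) (n + 1) (𝓔.Phi K (n + 1) (cls (𝓔.base K) (n + 1) x)) =
      cls (𝓔.base K) (n + 1) x - 𝓔.t K (n + 1) (cls (𝓔.base K) (n + 1) x) -
      𝓔.Phi K n (hochschild (𝓔.base K) n (cls (𝓔.base K) (n + 1) x) -
        if j = Fin.last _ then (-1 : k) ^ (n + 1) • cls (𝓔.base K) n (cface (Fin.last _) x) else 0) := by
  rw [Phi_cls_of_isLast K h, hochschild_sins (𝓔.base K) x (fun s => (j : ℕ) ≤ s),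
    sum_srot_sub _ (by omega), t_cls_of_isLast K h]
  congr 1
  have hface : ∀ i : Fin (n + 2), ¬ (i = Fin.last _ ∧ j = Fin.last _) →
      (∑ s : Fin (n + 1), if (j : ℕ) ≤ i.succAbove s then sins (𝓔.base K) n s (cface i x) else 0) =
        𝓔.Phi K n (cls (𝓔.base K) n (cface i x)) := by
    intro i hij
    obtain ⟨j', h1, h2⟩ := h.cface i hij
    rw [Phi_cls_of_isLast K h1]
    simp only [h2]
  rw [hochschild_cls]
  split_ifs with hj
  · rw [Fin.sum_univ_castSucc, Fin.sum_univ_castSucc (n := n + 1), Fin.val_last, add_sub_cancel_right, map_sum,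
      Finset.sum_eq_zero (s := Finset.univ) (f := fun s : Fin (n + 1) =>
        if (j : ℕ) ≤ (Fin.last (n + 1)).succAbove s then
          sins (𝓔.base K) n s (cface (Fin.last (n + 1)) x) else 0), smul_zero, add_zero]
    · refine Finset.sum_congr rfl fun i _ => ?_
      rw [hface _ (fun h' => Fin.castSucc_ne_last i h'.1), map_smul]
    · intro s _
      rw [if_neg]
      rw [hj, Fin.succAbove_last, Fin.val_last, Fin.val_castSucc]
      have := s.2
      omega
  · rw [sub_zero, map_sum]
    refine Finset.sum_congr rfl fun i _ => ?_
    rw [hface _ (fun h' => hj h'.2), map_smul]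

variable {𝓔} in
-- After rotation by r the tensor ends in …, xᵣ₋₂, xᵣ₋₁, so its last entry in M is the xⱼ with the
-- largest such j below r. Thus t turns on from r to j, and `Phi` collects the insertions in
-- between.
lemma t_srot {n : ℕ} {x : Fin (n + 1) → E} {j r : ℕ} (hr : r ≤ n + 1) (hjr : j < r)
    (hj : ∀ l : Fin (n + 1), (l : ℕ) = j → x l ∈ 𝓔.M)
    (hA : ∀ l : Fin (n + 1), j < l → (l : ℕ) < r → x l ∈ 𝓔.copyA) :
    𝓔.t K n (srot (𝓔.base K) n r x) = srot (𝓔.base K) n j x ∧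
    𝓔.Phi K n (srot (𝓔.base K) n r x) =
      ∑ s : Fin (n + 1), if j ≤ (s : ℕ) ∧ (s : ℕ) < r then sins (𝓔.base K) n s x else 0 := by
  have hval : ∀ l : Fin (n + 1), ((l + Fin.ofNat (n + 1) r : Fin (n + 1)) : ℕ) =
      if (l : ℕ) + r < n + 1 then (l : ℕ) + r else l + r - (n + 1) := by
    intro l
    have := l.2
    rw [Fin.val_add]
    simp only [Fin.ofNat, Nat.add_mod_mod]
    split_ifs with h
    · exact Nat.mod_eq_of_lt h
    · rw [Nat.mod_eq_sub_mod (by omega), Nat.mod_eq_of_lt (by omega)]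
  -- The position of xⱼ in the rotated tensor.
  obtain ⟨J, hJ⟩ : ∃ J : Fin (n + 1), (J : ℕ) = j + (n + 1) - r := ⟨⟨_, by omega⟩, rfl⟩
  have hlast : 𝓔.IsLast (rot (Fin.ofNat (n + 1) r) x) J := by
    refine ⟨hj _ ?_, fun l hl => hA _ ?_ ?_⟩
    · rw [hval, if_neg (by omega)]; omega
    · rw [Fin.lt_def] at hl
      rw [hval, if_neg (by omega)]; omega
    · rw [Fin.lt_def] at hl
      have := l.2
      rw [hval, if_neg (by omega)]; omega
  constructor
  · rw [srot, map_smul, t_cls_of_isLast K hlast, srot, srot, smul_smul, rot_rot, ← pow_add]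
    congr 1
    · apply neg_one_pow_congr
      rw [hJ]
      have : r * n + (j + (n + 1) - r) * n = j * n + n * (n + 1) := by
        rw [← add_mul, show r + (j + (n + 1) - r) = j + (n + 1) by omega]; ring
      rw [this, Nat.add_mod, Nat.even_iff.1 (Nat.even_mul_succ_self n), add_zero, Nat.mod_mod]
    · congr 2
      apply Fin.ext
      rw [hval, Fin.val_ofNat, Fin.val_ofNat, Nat.mod_eq_of_lt J.2, Nat.mod_eq_of_lt (by omega),
        if_neg (by omega)]
      omega
  · rw [srot, map_smul, Phi_cls_of_isLast K hlast,
      ← Equiv.sum_comp (Equiv.addRight (Fin.ofNat (n + 1) r)) (fun s : Fin (n + 1) =>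
        if j ≤ (s : ℕ) ∧ (s : ℕ) < r then sins (𝓔.base K) n s x else 0), Finset.smul_sum]
    refine Finset.sum_congr rfl fun s _ => ?_
    have hs := s.2
    have hv := hval s
    rw [Equiv.coe_addRight, smul_ite, smul_zero, hJ]
    beta_reduce
    by_cases h : j + (n + 1) - r ≤ (s : ℕ)
    · rw [if_neg (by omega)] at hv
      rw [if_pos h, if_pos (by omega), sins, sins, smul_smul, rot_rot, ← pow_add]
      congr 1
      · apply neg_one_pow_congr
        rw [hv]
        have : r * n + ((s : ℕ) + 1) * n = ((s : ℕ) + r - (n + 1) + 1) * n + n * (n + 1) := by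
          rw [← add_mul, mul_comm n (n + 1), ← add_mul]
          congr 1
          omega
        rw [this, Nat.add_mod, Nat.even_iff.1 (Nat.even_mul_succ_self n), add_zero, Nat.mod_mod]
      · exact congrArg (fun a => cls (𝓔.base K) (n + 1) (Fin.cons 1 (rot a x))) (add_right_comm s 1 _)
    · rw [if_neg h, if_neg]
      split_ifs at hv <;> omega

end homotopy

/-! ### The grading by the number of entries in M -/

section grading

open Classical in
/-- The projection to `M` in the positions of `S` and to `A` in the other ones. -/
def gproj {n : ℕ} (S : Finset (Fin (n + 1))) (l : Fin (n + 1)) : E →ₗ[k] E :=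
  if l ∈ S then 𝓔.piM else 𝓔.piA

lemma isBimoduleMap_gproj {n : ℕ} (S : Finset (Fin (n + 1))) (l : Fin (n + 1)) :
    IsBimoduleMap (𝓔.base K) (𝓔.gproj S l) := by
  unfold gproj
  split_ifs
  exacts [𝓔.isBimoduleMap_piM K, 𝓔.isBimoduleMap_piA K]

/-- The projection to the tensors with exactly `w` entries in `M`. -/
def gradeProj (n w : ℕ) : CycTensor (𝓔.base K) n →ₗ[k] CycTensor (𝓔.base K) n :=
  ∑ S ∈ Finset.univ.powersetCard w, tmap (𝓔.gproj S) (fun l => 𝓔.isBimoduleMap_gproj K S l)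

lemma gradeProj_cls {n w : ℕ} (x : Fin (n + 1) → E) :
    𝓔.gradeProj K n w (cls (𝓔.base K) n x) =
      ∑ S ∈ Finset.univ.powersetCard w, cls (𝓔.base K) n (fun l => 𝓔.gproj S l (x l)) := by
  simp [gradeProj]

lemma cls_gproj_mem {n w : ℕ} (S : Finset (Fin (n + 1))) (hS : S.card = w + 1)
    (x : Fin (n + 1) → E) (h0 : x 0 ∈ 𝓔.M) :
    cls (𝓔.base K) n (fun l => 𝓔.gproj S l (x l)) ∈ 𝓔.X K n w := by
  classical
  by_cases h : (0 : Fin (n + 1)) ∈ S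
  · refine 𝓔.X_of_gr K _ (fun l => if l ∈ S then 1 else 0) (fun l => ?_) (by simp [h]) (by simp [hS])
    by_cases hl : l ∈ S
    · simp only [gproj, hl, if_true]; exact 𝓔.piM_mem _
    · simp only [gproj, hl, if_false]; exact 𝓔.piA_mem _
  · rw [(cls (𝓔.base K) n).map_coord_zero 0]
    · exact zero_mem _
    · simp only [gproj, h, if_false]
      exact 𝓔.piA_of_mem_M h0

lemma sum_gradeProj {n : ℕ} (z : CycTensor (𝓔.base K) n) :
    ∑ w ∈ Finset.range (n + 2), 𝓔.gradeProj K n w z = z := by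
  suffices h : ∑ w ∈ Finset.range (n + 2), 𝓔.gradeProj K n w = LinearMap.id by
    simpa using LinearMap.congr_fun h z
  refine cyc_hom_ext fun x => ?_
  simp only [LinearMap.sum_apply, gradeProj_cls, LinearMap.id_apply]
  have h := (cls (𝓔.base K) n).map_add_univ (fun l => 𝓔.piM (x l)) (fun l => 𝓔.piA (x l))
  have hx : ((fun l => 𝓔.piM (x l)) + fun l => 𝓔.piA (x l)) = x := by
    funext l
    rw [Pi.add_apply, add_comm, piA_add_piM]
  rw [hx, ← Finset.powerset_univ, Finset.sum_powerset, Finset.card_univ, Fintype.card_fin] at h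
  rw [h]
  refine Finset.sum_congr rfl fun w _ => Finset.sum_congr rfl fun S _ => ?_
  congr 1
  funext l
  by_cases hl : l ∈ S <;> simp [gproj, hl, Finset.piecewise]

/-- The shift to w + 1 counts x₀ ∈ M, which w leaves out. For any set of positions other than the
true one, some projection kills an entry. -/
lemma gradeProj_of_mem {n w w' : ℕ} {z : CycTensor (𝓔.base K) n} (hz : z ∈ 𝓔.X K n w) :
    𝓔.gradeProj K n w' z = if w' = w + 1 then z else 0 := by
  classical
  suffices h : 𝓔.X K n w ≤ LinearMap.ker (𝓔.gradeProj K n w' - if w' = w + 1 then LinearMap.id else 0) by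
    have := h hz
    rw [LinearMap.mem_ker, LinearMap.sub_apply, sub_eq_zero] at this
    rw [this]
    split_ifs <;> rfl
  refine Submodule.span_le.2 ?_
  rintro z ⟨x, S, hS, h0, h1, h2, rfl⟩
  set T : Finset (Fin (n + 1)) := insert 0 (S.map ⟨Fin.succ, Fin.succ_injective n⟩) with hT
  have hTc : T.card = w + 1 := by
    rw [hT, Finset.card_insert_of_notMem, Finset.card_map, hS]
    simp
  have hM : ∀ l, l ∈ T → x l ∈ 𝓔.M := by
    intro l hl
    rw [hT, Finset.mem_insert, Finset.mem_map] at hl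
    obtain rfl | ⟨j, hj, rfl⟩ := hl
    exacts [h0, h1 j hj]
  have hA : ∀ l, l ∉ T → x l ∈ 𝓔.copyA := by
    intro l
    refine Fin.cases (fun hl => ?_) (fun j hl => ?_) l
    · exact absurd (Finset.mem_insert_self _ _) hl
    · refine h2 j fun hj => hl ?_
      rw [hT, Finset.mem_insert, Finset.mem_map]
      exact Or.inr ⟨j, hj, rfl⟩
  have hne : ∀ S', S' ≠ T → cls (𝓔.base K) n (fun l => 𝓔.gproj S' l (x l)) = 0 := by
    intro S' hS'
    obtain ⟨l, hl⟩ : ∃ l, ¬ (l ∈ S' ↔ l ∈ T) := by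
      by_contra! h
      exact hS' (Finset.ext h)
    rw [(cls (𝓔.base K) n).map_coord_zero l]
    by_cases hlT : l ∈ T
    · have : l ∉ S' := fun h => hl ⟨fun _ => hlT, fun _ => h⟩
      simp only [gproj, this, if_false]
      exact 𝓔.piA_of_mem_M (hM l hlT)
    · have : l ∈ S' := by
        by_contra h
        exact hl ⟨fun h' => absurd h' h, fun h' => absurd h' hlT⟩
      simp only [gproj, this, if_true]
      exact 𝓔.piM_of_mem_A (hA l hlT)
  rw [SetLike.mem_coe, LinearMap.mem_ker, LinearMap.sub_apply, sub_eq_zero, gradeProj_cls]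
  split_ifs with hw
  · rw [Finset.sum_eq_single T (fun S' _ h => hne S' h)]
    · rw [LinearMap.id_apply]
      congr 1
      funext l
      by_cases hl : l ∈ T
      · simp only [gproj, hl, if_true]
        exact 𝓔.piM_of_mem_M (hM l hl)
      · simp only [gproj, hl, if_false]
        exact 𝓔.piA_of_mem_A (hA l hl)
    · intro h
      exact absurd (Finset.mem_powersetCard.2 ⟨Finset.subset_univ _, hTc.trans hw.symm⟩) h
  · refine Finset.sum_eq_zero fun S' hS' => hne S' fun h => hw ?_
    rw [← (Finset.mem_powersetCard.1 hS').2, h, hTc]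

lemma X_eq_bot {n w : ℕ} (h : n < w) : 𝓔.X K n w = ⊥ := by
  rw [X, Submodule.span_eq_bot]
  rintro z ⟨x, S, hS, -⟩
  have := S.card_le_univ
  rw [Fintype.card_fin] at this
  omega

/-- The span of the tensors whose first entry is in `M`. -/
def F (n : ℕ) : Submodule k (CycTensor (𝓔.base K) n) := ⨆ w, 𝓔.X K n w

lemma X_le_F (n w : ℕ) : 𝓔.X K n w ≤ 𝓔.F K n := le_iSup _ w

/-- On a generator the set of positions with entry in M contains 0, so it has a maximum. -/
lemma F_le {n : ℕ} {N : Submodule k (CycTensor (𝓔.base K) n)}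
    (h : ∀ (x : Fin (n + 1) → E) (j : Fin (n + 1)), x 0 ∈ 𝓔.M → 𝓔.IsLast x j →
      cls (𝓔.base K) n x ∈ N) : 𝓔.F K n ≤ N := by
  classical
  refine iSup_le fun w => 𝓔.X_le K fun x c hx h0 _ => ?_
  have hne : (Finset.univ.filter fun l => c l = 1).Nonempty := ⟨0, by simp [h0]⟩
  have hj := Finset.max'_mem _ hne
  refine h x (Finset.max' _ hne) ?_ ⟨?_, fun l hl => ?_⟩
  · have := hx 0; rwa [h0] at this
  · have := hx (Finset.max' _ hne)
    rwa [(Finset.mem_filter.1 hj).2] at this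
  · have hl' : c l ≠ 1 := fun h' =>
      absurd (Finset.le_max' _ l (by simp [h'])) (not_le.2 hl)
    have := hx l
    match hc : c l with
    | 0 => rwa [hc] at this
    | 1 => exact absurd hc hl'
    | m + 2 =>
      rw [hc] at this
      rw [(Submodule.mem_bot k).1 this]
      exact zero_mem _

lemma gradeProj_zero_of_mem_F {n : ℕ} {z : CycTensor (𝓔.base K) n} (hz : z ∈ 𝓔.F K n) :
    𝓔.gradeProj K n 0 z = 0 := by
  suffices h : 𝓔.F K n ≤ LinearMap.ker (𝓔.gradeProj K n 0) from h hz
  refine iSup_le fun w z hz => ?_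
  rw [LinearMap.mem_ker, 𝓔.gradeProj_of_mem K hz, if_neg (by omega)]

lemma gradeProj_mem_X {n : ℕ} (w : ℕ) {z : CycTensor (𝓔.base K) n} (hz : z ∈ 𝓔.F K n) :
    𝓔.gradeProj K n (w + 1) z ∈ 𝓔.X K n w := by
  suffices h : 𝓔.F K n ≤ (𝓔.X K n w).comap (𝓔.gradeProj K n (w + 1)) from h hz
  refine iSup_le fun w' z hz => ?_
  rw [Submodule.mem_comap, 𝓔.gradeProj_of_mem K hz]
  split_ifs with h
  · obtain rfl : w = w' := by omega
    exact hz
  · exact zero_mem _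

lemma sum_gradeProj_of_mem_F {n : ℕ} {z : CycTensor (𝓔.base K) n} (hz : z ∈ 𝓔.F K n) :
    ∑ w ∈ Finset.range (n + 1), 𝓔.gradeProj K n (w + 1) z = z := by
  have h := 𝓔.sum_gradeProj K z
  rwa [Finset.sum_range_succ', 𝓔.gradeProj_zero_of_mem_F K hz, add_zero] at h

/-- The entries other than x₀ need not lie in A or M: expand each of them into its two parts. -/
lemma cls_mem_F {n : ℕ} {x : Fin (n + 1) → E} (h0 : x 0 ∈ 𝓔.M) :
    cls (𝓔.base K) n x ∈ 𝓔.F K n := by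
  rw [← 𝓔.sum_gradeProj K (cls (𝓔.base K) n x)]
  refine Submodule.sum_mem _ fun w _ => ?_
  rw [gradeProj_cls]
  refine Submodule.sum_mem _ fun S hS => ?_
  have hc := (Finset.mem_powersetCard.1 hS).2
  match w, hc with
  | 0, hc =>
    rw [Finset.card_eq_zero] at hc
    subst hc
    rw [(cls (𝓔.base K) n).map_coord_zero 0]
    · exact zero_mem _
    · simp only [gproj, Finset.notMem_empty, if_false]
      exact 𝓔.piA_of_mem_M h0
  | w + 1, hc => exact 𝓔.X_le_F K n w (𝓔.cls_gproj_mem K S hc x h0)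

lemma F_le_ker {n : ℕ} {z : CycTensor (𝓔.base K) n} (hz : z ∈ 𝓔.F K n) :
    mapCyc 𝓔.p (𝓔.p_base K) n z = 0 := by
  suffices h : 𝓔.F K n ≤ LinearMap.ker (mapCyc 𝓔.p (𝓔.p_base K) n) from h hz
  refine 𝓔.F_le K fun x j h0 _ => ?_
  rw [LinearMap.mem_ker, mapCyc_cls, (cls K n).map_coord_zero 0]
  exact h0

end grading

/-! ### Recovering both components of y + Phi z -/

section retraction

/-- The projection to `M` in position `0`. -/
def firstProj {n : ℕ} (l : Fin (n + 1)) : E →ₗ[k] E := if l = 0 then 𝓔.piM else LinearMap.id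

lemma isBimoduleMap_firstProj {n : ℕ} (l : Fin (n + 1)) :
    IsBimoduleMap (𝓔.base K) (𝓔.firstProj l) := by
  unfold firstProj
  split_ifs
  exacts [𝓔.isBimoduleMap_piM K, isBimoduleMap_id _]

/-- The projection to the tensors whose first entry is in `M`. -/
def projF (n : ℕ) : CycTensor (𝓔.base K) n →ₗ[k] CycTensor (𝓔.base K) n :=
  tmap 𝓔.firstProj (fun l => 𝓔.isBimoduleMap_firstProj K l)

lemma projF_mem_F {n : ℕ} (z : CycTensor (𝓔.base K) n) : 𝓔.projF K n z ∈ 𝓔.F K n := by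
  refine mem_of_forall_cls (N := (𝓔.F K n).comap (𝓔.projF K n)) (fun x => ?_) z
  rw [Submodule.mem_comap, projF, tmap_cls]
  exact 𝓔.cls_mem_F K (by simpa [firstProj] using 𝓔.piM_mem (x 0))

lemma projF_of_mem_F {n : ℕ} {z : CycTensor (𝓔.base K) n} (hz : z ∈ 𝓔.F K n) :
    𝓔.projF K n z = z := by
  suffices h : 𝓔.F K n ≤ LinearMap.eqLocus (𝓔.projF K n) LinearMap.id from h hz
  refine 𝓔.F_le K fun x j h0 _ => ?_
  rw [LinearMap.mem_eqLocus, projF, tmap_cls, LinearMap.id_apply]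
  congr 1
  funext l
  unfold firstProj
  split_ifs with h
  · rw [h, 𝓔.piM_of_mem_M h0]
  · rfl

lemma projF_Phi {n : ℕ} (z : CycTensor (𝓔.base K) n) : 𝓔.projF K (n + 1) (𝓔.Phi K n z) = 0 := by
  refine eq_zero_of_mem_unitSpan _ (fun x => ?_) (𝓔.Phi_mem_unitSpan K z)
  rw [projF, tmap_cls, (cls (𝓔.base K) (n + 1)).map_coord_zero 0]
  simp [firstProj, 𝓔.piM_one]

/-- The projections to `A` in position `0` and to `M` in position `1`. -/
def epsProj {n : ℕ} (l : Fin (n + 2)) : E →ₗ[k] E :=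
  if l = 0 then 𝓔.piA else if l = 1 then 𝓔.piM else LinearMap.id

lemma isBimoduleMap_epsProj {n : ℕ} (l : Fin (n + 2)) :
    IsBimoduleMap (𝓔.base K) (𝓔.epsProj l) := by
  unfold epsProj
  split_ifs
  exacts [𝓔.isBimoduleMap_piA K, 𝓔.isBimoduleMap_piM K, isBimoduleMap_id _]

/-- The multilinear form of `eps`. -/
def epsMul (n : ℕ) : MultilinearMap k (fun _ : Fin (n + 2) => E) (CycTensor (𝓔.base K) n) :=
  (face (𝓔.base K) 𝓔.dot n 0).compLinearMap fun l => 𝓔.epsProj l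

lemma epsMul_apply {n : ℕ} (x : Fin (n + 2) → E) :
    𝓔.epsMul K n x = cls (𝓔.base K) n (contr 𝓔.dot 0 fun l => 𝓔.epsProj l (x l)) := rfl

lemma epsMul_descends (n : ℕ) : Descends (𝓔.base K) (𝓔.epsMul K n) where
  balanced x j c hc := by
    rw [epsMul_apply, epsMul_apply]
    convert face_balanced (𝓔.isProd_dot K) 0 (fun l => 𝓔.epsProj l (x l)) j c hc using 3
    · funext l
      rw [Function.update_apply, Function.update_apply]
      split_ifs with h
      · rw [h, (𝓔.isBimoduleMap_epsProj K j).right c hc]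
      · rfl
    · funext l
      rw [Function.update_apply, Function.update_apply]
      split_ifs with h
      · rw [h, (𝓔.isBimoduleMap_epsProj K _).left c hc]
      · rfl
  degen x j hj hx := by
    rw [epsMul_apply]
    by_cases h1 : j = 1
    · rw [(cls (𝓔.base K) n).map_coord_zero 0]
      subst h1
      simp [contr, epsProj, 𝓔.piM_of_mem hx]
    · refine cls_contr_degen _ 0 _ hj ?_ ?_ ?_
      · simp only [epsProj, hj, h1, if_false]
        exact hx
      · exact fun h => hj (Fin.ext (h.trans (by simp)))
      · exact fun h => h1 (Fin.ext (h.trans (by simp)))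

/-- The map `x₀ ⊗ x₁ ⊗ ⋯ ⊗ xₙ ↦ x₀ x₁ ⊗ x₂ ⊗ ⋯ ⊗ xₙ` for `x₀ ∈ A`, `x₁ ∈ M`, which is zero if `x₀ ∈ M`
or `x₁ ∈ A`. -/
def eps (n : ℕ) : CycTensor (𝓔.base K) (n + 1) →ₗ[k] CycTensor (𝓔.base K) n :=
  descend (𝓔.epsMul K n) (𝓔.epsMul_descends K n)

lemma eps_cls {n : ℕ} (x : Fin (n + 2) → E) : 𝓔.eps K n (cls (𝓔.base K) (n + 1) x) =
    cls (𝓔.base K) n (contr 𝓔.dot 0 fun l => 𝓔.epsProj l (x l)) := by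
  rw [eps, descend_cls, epsMul_apply]

lemma eps_mem_F {n : ℕ} (z : CycTensor (𝓔.base K) (n + 1)) : 𝓔.eps K n z ∈ 𝓔.F K n := by
  refine mem_of_forall_cls (N := (𝓔.F K n).comap (𝓔.eps K n)) (fun x => ?_) z
  rw [Submodule.mem_comap, eps_cls]
  refine 𝓔.cls_mem_F K ?_
  have : contr 𝓔.dot 0 (fun l => 𝓔.epsProj l (x l)) 0 = 𝓔.dot (𝓔.piA (x 0)) (𝓔.piM (x 1)) := by
    simp [contr, epsProj]
  rw [this, dot_apply, 𝓔.piM_of_mem_A (𝓔.piA_mem _), zero_mul, sub_zero]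
  exact 𝓔.mul_mem_M_right (𝓔.piM_mem _)

lemma eps_of_mem_F {n : ℕ} {z : CycTensor (𝓔.base K) (n + 1)} (hz : z ∈ 𝓔.F K (n + 1)) :
    𝓔.eps K n z = 0 := by
  suffices h : 𝓔.F K (n + 1) ≤ LinearMap.ker (𝓔.eps K n) from h hz
  refine 𝓔.F_le K fun x j h0 _ => ?_
  rw [LinearMap.mem_ker, eps_cls, (cls (𝓔.base K) n).map_coord_zero 0]
  simp [contr, epsProj, 𝓔.piA_of_mem_M h0]

/-- Only the insertion s = n puts x₀ ∈ M right behind the unit. For j ≤ s < n that place is taken by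
xₛ₊₁ ∈ A, which the projection to M kills. -/
lemma eps_Phi {n : ℕ} {z : CycTensor (𝓔.base K) n} (hz : z ∈ 𝓔.F K n) :
    𝓔.eps K n (𝓔.Phi K n z) = z := by
  suffices h : 𝓔.F K n ≤ LinearMap.eqLocus (𝓔.eps K n ∘ₗ 𝓔.Phi K n) LinearMap.id from h hz
  refine 𝓔.F_le K fun x j h0 hj => ?_
  rw [LinearMap.mem_eqLocus, LinearMap.comp_apply, LinearMap.id_apply, Phi_cls_of_isLast K hj,
    map_sum, Finset.sum_eq_single (Fin.last n)]
  · rw [if_pos (by rw [Fin.val_last]; omega), sins, map_smul, eps_cls, Fin.last_add_one, rot_zero,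
      Fin.val_last, mul_comm, (Nat.even_mul_succ_self n).neg_one_pow, one_smul]
    congr 1
    funext l
    unfold contr
    by_cases hl : l = 0
    · subst hl
      simp only [lt_self_iff_false, if_false, if_true, Fin.castSucc_zero, Fin.cons_zero,
        Fin.cons_succ]
      simp [epsProj, 𝓔.piA_one, 𝓔.piM_of_mem_M h0, dot_apply, 𝓔.piM_one]
    · have h1 : l.succ ≠ 1 := by
        rw [← Fin.succ_zero_eq_one]
        exact fun h => hl (Fin.succ_injective _ h)
      simp only [Fin.not_lt_zero, if_false, hl, Fin.cons_succ, epsProj, Fin.succ_ne_zero, h1,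
        LinearMap.id_apply]
  · intro s _ hs
    split_ifs with hjs
    · rw [sins, map_smul, eps_cls, (cls (𝓔.base K) n).map_coord_zero 0, smul_zero]
      have hs' : (s : ℕ) ≠ n := fun h => hs (Fin.ext h)
      have hA : x (s + 1) ∈ 𝓔.copyA := hj.mem_A _ (by
        rw [Fin.lt_def, val_add_one', if_neg hs']; omega)
      unfold contr
      simp only [lt_self_iff_false, if_false, if_true, Fin.cons_succ]
      simp [epsProj, rot, 𝓔.piM_of_mem_A hA]
    · rw [map_zero]
  · simp

lemma Phi_injOn_F {n : ℕ} {z : CycTensor (𝓔.base K) n} (hz : z ∈ 𝓔.F K n)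
    (h : 𝓔.Phi K n z = 0) : z = 0 := by
  rw [← 𝓔.eps_Phi K hz, h, map_zero]

end retraction

/-! ### The homotopy formula and the factorization B = Phi N -/

section identities

lemma srot_mem_F {n : ℕ} {x : Fin (n + 1) → E} {j : Fin (n + 1)} (h : x j ∈ 𝓔.M) :
    srot (𝓔.base K) n j x ∈ 𝓔.F K n := by
  rw [srot, Fin.ofNat_val_eq_self]
  exact Submodule.smul_mem _ _ (𝓔.cls_mem_F K (by simpa [rot] using h))

lemma b_add_d (n : ℕ) : 𝓔.b K n + 𝓔.d K n = hochschild (𝓔.base K) n := by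
  have h : ∀ (j : Fin (n + 1)) (x : Fin (n + 2) → E),
      cls (𝓔.base K) n (contr (LinearMap.mul k E) j x) =
        cls (𝓔.base K) n (contr 𝓔.dot j x) + cls (𝓔.base K) n (contr 𝓔.tri j x) := by
    intro j x
    have e : ∀ μ : E →ₗ[k] E →ₗ[k] E, contr μ j x =
        Function.update (contr 𝓔.dot j x) j (μ (x j.castSucc) (x j.succ)) := by
      intro μ
      funext l
      rw [Function.update_apply]
      unfold contr
      split_ifs with h1 h2 h3
      · rw [h2] at h1; exact absurd h1 (lt_irrefl _)
      · rfl
      · rw [h3]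
      · rfl
    rw [e 𝓔.tri, e (LinearMap.mul k E)]
    conv_rhs => enter [1]; rw [e 𝓔.dot]
    rw [← MultilinearMap.map_update_add]
    simp [dot]
  refine cyc_hom_ext fun x => ?_
  rw [LinearMap.add_apply, b, d, hochschild, descend_cls, descend_cls, descend_cls]
  simp only [hochMul_apply, h, smul_add, Finset.sum_add_distrib]
  abel

lemma d_eq (n : ℕ) (x : Fin (n + 2) → E) : 𝓔.d K n (cls (𝓔.base K) (n + 1) x) =
    𝓔.d' K n (cls (𝓔.base K) (n + 1) x) +
      (-1 : k) ^ (n + 1) • cls (𝓔.base K) n (contr 𝓔.tri 0 (rot (Fin.last (n + 1)) x)) := by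
  rw [d, d', descend_cls, descend_cls, hochMul_apply, hochMul'_apply]

/-- The face removed in `hochschild_Phi_cls` is the cyclic term by which d exceeds d': if the last
entry is in M, both factors x₀ and xₙ₊₁ are in M; if it is in A, nothing is removed and the cyclic
term is 0. -/
lemma hochschild_Phi_of_mem_F {n : ℕ} {z : CycTensor (𝓔.base K) (n + 1)}
    (hz : z ∈ 𝓔.F K (n + 1)) :
    hochschild (𝓔.base K) (n + 1) (𝓔.Phi K (n + 1) z) =
      z - 𝓔.t K (n + 1) z - 𝓔.Phi K n (𝓔.b K n z + 𝓔.d' K n z) := by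
  suffices h : 𝓔.F K (n + 1) ≤ LinearMap.eqLocus
      (hochschild (𝓔.base K) (n + 1) ∘ₗ 𝓔.Phi K (n + 1))
      (LinearMap.id - 𝓔.t K (n + 1) - 𝓔.Phi K n ∘ₗ (𝓔.b K n + 𝓔.d' K n)) from h hz
  refine 𝓔.F_le K fun x j h0 hj => ?_
  rw [LinearMap.mem_eqLocus, LinearMap.comp_apply, hochschild_Phi_cls K hj]
  simp only [LinearMap.sub_apply, LinearMap.comp_apply, LinearMap.add_apply, LinearMap.id_apply]
  congr 2
  rw [← b_add_d, LinearMap.add_apply, d_eq]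
  have e : ∀ a c q r : CycTensor (𝓔.base K) n, q = r → a + (c + q) - r = a + c := by
    rintro a c q _ rfl; abel
  refine e _ _ _ _ ?_
  split_ifs with hl
  · congr 2
    funext l
    rw [contr_zero_rot_last]
    unfold cface
    rw [if_pos (Fin.val_last _)]
    subst hl
    simp only [tri_apply, 𝓔.piM_of_mem_M h0, 𝓔.piM_of_mem_M hj.mem]
  · rw [(cls (𝓔.base K) n).map_coord_zero 0, smul_zero]
    rw [contr_zero_rot_last, if_pos (by simp), tri_apply,
      𝓔.piM_of_mem_A (hj.mem_A _ (Fin.lt_last_iff_ne_last.2 hl)), zero_mul]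

lemma hochschild_Phi_zero (z : CycTensor (𝓔.base K) 0) :
    hochschild (𝓔.base K) 0 (𝓔.Phi K 0 z) = 0 := by
  suffices h : hochschild (𝓔.base K) 0 ∘ₗ 𝓔.Phi K 0 = 0 from LinearMap.congr_fun h z
  refine cyc_hom_ext fun x => ?_
  rw [LinearMap.comp_apply, Phi_cls, Fin.sum_univ_one, hochschild_sins_zero]
  rfl

lemma t_zero {z : CycTensor (𝓔.base K) 0} (hz : z ∈ 𝓔.F K 0) : 𝓔.t K 0 z = z := by
  suffices h : 𝓔.F K 0 ≤ LinearMap.eqLocus (𝓔.t K 0) LinearMap.id from h hz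
  refine 𝓔.F_le K fun x j h0 hj => ?_
  rw [LinearMap.mem_eqLocus, t_cls_of_isLast K hj, Fin.eq_zero j]
  simp

/-- The span of the tensors whose first entry is in `M` and of their images under `Phi`. -/
def imTheta : (n : ℕ) → Submodule k (CycTensor (𝓔.base K) n)
  | 0 => 𝓔.F K 0
  | n + 1 => 𝓔.F K (n + 1) ⊔ (𝓔.F K n).map (𝓔.Phi K n)

/-- On a tensor with a last entry xⱼ in M, `hochschild_Phi_cls` reduces the expression to -t x plus
`Phi` of the removed wrap-around face. The first tensor starts with xⱼ, the second is `Phi` of one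
starting with a product that has a factor in M. The condition x₀ ∈ M is not needed. -/
lemma homotopy_mem {n : ℕ} {z : CycTensor (𝓔.base K) (n + 1)}
    (hz : mapCyc 𝓔.p (𝓔.p_base K) (n + 1) z = 0) :
    hochschild (𝓔.base K) (n + 1) (𝓔.Phi K (n + 1) z) +
      𝓔.Phi K n (hochschild (𝓔.base K) n z) - z ∈ 𝓔.imTheta K (n + 1) := by
  set f : CycTensor (𝓔.base K) (n + 1) →ₗ[k] CycTensor (𝓔.base K) (n + 1) :=
    hochschild (𝓔.base K) (n + 1) ∘ₗ 𝓔.Phi K (n + 1) + 𝓔.Phi K n ∘ₗ hochschild (𝓔.base K) n -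
      LinearMap.id with hf
  have key : ∀ (j : Fin (n + 2)) (y : CycTensor (𝓔.base K) (n + 1)),
      f (tmap (𝓔.lastProj j) (fun l => 𝓔.isBimoduleMap_lastProj K j l) y) ∈ 𝓔.imTheta K (n + 1) := by
    intro j y
    refine mem_of_forall_cls (N := (𝓔.imTheta K (n + 1)).comap
      (f ∘ₗ tmap (𝓔.lastProj j) (fun l => 𝓔.isBimoduleMap_lastProj K j l))) (fun x => ?_) y
    rw [Submodule.mem_comap, LinearMap.comp_apply, tmap_cls]
    have h := isLast_lastProj (𝓔 := 𝓔) x j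
    generalize (fun l => 𝓔.lastProj j l (x l)) = x' at h ⊢
    simp only [hf, LinearMap.sub_apply, LinearMap.add_apply, LinearMap.comp_apply,
      LinearMap.id_apply]
    rw [hochschild_Phi_cls K h, map_sub]
    have e : ∀ a t p q : CycTensor (𝓔.base K) (n + 1), a - t - (p - q) + p - a = -t + q := by
      intros; abel
    rw [e]
    refine Submodule.add_mem_sup (Submodule.neg_mem _ ?_) (Submodule.mem_map_of_mem ?_)
    · rw [t_cls_of_isLast K h]
      exact 𝓔.srot_mem_F K h.mem
    · split_ifs with hj
      · refine Submodule.smul_mem _ _ (𝓔.cls_mem_F K ?_)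
        have hm := h.mem
        rw [hj] at hm
        simpa [cface] using 𝓔.mul_mem_M_left hm
      · exact zero_mem _
  have := Submodule.sum_mem (𝓔.imTheta K (n + 1)) fun j (_ : j ∈ Finset.univ) => key j z
  rwa [← map_sum, 𝓔.sum_lastProj_of_mem_ker K hz] at this

/-- In degree 0 the last entry in M is also the first one, so the comparison map misses nothing
there. -/
lemma mem_F_zero {z : CycTensor (𝓔.base K) 0} (hz : mapCyc 𝓔.p (𝓔.p_base K) 0 z = 0) :
    z ∈ 𝓔.F K 0 := by
  rw [← 𝓔.sum_lastProj_of_mem_ker K hz]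
  refine Submodule.sum_mem _ fun j _ => ?_
  refine mem_of_forall_cls (N := (𝓔.F K 0).comap
    (tmap (𝓔.lastProj j) (fun l => 𝓔.isBimoduleMap_lastProj K j l))) (fun x => ?_) z
  rw [Submodule.mem_comap, tmap_cls]
  have h := (isLast_lastProj (𝓔 := 𝓔) x j).mem
  rw [Fin.eq_zero j] at h ⊢
  exact 𝓔.cls_mem_F K h

/-- `N = id + t + ⋯ + t^w`. -/
def Nw (n w : ℕ) : CycTensor (𝓔.base K) n →ₗ[k] CycTensor (𝓔.base K) n :=
  ∑ l ∈ Finset.range (w + 1), 𝓔.t K n ^ l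

/-- By `t_srot` each further power of t moves the cut down to the next index with entry in M, and
`Phi` fills the gap just crossed. There are as many powers as such indices below r, and x₀ ∈ M makes
the gaps reach down to 0. The induction passes from r to the largest such index below r. -/
lemma sum_Phi_t_pow_srot {n : ℕ} {x : Fin (n + 1) → E} {c : Fin (n + 1) → ℕ}
    (hx : ∀ l, x l ∈ 𝓔.gr (c l)) (hc : ∀ l, c l ≤ 1) (h0 : c 0 = 1) (r : ℕ) (hr : r ≤ n + 1) :
    𝓔.Phi K n (∑ l ∈ Finset.range (∑ i : Fin (n + 1), if (i : ℕ) < r then c i else 0),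
        (𝓔.t K n ^ l) (srot (𝓔.base K) n r x)) =
      ∑ s : Fin (n + 1), if (s : ℕ) < r then sins (𝓔.base K) n s x else 0 := by
  induction r using Nat.strong_induction_on with
  | _ r ih =>
  rcases Nat.eq_zero_or_pos r with rfl | hpos
  · simp
  classical
  have hne : (Finset.univ.filter fun l : Fin (n + 1) => c l = 1 ∧ (l : ℕ) < r).Nonempty :=
    ⟨0, by simp [h0, hpos]⟩
  obtain ⟨j, hj⟩ : ∃ j, j = Finset.max' _ hne := ⟨_, rfl⟩
  have hjm := Finset.max'_mem _ hne
  rw [← hj, Finset.mem_filter] at hjm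
  obtain ⟨-, hj1, hjr⟩ := hjm
  have hzero : ∀ l : Fin (n + 1), (j : ℕ) < l → (l : ℕ) < r → c l = 0 := by
    intro l hl hlr
    have hl' : c l ≠ 1 := fun h' => by
      have := Finset.le_max' (Finset.univ.filter fun l : Fin (n + 1) => c l = 1 ∧ (l : ℕ) < r) l
        (by simp [h', hlr])
      rw [← hj, Fin.le_def] at this
      omega
    have := hc l
    omega
  have hsum : (∑ i : Fin (n + 1), if (i : ℕ) < r then c i else 0) =
      (∑ i : Fin (n + 1), if (i : ℕ) < j then c i else 0) + 1 := by
    have : ∀ i : Fin (n + 1), (if (i : ℕ) < r then c i else 0) =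
        (if (i : ℕ) < j then c i else 0) + if i = j then 1 else 0 := by
      intro i
      by_cases hij : i = j
      · subst hij; simp [hjr, hj1]
      · have hij' : (i : ℕ) ≠ j := fun h => hij (Fin.ext h)
        rw [if_neg hij, add_zero]
        by_cases h1 : (i : ℕ) < j
        · rw [if_pos h1, if_pos (by omega)]
        · rw [if_neg h1]
          split_ifs with h2
          · exact hzero i (by omega) h2
          · rfl
    simp only [this, Finset.sum_add_distrib, Finset.sum_ite_eq', Finset.mem_univ, if_true]
  obtain ⟨ht, hP⟩ := t_srot (𝓔 := 𝓔) K (x := x) (j := j) (r := r) hr hjr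
    (fun l hl => by
      obtain rfl : l = j := Fin.ext hl
      have := hx l; rwa [hj1] at this)
    (fun l hl hlr => by have := hx l; rwa [hzero l hl hlr] at this)
  -- The power t⁰ accounts for j ≤ s < r; the remaining powers form the same sum with j in place of
  -- r.
  rw [hsum, Finset.sum_range_succ', map_add, pow_zero, Module.End.one_apply, hP]
  have hstep : ∀ l, (𝓔.t K n ^ (l + 1)) (srot (𝓔.base K) n r x) =
      (𝓔.t K n ^ l) (srot (𝓔.base K) n j x) := by
    intro l
    rw [pow_succ, Module.End.mul_apply, ht]
  simp only [hstep]
  rw [ih j hjr (by omega), ← Finset.sum_add_distrib]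
  refine Finset.sum_congr rfl fun s _ => ?_
  split_ifs <;> first | omega | simp

/-- The case r = n + 1, in which the rotation is a full turn and the w + 1 entries in M match the w
+ 1 summands of N. -/
lemma connes_eq_Phi_N {n w : ℕ} {z : CycTensor (𝓔.base K) n} (hz : z ∈ 𝓔.X K n w) :
    connes (𝓔.base K) n z = 𝓔.Phi K n (𝓔.Nw K n w z) := by
  suffices h : 𝓔.X K n w ≤ LinearMap.eqLocus (connes (𝓔.base K) n) (𝓔.Phi K n ∘ₗ 𝓔.Nw K n w) from h hz
  refine 𝓔.X_le K fun x c hx h0 hw => ?_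
  rw [LinearMap.mem_eqLocus, LinearMap.comp_apply]
  by_cases hc : ∀ l, c l ≤ 1
  · have h := 𝓔.sum_Phi_t_pow_srot K hx hc h0 (n + 1) le_rfl
    simp only [Fin.is_lt, if_true, srot_full, hw] at h
    rw [connes_cls, ← h, Nw, LinearMap.sum_apply]
  · push Not at hc
    obtain ⟨l, hl⟩ := hc
    have hl' := hx l
    obtain ⟨m, hm⟩ := Nat.exists_eq_add_of_le' (show 2 ≤ c l by omega)
    rw [hm] at hl'
    rw [(cls (𝓔.base K) n).map_coord_zero l ((Submodule.mem_bot k).1 hl')]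
    simp

end identities

/-! ### Compatibility of the operators with the grading -/

section graded

/-- For w = 0 the only entry in M is x₀, whereas ▽ needs two. -/
lemma d_d'_eq_zero {n : ℕ} {z : CycTensor (𝓔.base K) (n + 1)} (hz : z ∈ 𝓔.X K (n + 1) 0) :
    𝓔.d K n z = 0 ∧ 𝓔.d' K n z = 0 := by
  suffices h : 𝓔.X K (n + 1) 0 ≤ LinearMap.ker (𝓔.d K n) ⊓ LinearMap.ker (𝓔.d' K n) from h hz
  refine 𝓔.X_le K fun x c hx h0 hc => ?_
  have hA : ∀ l : Fin (n + 1), 𝓔.piM (x l.succ) = 0 := by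
    intro l
    rw [Fin.sum_univ_succ, h0, zero_add, add_eq_left, Finset.sum_eq_zero_iff] at hc
    have := hx l.succ
    rw [hc l (Finset.mem_univ _)] at this
    exact 𝓔.piM_of_mem_A this
  have h' : 𝓔.d' K n (cls (𝓔.base K) (n + 1) x) = 0 := by
    rw [d', descend_cls, hochMul'_apply]
    refine Finset.sum_eq_zero fun j _ => ?_
    rw [(cls (𝓔.base K) n).map_coord_zero j, smul_zero]
    simp [contr, tri_apply, hA]
  refine ⟨?_, h'⟩
  rw [SetLike.mem_coe, LinearMap.mem_ker, d_eq, h', zero_add, (cls (𝓔.base K) n).map_coord_zero 0, smul_zero]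
  rw [contr_zero_rot_last, if_pos (by simp), tri_apply, ← Fin.succ_last, hA, zero_mul]

lemma b_mem_F {n : ℕ} {z : CycTensor (𝓔.base K) (n + 1)} (hz : z ∈ 𝓔.F K (n + 1)) :
    𝓔.b K n z ∈ 𝓔.F K n := by
  suffices h : 𝓔.F K (n + 1) ≤ (𝓔.F K n).comap (𝓔.b K n) from h hz
  exact iSup_le fun w z hz => 𝓔.X_le_F K n w (𝓔.b_mem K n w z hz)

lemma d_mem_F {n : ℕ} {z : CycTensor (𝓔.base K) (n + 1)} (hz : z ∈ 𝓔.F K (n + 1)) :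
    𝓔.d K n z ∈ 𝓔.F K n := by
  suffices h : 𝓔.F K (n + 1) ≤ (𝓔.F K n).comap (𝓔.d K n) from h hz
  refine iSup_le fun w z hz => ?_
  cases w with
  | zero => rw [Submodule.mem_comap, (𝓔.d_d'_eq_zero K hz).1]; exact zero_mem _
  | succ w => exact 𝓔.X_le_F K n w (𝓔.d_mem K n w z hz)

lemma d'_mem_F {n : ℕ} {z : CycTensor (𝓔.base K) (n + 1)} (hz : z ∈ 𝓔.F K (n + 1)) :
    𝓔.d' K n z ∈ 𝓔.F K n := by
  suffices h : 𝓔.F K (n + 1) ≤ (𝓔.F K n).comap (𝓔.d' K n) from h hz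
  refine iSup_le fun w z hz => ?_
  cases w with
  | zero => rw [Submodule.mem_comap, (𝓔.d_d'_eq_zero K hz).2]; exact zero_mem _
  | succ w => exact 𝓔.X_le_F K n w (𝓔.d'_mem K n w z hz)

lemma t_mem_F {n : ℕ} {z : CycTensor (𝓔.base K) n} (hz : z ∈ 𝓔.F K n) :
    𝓔.t K n z ∈ 𝓔.F K n := by
  suffices h : 𝓔.F K n ≤ (𝓔.F K n).comap (𝓔.t K n) from h hz
  exact iSup_le fun w z hz => 𝓔.X_le_F K n w (𝓔.t_mem K n w z hz)

lemma gradeProj_b {n : ℕ} (w : ℕ) {z : CycTensor (𝓔.base K) (n + 1)} (hz : z ∈ 𝓔.F K (n + 1)) :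
    𝓔.gradeProj K n w (𝓔.b K n z) = 𝓔.b K n (𝓔.gradeProj K (n + 1) w z) := by
  suffices h : 𝓔.F K (n + 1) ≤ LinearMap.eqLocus (𝓔.gradeProj K n w ∘ₗ 𝓔.b K n)
    (𝓔.b K n ∘ₗ 𝓔.gradeProj K (n + 1) w) from h hz
  refine iSup_le fun w' z hz => ?_
  rw [LinearMap.mem_eqLocus, LinearMap.comp_apply, LinearMap.comp_apply, 𝓔.gradeProj_of_mem K hz,
    𝓔.gradeProj_of_mem K (𝓔.b_mem K n w' z hz)]
  split_ifs
  · rfl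
  · rw [map_zero]

lemma gradeProj_t {n : ℕ} (w : ℕ) {z : CycTensor (𝓔.base K) n} (hz : z ∈ 𝓔.F K n) :
    𝓔.gradeProj K n w (𝓔.t K n z) = 𝓔.t K n (𝓔.gradeProj K n w z) := by
  suffices h : 𝓔.F K n ≤ LinearMap.eqLocus (𝓔.gradeProj K n w ∘ₗ 𝓔.t K n)
    (𝓔.t K n ∘ₗ 𝓔.gradeProj K n w) from h hz
  refine iSup_le fun w' z hz => ?_
  rw [LinearMap.mem_eqLocus, LinearMap.comp_apply, LinearMap.comp_apply, 𝓔.gradeProj_of_mem K hz,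
    𝓔.gradeProj_of_mem K (𝓔.t_mem K n w' z hz)]
  split_ifs
  · rfl
  · rw [map_zero]

lemma gradeProj_d {n : ℕ} (w : ℕ) {z : CycTensor (𝓔.base K) (n + 1)} (hz : z ∈ 𝓔.F K (n + 1)) :
    𝓔.gradeProj K n w (𝓔.d K n z) = 𝓔.d K n (𝓔.gradeProj K (n + 1) (w + 1) z) := by
  suffices h : 𝓔.F K (n + 1) ≤ LinearMap.eqLocus (𝓔.gradeProj K n w ∘ₗ 𝓔.d K n)
    (𝓔.d K n ∘ₗ 𝓔.gradeProj K (n + 1) (w + 1)) from h hz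
  refine iSup_le fun w' z hz => ?_
  rw [LinearMap.mem_eqLocus, LinearMap.comp_apply, LinearMap.comp_apply, 𝓔.gradeProj_of_mem K hz]
  cases w' with
  | zero =>
    rw [(𝓔.d_d'_eq_zero K hz).1, map_zero]
    split_ifs
    · rw [(𝓔.d_d'_eq_zero K hz).1]
    · rw [map_zero]
  | succ w' =>
    rw [𝓔.gradeProj_of_mem K (𝓔.d_mem K n w' z hz)]
    split_ifs <;> first | omega | rfl

lemma gradeProj_d' {n : ℕ} (w : ℕ) {z : CycTensor (𝓔.base K) (n + 1)} (hz : z ∈ 𝓔.F K (n + 1)) :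
    𝓔.gradeProj K n w (𝓔.d' K n z) = 𝓔.d' K n (𝓔.gradeProj K (n + 1) (w + 1) z) := by
  suffices h : 𝓔.F K (n + 1) ≤ LinearMap.eqLocus (𝓔.gradeProj K n w ∘ₗ 𝓔.d' K n)
    (𝓔.d' K n ∘ₗ 𝓔.gradeProj K (n + 1) (w + 1)) from h hz
  refine iSup_le fun w' z hz => ?_
  rw [LinearMap.mem_eqLocus, LinearMap.comp_apply, LinearMap.comp_apply, 𝓔.gradeProj_of_mem K hz]
  cases w' with
  | zero =>
    rw [(𝓔.d_d'_eq_zero K hz).2, map_zero]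
    split_ifs
    · rw [(𝓔.d_d'_eq_zero K hz).2]
    · rw [map_zero]
  | succ w' =>
    rw [𝓔.gradeProj_of_mem K (𝓔.d'_mem K n w' z hz)]
    split_ifs <;> first | omega | rfl

lemma t_pow_mem {n w : ℕ} (l : ℕ) {z : CycTensor (𝓔.base K) n} (hz : z ∈ 𝓔.X K n w) :
    (𝓔.t K n ^ l) z ∈ 𝓔.X K n w := by
  induction l with
  | zero => simpa using hz
  | succ l ih => rw [pow_succ', Module.End.mul_apply]; exact 𝓔.t_mem K n w _ ih

lemma Nw_mem {n w : ℕ} (w' : ℕ) {z : CycTensor (𝓔.base K) n} (hz : z ∈ 𝓔.X K n w) :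
    𝓔.Nw K n w' z ∈ 𝓔.X K n w := by
  rw [Nw, LinearMap.sum_apply]
  exact Submodule.sum_mem _ fun l _ => 𝓔.t_pow_mem K l hz

end graded

/-! ### Relations between b, d, d', t and N -/

section relations

lemma hochschild_eq {n : ℕ} (z : CycTensor (𝓔.base K) (n + 1)) :
    hochschild (𝓔.base K) n z = 𝓔.b K n z + 𝓔.d K n z := by
  rw [← b_add_d, LinearMap.add_apply]

/-- An element of `F` plus an element of `Φ(F)` is zero only if both are zero. -/
lemma eq_zero_of_add_Phi {n : ℕ} {y : CycTensor (𝓔.base K) (n + 1)} {z : CycTensor (𝓔.base K) n}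
    (hy : y ∈ 𝓔.F K (n + 1)) (hz : z ∈ 𝓔.F K n) (h : y + 𝓔.Phi K n z = 0) : y = 0 ∧ z = 0 := by
  have hy0 : y = 0 := by
    have := congrArg (𝓔.projF K (n + 1)) h
    rwa [map_add, 𝓔.projF_of_mem_F K hy, projF_Phi, add_zero, map_zero] at this
  refine ⟨hy0, 𝓔.Phi_injOn_F K hz ?_⟩
  rwa [hy0, zero_add] at h

variable {n : ℕ} {w : ℕ}

/-- The three homogeneous parts of ∂² = 0. The projections to w + 1 and to w entries in M isolate b²
and bd + db, and what is left over is d². -/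
lemma bd_bd {z : CycTensor (𝓔.base K) (n + 2)} (hz : z ∈ 𝓔.X K (n + 2) w) :
    𝓔.b K n (𝓔.b K (n + 1) z) = 0 ∧
    𝓔.b K n (𝓔.d K (n + 1) z) + 𝓔.d K n (𝓔.b K (n + 1) z) = 0 ∧
    𝓔.d K n (𝓔.d K (n + 1) z) = 0 := by
  have hF := 𝓔.X_le_F K _ _ hz
  have hb := 𝓔.b_mem_F K hF
  have hd := 𝓔.d_mem_F K hF
  have h := hochschild_hochschild (𝓔.base K) n z
  simp only [hochschild_eq, map_add] at h
  have h1 := congrArg (𝓔.gradeProj K n (w + 1)) h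
  have h2 := congrArg (𝓔.gradeProj K n w) h
  simp only [map_add, 𝓔.gradeProj_b K _ hF, 𝓔.gradeProj_b K _ hb, 𝓔.gradeProj_b K _ hd,
    𝓔.gradeProj_d K _ hF, 𝓔.gradeProj_d K _ hb, 𝓔.gradeProj_d K _ hd,
    𝓔.gradeProj_of_mem K hz, map_zero] at h1 h2
  have hw : ¬ w + 1 + 1 = w := by omega
  simp [hw] at h1 h2
  rw [h1] at h
  have e : 𝓔.b K n (𝓔.d K (n + 1) z) + 𝓔.d K n (𝓔.b K (n + 1) z) = 0 := by rwa [add_comm]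
  refine ⟨h1, e, ?_⟩
  have h3 : (𝓔.b K n (𝓔.d K (n + 1) z) + 𝓔.d K n (𝓔.b K (n + 1) z)) +
      𝓔.d K n (𝓔.d K (n + 1) z) = 0 := by rw [← h]; abel
  rwa [e, zero_add] at h3

lemma hochschild_sub_t_aux {z : CycTensor (𝓔.base K) (n + 1)} (hz : z ∈ 𝓔.F K (n + 1)) :
    hochschild (𝓔.base K) n (z - 𝓔.t K (n + 1) z) =
      hochschild (𝓔.base K) n (𝓔.Phi K n (𝓔.b K n z + 𝓔.d' K n z)) := by
  have h := hochschild_hochschild (𝓔.base K) n (𝓔.Phi K (n + 1) z)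
  rwa [𝓔.hochschild_Phi_of_mem_F K hz, map_sub, sub_eq_zero] at h

/-- Applying ∂ to the homotopy formula for z, and that formula once more to (b + d')z, gives an
equation between elements of F + Phi(F). Its part in `F` is ∂(id - t) = (id - t)(b + d'), its part
in Phi(F) is (b + d')² = 0. -/
lemma hochschild_sub_t_succ {z : CycTensor (𝓔.base K) (n + 2)} (hz : z ∈ 𝓔.F K (n + 2)) :
    hochschild (𝓔.base K) (n + 1) (z - 𝓔.t K (n + 2) z) =
      (𝓔.b K (n + 1) z + 𝓔.d' K (n + 1) z) -
        𝓔.t K (n + 1) (𝓔.b K (n + 1) z + 𝓔.d' K (n + 1) z) ∧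
    𝓔.b K n (𝓔.b K (n + 1) z + 𝓔.d' K (n + 1) z) +
      𝓔.d' K n (𝓔.b K (n + 1) z + 𝓔.d' K (n + 1) z) = 0 := by
  have hy : 𝓔.b K (n + 1) z + 𝓔.d' K (n + 1) z ∈ 𝓔.F K (n + 1) :=
    add_mem (𝓔.b_mem_F K hz) (𝓔.d'_mem_F K hz)
  have h := 𝓔.hochschild_sub_t_aux K hz
  rw [𝓔.hochschild_Phi_of_mem_F K hy, ← sub_eq_zero, ← sub_add] at h
  have hzt : z - 𝓔.t K (n + 2) z ∈ 𝓔.F K (n + 2) := sub_mem hz (𝓔.t_mem_F K hz)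
  obtain ⟨h1, h2⟩ := 𝓔.eq_zero_of_add_Phi K (sub_mem
    (by rw [hochschild_eq]; exact add_mem (𝓔.b_mem_F K hzt) (𝓔.d_mem_F K hzt))
    (sub_mem hy (𝓔.t_mem_F K hy))) (add_mem (𝓔.b_mem_F K hy) (𝓔.d'_mem_F K hy)) h
  exact ⟨sub_eq_zero.1 h1, h2⟩

lemma hochschild_sub_t {z : CycTensor (𝓔.base K) (n + 1)} (hz : z ∈ 𝓔.F K (n + 1)) :
    hochschild (𝓔.base K) n (z - 𝓔.t K (n + 1) z) =
      (𝓔.b K n z + 𝓔.d' K n z) - 𝓔.t K n (𝓔.b K n z + 𝓔.d' K n z) := by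
  cases n with
  | zero =>
    rw [𝓔.hochschild_sub_t_aux K hz, hochschild_Phi_zero,
      𝓔.t_zero K (add_mem (𝓔.b_mem_F K hz) (𝓔.d'_mem_F K hz)), sub_self]
  | succ n => exact (𝓔.hochschild_sub_t_succ K hz).1

lemma bd'_bd' {z : CycTensor (𝓔.base K) (n + 2)} (hz : z ∈ 𝓔.X K (n + 2) w) :
    𝓔.b K n (𝓔.d' K (n + 1) z) + 𝓔.d' K n (𝓔.b K (n + 1) z) = 0 ∧
    𝓔.d' K n (𝓔.d' K (n + 1) z) = 0 := by
  have hF := 𝓔.X_le_F K _ _ hz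
  have hb := 𝓔.b_mem_F K hF
  have hd := 𝓔.d'_mem_F K hF
  have h := (𝓔.hochschild_sub_t_succ K hF).2
  simp only [map_add, (𝓔.bd_bd K hz).1, zero_add] at h
  have h2 := congrArg (𝓔.gradeProj K n w) h
  simp only [map_add, 𝓔.gradeProj_b K _ hF, 𝓔.gradeProj_b K _ hd,
    𝓔.gradeProj_d' K _ hF, 𝓔.gradeProj_d' K _ hb, 𝓔.gradeProj_d' K _ hd,
    𝓔.gradeProj_of_mem K hz, map_zero] at h2
  simp at h2
  refine ⟨h2, ?_⟩
  rwa [← add_assoc, h2, zero_add] at h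

lemma bd_sub_t {z : CycTensor (𝓔.base K) (n + 1)} (hz : z ∈ 𝓔.X K (n + 1) w) :
    𝓔.b K n (z - 𝓔.t K (n + 1) z) = 𝓔.b K n z - 𝓔.t K n (𝓔.b K n z) ∧
    𝓔.d K n (z - 𝓔.t K (n + 1) z) = 𝓔.d' K n z - 𝓔.t K n (𝓔.d' K n z) := by
  have hF := 𝓔.X_le_F K _ _ hz
  have hb := 𝓔.b_mem_F K hF
  have hd := 𝓔.d_mem_F K hF
  have hd' := 𝓔.d'_mem_F K hF
  have ht := 𝓔.t_mem_F K hF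
  have h := 𝓔.hochschild_sub_t K hF
  simp only [hochschild_eq, map_add, map_sub] at h
  have h1 := congrArg (𝓔.gradeProj K n (w + 1)) h
  simp only [map_add, map_sub, 𝓔.gradeProj_b K _ hF, 𝓔.gradeProj_d K _ hF, 𝓔.gradeProj_d' K _ hF,
    𝓔.gradeProj_b K _ ht, 𝓔.gradeProj_d K _ ht, 𝓔.gradeProj_t K _ hF, 𝓔.gradeProj_t K _ hb,
    𝓔.gradeProj_t K _ hd', 𝓔.gradeProj_of_mem K hz] at h1
  simp at h1
  rw [map_sub, map_sub]
  refine ⟨by rw [h1], ?_⟩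
  have e1 : ∀ a c e f g i j l : CycTensor (𝓔.base K) n, a - c = g - j →
      (a - c) + (e - f) = (g + i) - (j + l) → e - f = i - l := by
    intro a c e f g i j l h1 h2
    rw [h1, add_sub_add_comm] at h2
    exact add_left_cancel h2
  refine e1 (𝓔.b K n z) (𝓔.b K n (𝓔.t K (n + 1) z)) _ _ (𝓔.b K n z) _ (𝓔.t K n (𝓔.b K n z)) _
    (by rw [h1]) (Eq.trans ?_ h)
  abel

/-- Substituting B = Phi N into ∂B + B∂ = 0 and applying the homotopy formula to Nz, one reads off
the parts in `F` and in Phi(F). For w = 0 the truncated difference w - 1 is harmless, as dz = 0. -/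
lemma sub_t_Nw_aux {z : CycTensor (𝓔.base K) (n + 1)} (hz : z ∈ 𝓔.X K (n + 1) w) :
    𝓔.Nw K (n + 1) w z - 𝓔.t K (n + 1) (𝓔.Nw K (n + 1) w z) = 0 ∧
    𝓔.b K n (𝓔.Nw K (n + 1) w z) + 𝓔.d' K n (𝓔.Nw K (n + 1) w z) =
      𝓔.Nw K n w (𝓔.b K n z) + 𝓔.Nw K n (w - 1) (𝓔.d K n z) := by
  have hF := 𝓔.X_le_F K _ _ hz
  have hN := 𝓔.Nw_mem K w hz
  have hNF := 𝓔.X_le_F K _ _ hN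
  have hb := 𝓔.b_mem K n w z hz
  have hd : connes (𝓔.base K) n (𝓔.d K n z) = 𝓔.Phi K n (𝓔.Nw K n (w - 1) (𝓔.d K n z)) ∧
      𝓔.Nw K n (w - 1) (𝓔.d K n z) ∈ 𝓔.F K n := by
    cases w with
    | zero => rw [(𝓔.d_d'_eq_zero K hz).1, map_zero, map_zero, map_zero]; exact ⟨rfl, zero_mem _⟩
    | succ w =>
      have hd := 𝓔.d_mem K n w z hz
      exact ⟨𝓔.connes_eq_Phi_N K hd, 𝓔.X_le_F K _ _ (𝓔.Nw_mem K _ hd)⟩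
  have h := hochschild_connes (𝓔.base K) n z
  rw [𝓔.connes_eq_Phi_N K hz, 𝓔.hochschild_Phi_of_mem_F K hNF, hochschild_eq, map_add (connes (𝓔.base K) n), hd.1,
    𝓔.connes_eq_Phi_N K hb, ← map_add, sub_add, ← map_sub, sub_eq_add_neg, ← map_neg] at h
  obtain ⟨h1, h2⟩ := 𝓔.eq_zero_of_add_Phi K (sub_mem hNF (𝓔.t_mem_F K hNF))
    (neg_mem (sub_mem (add_mem (𝓔.b_mem_F K hNF) (𝓔.d'_mem_F K hNF))
      (add_mem (𝓔.X_le_F K _ _ (𝓔.Nw_mem K w hb)) hd.2))) h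
  exact ⟨h1, sub_eq_zero.1 (neg_eq_zero.1 h2)⟩

lemma sub_t_Nw {z : CycTensor (𝓔.base K) n} (hz : z ∈ 𝓔.X K n w) :
    𝓔.Nw K n w z - 𝓔.t K n (𝓔.Nw K n w z) = 0 := by
  cases n with
  | zero => rw [𝓔.t_zero K (𝓔.X_le_F K _ _ (𝓔.Nw_mem K w hz)), sub_self]
  | succ n => exact (𝓔.sub_t_Nw_aux K hz).1

lemma b_Nw {z : CycTensor (𝓔.base K) (n + 1)} (hz : z ∈ 𝓔.X K (n + 1) w) :
    𝓔.b K n (𝓔.Nw K (n + 1) w z) = 𝓔.Nw K n w (𝓔.b K n z) := by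
  have h := (𝓔.sub_t_Nw_aux K hz).2
  have hN := 𝓔.Nw_mem K w hz
  have hb := 𝓔.Nw_mem K w (𝓔.b_mem K n w z hz)
  have h1 := congrArg (𝓔.gradeProj K n (w + 1)) h
  rw [map_add, map_add, 𝓔.gradeProj_of_mem K (𝓔.b_mem K n w _ hN), 𝓔.gradeProj_of_mem K hb,
    if_pos rfl, if_pos rfl, 𝓔.gradeProj_d' K _ (𝓔.X_le_F K _ _ hN), 𝓔.gradeProj_of_mem K hN,
    if_neg (by omega), map_zero, add_zero] at h1
  rw [h1]
  cases w with
  | zero => rw [(𝓔.d_d'_eq_zero K hz).1, map_zero, map_zero, add_zero]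
  | succ w =>
    rw [𝓔.gradeProj_of_mem K (𝓔.Nw_mem K _ (𝓔.d_mem K n w z hz)), if_neg (by omega), add_zero]

lemma d'_Nw {z : CycTensor (𝓔.base K) (n + 1)} (hz : z ∈ 𝓔.X K (n + 1) (w + 1)) :
    𝓔.d' K n (𝓔.Nw K (n + 1) (w + 1) z) = 𝓔.Nw K n w (𝓔.d K n z) := by
  have h := (𝓔.sub_t_Nw_aux K hz).2
  rw [𝓔.b_Nw K hz] at h
  exact add_left_cancel h

/-- N is a polynomial in t and hence commutes with it. -/
lemma Nw_sub_t {z : CycTensor (𝓔.base K) n} (hz : z ∈ 𝓔.X K n w) :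
    𝓔.Nw K n w (z - 𝓔.t K n z) = 0 := by
  have hc : Commute (𝓔.Nw K n w) (𝓔.t K n) := by
    unfold Nw
    exact Commute.sum_left _ _ _ fun l _ => Commute.pow_left (Commute.refl _) l
  rw [map_sub, ← Module.End.mul_apply, hc.eq, Module.End.mul_apply, 𝓔.sub_t_Nw K hz]

end relations

/-! ### The triple complex -/

section tripleComplex

lemma coe_tX {n w : ℕ} (z : 𝓔.X K n w) : ((𝓔.tX K n w z : 𝓔.X K n w) : CycTensor (𝓔.base K) n) = 𝓔.t K n z := rfl

lemma coe_bX {n w : ℕ} (z : 𝓔.X K (n + 1) w) :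
    ((𝓔.bX K n w z : 𝓔.X K n w) : CycTensor (𝓔.base K) n) = 𝓔.b K n z := rfl

lemma coe_dX {n w : ℕ} (z : 𝓔.X K (n + 1) (w + 1)) :
    ((𝓔.dX K n w z : 𝓔.X K n w) : CycTensor (𝓔.base K) n) = 𝓔.d K n z := rfl

lemma coe_dX' {n w : ℕ} (z : 𝓔.X K (n + 1) (w + 1)) :
    ((𝓔.dX' K n w z : 𝓔.X K n w) : CycTensor (𝓔.base K) n) = 𝓔.d' K n z := rfl

lemma coe_NX {n w : ℕ} (z : 𝓔.X K n w) :
    ((𝓔.NX K n w z : 𝓔.X K n w) : CycTensor (𝓔.base K) n) = 𝓔.Nw K n w z := by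
  have h : ∀ l, (((𝓔.tX K n w ^ l) z : 𝓔.X K n w) : CycTensor (𝓔.base K) n) = (𝓔.t K n ^ l) z := by
    intro l
    induction l with
    | zero => simp
    | succ l ih => rw [pow_succ', pow_succ', Module.End.mul_apply, Module.End.mul_apply, coe_tX, ih]
  rw [NX, Nw, LinearMap.sum_apply, LinearMap.sum_apply, Submodule.coe_sum]
  exact Finset.sum_congr rfl fun l _ => h l

/-- The map `dh` of the diagram. -/
def hMap (u : ℤ) (n w : ℕ) : 𝓔.X K n w →ₗ[k] 𝓔.X K n w :=
  if Even u then LinearMap.id - 𝓔.tX K n w else 𝓔.NX K n w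

/-- The map `dv` of the diagram, up to the identification of `v + 1 + w` with `v + w + 1`. -/
def vMap (u : ℤ) (n w : ℕ) : 𝓔.X K (n + 1) w →ₗ[k] 𝓔.X K n w :=
  if Even u then 𝓔.bX K n w else -𝓔.bX K n w

/-- The map `dd` of the diagram. -/
def dMap (u : ℤ) (n w : ℕ) : 𝓔.X K (n + 1) (w + 1) →ₗ[k] 𝓔.X K n w :=
  if Even u then 𝓔.dX K n w else -𝓔.dX' K n w

lemma castX_hMap {m n w : ℕ} (u : ℤ) (h : m = n) (z : 𝓔.X K m w) :
    𝓔.castX K h w (𝓔.hMap K u m w z) = 𝓔.hMap K u n w (𝓔.castX K h w z) := by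
  subst h; rfl

lemma castX_vMap {m n w : ℕ} (u : ℤ) (h : m = n) (z : 𝓔.X K (m + 1) w) :
    𝓔.castX K h w (𝓔.vMap K u m w z) = 𝓔.vMap K u n w (𝓔.castX K (congrArg Nat.succ h) w z) := by
  subst h; rfl

lemma castX_dMap {m n w : ℕ} (u : ℤ) (h : m = n) (z : 𝓔.X K (m + 1) (w + 1)) :
    𝓔.castX K h w (𝓔.dMap K u m w z) =
      𝓔.dMap K u n w (𝓔.castX K (congrArg Nat.succ h) (w + 1) z) := by
  subst h; rfl

lemma bX_bX {n w : ℕ} (z : 𝓔.X K (n + 2) w) : 𝓔.bX K n w (𝓔.bX K (n + 1) w z) = 0 :=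
  Subtype.ext (𝓔.bd_bd K z.2).1

lemma dX_dX {n w : ℕ} (z : 𝓔.X K (n + 2) (w + 2)) : 𝓔.dX K n w (𝓔.dX K (n + 1) (w + 1) z) = 0 :=
  Subtype.ext (𝓔.bd_bd K z.2).2.2

lemma dX'_dX' {n w : ℕ} (z : 𝓔.X K (n + 2) (w + 2)) :
    𝓔.dX' K n w (𝓔.dX' K (n + 1) (w + 1) z) = 0 :=
  Subtype.ext (𝓔.bd'_bd' K z.2).2

lemma bX_dX {n w : ℕ} (z : 𝓔.X K (n + 2) (w + 1)) :
    𝓔.bX K n w (𝓔.dX K (n + 1) w z) + 𝓔.dX K n w (𝓔.bX K (n + 1) (w + 1) z) = 0 :=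
  Subtype.ext (𝓔.bd_bd K z.2).2.1

lemma bX_dX' {n w : ℕ} (z : 𝓔.X K (n + 2) (w + 1)) :
    𝓔.bX K n w (𝓔.dX' K (n + 1) w z) + 𝓔.dX' K n w (𝓔.bX K (n + 1) (w + 1) z) = 0 :=
  Subtype.ext (𝓔.bd'_bd' K z.2).1

lemma bX_sub_tX {n w : ℕ} (z : 𝓔.X K (n + 1) w) :
    𝓔.bX K n w (z - 𝓔.tX K (n + 1) w z) = 𝓔.bX K n w z - 𝓔.tX K n w (𝓔.bX K n w z) :=
  Subtype.ext (𝓔.bd_sub_t K z.2).1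

lemma dX_sub_tX {n w : ℕ} (z : 𝓔.X K (n + 1) (w + 1)) :
    𝓔.dX K n w (z - 𝓔.tX K (n + 1) (w + 1) z) = 𝓔.dX' K n w z - 𝓔.tX K n w (𝓔.dX' K n w z) :=
  Subtype.ext (𝓔.bd_sub_t K z.2).2

lemma bX_NX {n w : ℕ} (z : 𝓔.X K (n + 1) w) :
    𝓔.bX K n w (𝓔.NX K (n + 1) w z) = 𝓔.NX K n w (𝓔.bX K n w z) := by
  refine Subtype.ext ?_
  rw [coe_bX, coe_NX, coe_NX, coe_bX]
  exact 𝓔.b_Nw K z.2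

lemma dX'_NX {n w : ℕ} (z : 𝓔.X K (n + 1) (w + 1)) :
    𝓔.dX' K n w (𝓔.NX K (n + 1) (w + 1) z) = 𝓔.NX K n w (𝓔.dX K n w z) := by
  refine Subtype.ext ?_
  rw [coe_dX', coe_NX, coe_NX, coe_dX]
  exact 𝓔.d'_Nw K z.2

lemma NX_sub_tX {n w : ℕ} (z : 𝓔.X K n w) : 𝓔.NX K n w (z - 𝓔.tX K n w z) = 0 := by
  refine Subtype.ext ?_
  rw [coe_NX]
  exact 𝓔.Nw_sub_t K z.2

lemma sub_tX_NX {n w : ℕ} (z : 𝓔.X K n w) :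
    𝓔.NX K n w z - 𝓔.tX K n w (𝓔.NX K n w z) = 0 := by
  refine Subtype.ext ?_
  rw [Submodule.coe_sub, coe_tX, coe_NX]
  exact 𝓔.sub_t_Nw K z.2

lemma hMap_hMap (u : ℤ) {n w : ℕ} (z : 𝓔.X K n w) :
    𝓔.hMap K u n w (𝓔.hMap K (u + 1) n w z) = 0 := by
  by_cases hu : Even u
  · have hu' : ¬ Even (u + 1) := by simpa [Int.even_add_one] using hu
    rw [hMap, hMap, if_pos hu, if_neg hu']
    exact 𝓔.sub_tX_NX K z
  · have hu' : Even (u + 1) := by simpa [Int.even_add_one] using hu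
    rw [hMap, hMap, if_neg hu, if_pos hu']
    exact 𝓔.NX_sub_tX K z

lemma vMap_vMap (u : ℤ) {n w : ℕ} (z : 𝓔.X K (n + 2) w) :
    𝓔.vMap K u n w (𝓔.vMap K u (n + 1) w z) = 0 := by
  unfold vMap
  split_ifs <;> simp [𝓔.bX_bX K z]

lemma dMap_dMap (u : ℤ) {n w : ℕ} (z : 𝓔.X K (n + 2) (w + 2)) :
    𝓔.dMap K u n w (𝓔.dMap K u (n + 1) (w + 1) z) = 0 := by
  unfold dMap
  split_ifs <;> simp [𝓔.dX_dX K z, 𝓔.dX'_dX' K z]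

lemma hMap_vMap (u : ℤ) {n w : ℕ} (z : 𝓔.X K (n + 1) w) :
    𝓔.hMap K u n w (𝓔.vMap K (u + 1) n w z) + 𝓔.vMap K u n w (𝓔.hMap K u (n + 1) w z) = 0 := by
  by_cases hu : Even u
  · have hu' : ¬ Even (u + 1) := by simpa [Int.even_add_one] using hu
    simp only [hMap, vMap, if_pos hu, if_neg hu', LinearMap.neg_apply, map_neg,
      LinearMap.sub_apply, LinearMap.id_apply, bX_sub_tX, neg_add_cancel]
  · have hu' : Even (u + 1) := by simpa [Int.even_add_one] using hu
    simp only [hMap, vMap, if_neg hu, if_pos hu', LinearMap.neg_apply, bX_NX, add_neg_cancel]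

lemma hMap_dMap (u : ℤ) {n w : ℕ} (z : 𝓔.X K (n + 1) (w + 1)) :
    𝓔.hMap K u n w (𝓔.dMap K (u + 1) n w z) +
      𝓔.dMap K u n w (𝓔.hMap K u (n + 1) (w + 1) z) = 0 := by
  by_cases hu : Even u
  · have hu' : ¬ Even (u + 1) := by simpa [Int.even_add_one] using hu
    simp only [hMap, dMap, if_pos hu, if_neg hu', LinearMap.neg_apply, map_neg,
      LinearMap.sub_apply, LinearMap.id_apply, dX_sub_tX, neg_add_cancel]
  · have hu' : Even (u + 1) := by simpa [Int.even_add_one] using hu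
    simp only [hMap, dMap, if_neg hu, if_pos hu', LinearMap.neg_apply, dX'_NX, add_neg_cancel]

lemma vMap_dMap (u : ℤ) {n w : ℕ} (z : 𝓔.X K (n + 2) (w + 1)) :
    𝓔.vMap K u n w (𝓔.dMap K u (n + 1) w z) +
      𝓔.dMap K u n w (𝓔.vMap K u (n + 1) (w + 1) z) = 0 := by
  unfold vMap dMap
  split_ifs
  · exact 𝓔.bX_dX K z
  · simp only [LinearMap.neg_apply, map_neg, neg_neg]
    exact 𝓔.bX_dX' K z

lemma isTripleComplex : (𝓔.diagram K).IsTripleComplex where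
  dh_dh u v w := LinearMap.ext fun z => 𝓔.hMap_hMap K u z
  dv_dv u v w := LinearMap.ext fun (z : 𝓔.X K (v + 1 + 1 + w) w) => by
    change 𝓔.vMap K u (v + w) w (𝓔.castX K _ w (𝓔.vMap K u (v + 1 + w) w (𝓔.castX K _ w z))) =
      (0 : 𝓔.X K (v + w) w)
    rw [castX_vMap, vMap_vMap]
  dd_dd u v w := LinearMap.ext fun z => 𝓔.dMap_dMap K u (n := v + w) z
  dh_dv u v w := LinearMap.ext fun (z : 𝓔.X K (v + 1 + w) w) => by
    change 𝓔.hMap K u (v + w) w (𝓔.vMap K (u + 1) (v + w) w (𝓔.castX K _ w z)) +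
      𝓔.vMap K u (v + w) w (𝓔.castX K _ w (𝓔.hMap K u (v + 1 + w) w z)) = (0 : 𝓔.X K (v + w) w)
    rw [castX_hMap, hMap_vMap]
  dh_dd u v w := LinearMap.ext fun z => 𝓔.hMap_dMap K u (n := v + w) z
  dv_dd u v w := LinearMap.ext fun (z : 𝓔.X K (v + 1 + w + 1) (w + 1)) => by
    change 𝓔.vMap K u (v + w) w (𝓔.castX K _ w (𝓔.dMap K u (v + 1 + w) w z)) +
      𝓔.dMap K u (v + w) w (𝓔.vMap K u (v + w + 1) (w + 1) (𝓔.castX K _ (w + 1) z)) =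
        (0 : 𝓔.X K (v + w) w)
    rw [castX_dMap]
    exact 𝓔.vMap_dMap K u _

end tripleComplex

end CleftExtension

/-! ### Homology along an injection with acyclic cokernel -/

section homologyEquiv

/-- An injective morphism of complexes whose cokernel is acyclic induces an isomorphism in homology. -/
lemma homology_equiv {U V W T' U' V' W' : Type*} [AddCommGroup U] [AddCommGroup V] [AddCommGroup W]
    [AddCommGroup T'] [AddCommGroup U'] [AddCommGroup V'] [AddCommGroup W'] [Module k U] [Module k V]
    [Module k W] [Module k T'] [Module k U'] [Module k V'] [Module k W']
    (f : U →ₗ[k] V) (g : V →ₗ[k] W) (e' : T' →ₗ[k] U') (f' : U' →ₗ[k] V') (g' : V' →ₗ[k] W')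
    (α : U →ₗ[k] U') (β : V →ₗ[k] V') (γ : W →ₗ[k] W')
    (hf : ∀ x, β (f x) = f' (α x)) (hg : ∀ x, γ (g x) = g' (β x))
    (he' : ∀ x, f' (e' x) = 0) (hf' : ∀ x, g' (f' x) = 0)
    (hβ : Function.Injective β) (hγ : Function.Injective γ)
    (hV : ∀ v, g' v ∈ LinearMap.range γ → ∃ u, v - f' u ∈ LinearMap.range β)
    (hU : ∀ u, f' u ∈ LinearMap.range β → ∃ t, u - e' t ∈ LinearMap.range α) :
    Nonempty (Homology f' g' ≃ₗ[k] Homology f g) := by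
  let φ : LinearMap.ker g →ₗ[k] Homology f' g' :=
    ((LinearMap.range f').submoduleOf (LinearMap.ker g')).mkQ ∘ₗ β.restrict (fun x hx => by
      rw [LinearMap.mem_ker] at hx ⊢
      rw [← hg, hx, map_zero])
  have hsurj : Function.Surjective φ := by
    intro y
    obtain ⟨⟨v, hv⟩, rfl⟩ := Submodule.mkQ_surjective _ y
    rw [LinearMap.mem_ker] at hv
    obtain ⟨u, x, hx⟩ := hV v (by rw [hv]; exact zero_mem _)
    have hx0 : g x = 0 := hγ (by rw [hg, hx, map_sub, hv, hf', sub_zero, map_zero])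
    refine ⟨⟨x, hx0⟩, (Submodule.Quotient.eq _).2 ⟨-u, ?_⟩⟩
    simp [hx]
  have hker : LinearMap.ker φ = (LinearMap.range f).submoduleOf (LinearMap.ker g) := by
    ext ⟨x, hx⟩
    rw [LinearMap.mem_ker]
    refine (Submodule.Quotient.mk_eq_zero _).trans ?_
    constructor
    · rintro ⟨u, hu⟩
      have hu' : f' u = β x := hu
      obtain ⟨t, y, hy⟩ := hU u (by rw [hu']; exact ⟨x, rfl⟩)
      refine ⟨y, hβ ?_⟩
      rw [hf, hy, map_sub, he', sub_zero, hu']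
      rfl
    · rintro ⟨y, hy⟩
      refine ⟨α y, ?_⟩
      rw [← hf, hy]
      rfl
  exact ⟨((Submodule.quotEquivOfEq _ _ hker.symm).trans
    (φ.quotKerEquivOfSurjective hsurj)).symm⟩

end homologyEquiv

namespace CleftExtension

variable {A E : Type*} [Ring A] [Algebra k A] [Ring E] [Algebra k E]
  (𝓔 : CleftExtension k A E) (K : Subalgebra k A)

/-! ### The comparison map y + Phi z on components -/

section components

/-- The component in position `(u, q - w, w)`, viewed in `E ⊗ Ē^{⊗ q} ⊗`. -/
def zval (n u : ℤ) (q w : ℕ) : (𝓔.diagram K).Tot n →ₗ[k] CycTensor (𝓔.base K) q :=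
  if h : w ≤ q ∧ u + q = n then
    (𝓔.X K q w).subtype ∘ₗ 𝓔.castX K (Nat.sub_add_cancel h.1) w ∘ₗ
      (𝓔.diagram K).totProj u (q - w) w (by have := h.1; have := h.2; omega)
  else 0

variable {n : ℤ}

lemma castX_apply (z : (𝓔.diagram K).Tot n) (u : ℤ) {v v' w q : ℕ} (hv : v' = v)
    (h : u + v + w = n) (h' : u + v' + w = n) (hq : v + w = q) (hq' : v' + w = q) :
    𝓔.castX K hq' w (z ⟨(u, v', w), h'⟩) = 𝓔.castX K hq w (z ⟨(u, v, w), h⟩) := by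
  subst hv; rfl

lemma zval_eq (z : (𝓔.diagram K).Tot n) {u : ℤ} {v w q : ℕ} (h : u + v + w = n) (hq : v + w = q) :
    𝓔.zval K n u q w z = (𝓔.castX K hq w (z ⟨(u, v, w), h⟩) : 𝓔.X K q w) := by
  rw [zval, dif_pos ⟨by omega, by omega⟩]
  exact congrArg Subtype.val (𝓔.castX_apply K z u (by omega) h _ hq _)

lemma zval_mem (z : (𝓔.diagram K).Tot n) (u : ℤ) (q w : ℕ) :
    𝓔.zval K n u q w z ∈ 𝓔.X K q w := by
  unfold zval
  split_ifs with h
  · exact Subtype.property _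
  · exact zero_mem _

lemma eq_of_mem_X_of_lt {q w : ℕ} (h : q < w) {x y : CycTensor (𝓔.base K) q} (hx : x ∈ 𝓔.X K q w)
    (hy : y ∈ 𝓔.X K q w) : x = y := by
  rw [𝓔.X_eq_bot K h, Submodule.mem_bot] at hx hy
  rw [hx, hy]

lemma zval_totD_even {m : ℤ} (h : m + 1 = n) (z : (𝓔.diagram K).Tot n) {u : ℤ} (hu : Even u)
    {q : ℕ} (hq : u + q = m) (w : ℕ) :
    𝓔.zval K m u q w ((𝓔.diagram K).totD h z) =
      (𝓔.zval K n (u + 1) q w z - 𝓔.t K q (𝓔.zval K n (u + 1) q w z)) +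
        𝓔.b K q (𝓔.zval K n u (q + 1) w z) + 𝓔.d K q (𝓔.zval K n u (q + 1) (w + 1) z) := by
  rcases lt_or_ge q w with hw | hw
  · refine 𝓔.eq_of_mem_X_of_lt K hw (𝓔.zval_mem K _ _ _ _) (add_mem (add_mem (sub_mem
      (𝓔.zval_mem K _ _ _ _) (𝓔.t_mem K _ _ _ (𝓔.zval_mem K _ _ _ _)))
      (𝓔.b_mem K _ _ _ (𝓔.zval_mem K _ _ _ _))) (𝓔.d_mem K _ _ _ (𝓔.zval_mem K _ _ _ _)))
  · obtain ⟨v, rfl⟩ := Nat.exists_eq_add_of_le' hw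
    rw [𝓔.zval_eq K _ (show u + v + w = m by push_cast at hq; omega) rfl,
      𝓔.zval_eq K z (u := u + 1) (show u + 1 + v + w = n by push_cast at hq; omega) rfl,
      𝓔.zval_eq K z (u := u) (v := v + 1) (show u + (v + 1 : ℕ) + w = n by push_cast at hq ⊢; omega)
        (by omega : v + 1 + w = v + w + 1),
      𝓔.zval_eq K z (u := u) (v := v) (w := w + 1) (q := v + w + 1)
        (show u + v + (w + 1 : ℕ) = n by push_cast at hq ⊢; omega)
        (rfl : v + (w + 1) = v + w + 1)]
    have e : ∀ z₁ z₂ z₃, ((𝓔.hMap K u (v + w) w z₁ + 𝓔.vMap K u (v + w) w z₂ +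
        𝓔.dMap K u (v + w) w z₃ : 𝓔.X K (v + w) w) : CycTensor (𝓔.base K) (v + w)) =
        (z₁ - 𝓔.t K (v + w) z₁) + 𝓔.b K (v + w) z₂ + 𝓔.d K (v + w) z₃ := by
      intro z₁ z₂ z₃
      rw [hMap, vMap, dMap, if_pos hu, if_pos hu, if_pos hu]
      rfl
    exact e _ _ _

lemma zval_totD_odd {m : ℤ} (h : m + 1 = n) (z : (𝓔.diagram K).Tot n) {u : ℤ} (hu : ¬ Even u)
    {q : ℕ} (hq : u + q = m) (w : ℕ) :
    𝓔.zval K m u q w ((𝓔.diagram K).totD h z) =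
      𝓔.Nw K q w (𝓔.zval K n (u + 1) q w z) -
        𝓔.b K q (𝓔.zval K n u (q + 1) w z) - 𝓔.d' K q (𝓔.zval K n u (q + 1) (w + 1) z) := by
  rcases lt_or_ge q w with hw | hw
  · refine 𝓔.eq_of_mem_X_of_lt K hw (𝓔.zval_mem K _ _ _ _) (sub_mem (sub_mem
      (𝓔.Nw_mem K _ (𝓔.zval_mem K _ _ _ _))
      (𝓔.b_mem K _ _ _ (𝓔.zval_mem K _ _ _ _))) (𝓔.d'_mem K _ _ _ (𝓔.zval_mem K _ _ _ _)))
  · obtain ⟨v, rfl⟩ := Nat.exists_eq_add_of_le' hw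
    rw [𝓔.zval_eq K _ (show u + v + w = m by push_cast at hq; omega) rfl,
      𝓔.zval_eq K z (u := u + 1) (show u + 1 + v + w = n by push_cast at hq; omega) rfl,
      𝓔.zval_eq K z (u := u) (v := v + 1) (show u + (v + 1 : ℕ) + w = n by push_cast at hq ⊢; omega)
        (by omega : v + 1 + w = v + w + 1),
      𝓔.zval_eq K z (u := u) (v := v) (w := w + 1) (q := v + w + 1)
        (show u + v + (w + 1 : ℕ) = n by push_cast at hq ⊢; omega)
        (rfl : v + (w + 1) = v + w + 1)]
    have e : ∀ z₁ z₂ z₃, ((𝓔.hMap K u (v + w) w z₁ + 𝓔.vMap K u (v + w) w z₂ +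
        𝓔.dMap K u (v + w) w z₃ : 𝓔.X K (v + w) w) : CycTensor (𝓔.base K) (v + w)) =
        𝓔.Nw K (v + w) w z₁ - 𝓔.b K (v + w) z₂ - 𝓔.d' K (v + w) z₃ := by
      intro z₁ z₂ z₃
      rw [hMap, vMap, dMap, if_neg hu, if_neg hu, if_neg hu, sub_eq_add_neg, sub_eq_add_neg,
        ← coe_NX]
      rfl
    exact e _ _ _

/-- The component in column `u` and degree `q` in the span of the tensors whose first entry is in `M`. -/
def Fcomp (n u : ℤ) (q : ℕ) : (𝓔.diagram K).Tot n →ₗ[k] CycTensor (𝓔.base K) q :=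
  ∑ w ∈ Finset.range (q + 1), 𝓔.zval K n u q w

lemma Fcomp_apply (u : ℤ) (q : ℕ) (z : (𝓔.diagram K).Tot n) :
    𝓔.Fcomp K n u q z = ∑ w ∈ Finset.range (q + 1), 𝓔.zval K n u q w z := by
  rw [Fcomp, LinearMap.sum_apply]

lemma Fcomp_mem (z : (𝓔.diagram K).Tot n) (u : ℤ) (q : ℕ) : 𝓔.Fcomp K n u q z ∈ 𝓔.F K q := by
  rw [Fcomp_apply]
  exact Submodule.sum_mem _ fun w _ => 𝓔.X_le_F K _ _ (𝓔.zval_mem K _ _ _ _)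

lemma gradeProj_Fcomp (z : (𝓔.diagram K).Tot n) (u : ℤ) {q w : ℕ} (hw : w ≤ q) :
    𝓔.gradeProj K q (w + 1) (𝓔.Fcomp K n u q z) = 𝓔.zval K n u q w z := by
  rw [Fcomp_apply, map_sum, Finset.sum_eq_single w]
  · rw [𝓔.gradeProj_of_mem K (𝓔.zval_mem K _ _ _ _), if_pos rfl]
  · intro w' _ hw'
    rw [𝓔.gradeProj_of_mem K (𝓔.zval_mem K _ _ _ _), if_neg (by omega)]
  · intro h
    exact absurd (Finset.mem_range.2 (by omega)) h

lemma Fcomp_congr {z z' : (𝓔.diagram K).Tot n} {u : ℤ}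
    (h : ∀ (v w : ℕ) (hi : u + v + w = n), z ⟨(u, v, w), hi⟩ = z' ⟨(u, v, w), hi⟩) (q : ℕ) :
    𝓔.Fcomp K n u q z = 𝓔.Fcomp K n u q z' := by
  rw [Fcomp_apply, Fcomp_apply]
  refine Finset.sum_congr rfl fun w hw => ?_
  obtain ⟨v, rfl⟩ := Nat.exists_eq_add_of_le' (Nat.lt_succ_iff.1 (Finset.mem_range.1 hw))
  by_cases hn : u + v + w = n
  · rw [𝓔.zval_eq K z hn rfl, 𝓔.zval_eq K z' hn rfl, h]
  · rw [zval, dif_neg (by push_cast; omega)]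
    rfl

/-- The maps no longer depend on w once the X_{vw} of a column are summed up: b and d combine to ∂.
-/
lemma Fcomp_totD_even {m : ℤ} (h : m + 1 = n) (z : (𝓔.diagram K).Tot n) {u : ℤ} (hu : Even u)
    {q : ℕ} (hq : u + q = m) :
    𝓔.Fcomp K m u q ((𝓔.diagram K).totD h z) =
      (𝓔.Fcomp K n (u + 1) q z - 𝓔.t K q (𝓔.Fcomp K n (u + 1) q z)) +
        hochschild (𝓔.base K) q (𝓔.Fcomp K n u (q + 1) z) := by
  simp only [Fcomp_apply, 𝓔.zval_totD_even K h z hu hq, Finset.sum_add_distrib,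
    Finset.sum_sub_distrib, hochschild_eq, map_sum]
  -- Degree q + 1 has one more value of w than degree q. For b the surplus term w = q + 1 lands in a
  -- zero module; for d it is w = 0, where d vanishes.
  rw [Finset.sum_range_succ (fun w => 𝓔.b K q (𝓔.zval K n u (q + 1) w z)) (q + 1),
    Finset.sum_range_succ' (fun w => 𝓔.d K q (𝓔.zval K n u (q + 1) w z)) (q + 1),
    (𝓔.d_d'_eq_zero K (𝓔.zval_mem K z u (q + 1) 0)).1,
    𝓔.eq_of_mem_X_of_lt K (Nat.lt_succ_self q) (𝓔.b_mem K _ _ _ (𝓔.zval_mem K z u (q + 1) (q + 1)))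
      (zero_mem _), add_zero, add_zero, add_assoc]

/-- `Phi` is applied first because N varies with w, while Phi N = B does not. -/
lemma Phi_Fcomp_totD_odd {m : ℤ} (h : m + 1 = n) (z : (𝓔.diagram K).Tot n) {u : ℤ}
    (hu : ¬ Even u) {q : ℕ} (hq : u + q = m) :
    𝓔.Phi K q (𝓔.Fcomp K m u q ((𝓔.diagram K).totD h z)) =
      connes (𝓔.base K) q (𝓔.Fcomp K n (u + 1) q z) -
        𝓔.Phi K q (𝓔.b K q (𝓔.Fcomp K n u (q + 1) z) + 𝓔.d' K q (𝓔.Fcomp K n u (q + 1) z)) := by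
  simp only [Fcomp_apply, 𝓔.zval_totD_odd K h z hu hq,
    Finset.sum_sub_distrib, map_sum, map_sub, map_add]
  rw [Finset.sum_range_succ (fun w => 𝓔.Phi K q (𝓔.b K q (𝓔.zval K n u (q + 1) w z))) (q + 1),
    Finset.sum_range_succ' (fun w => 𝓔.Phi K q (𝓔.d' K q (𝓔.zval K n u (q + 1) w z))) (q + 1),
    (𝓔.d_d'_eq_zero K (𝓔.zval_mem K z u (q + 1) 0)).2,
    𝓔.eq_of_mem_X_of_lt K (Nat.lt_succ_self q) (𝓔.b_mem K _ _ _ (𝓔.zval_mem K z u (q + 1) (q + 1)))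
      (zero_mem _), map_zero, add_zero, add_zero, sub_sub]
  congr 1
  exact Finset.sum_congr rfl fun w _ => (𝓔.connes_eq_Phi_N K (𝓔.zval_mem K z (u + 1) q w)).symm

/-- The component in degree `q` of the column `i` of the comparison map. -/
def thetaVal (n i : ℤ) : (q : ℕ) → (𝓔.diagram K).Tot n →ₗ[k] CycTensor (𝓔.base K) q
  | 0 => 𝓔.Fcomp K n (2 * i) 0
  | q + 1 => 𝓔.Fcomp K n (2 * i) (q + 1) + 𝓔.Phi K q ∘ₗ 𝓔.Fcomp K n (2 * i + 1) q

lemma thetaVal_mem (i : ℤ) (q : ℕ) (z : (𝓔.diagram K).Tot n) :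
    𝓔.thetaVal K n i q z ∈ 𝓔.imTheta K q := by
  cases q with
  | zero => exact 𝓔.Fcomp_mem K z _ _
  | succ q =>
    exact Submodule.add_mem_sup (𝓔.Fcomp_mem K z _ _)
      (Submodule.mem_map_of_mem (𝓔.Fcomp_mem K z _ _))

lemma imTheta_le_ker {q : ℕ} {y : CycTensor (𝓔.base K) q} (hy : y ∈ 𝓔.imTheta K q) :
    mapCyc 𝓔.p (𝓔.p_base K) q y = 0 := by
  cases q with
  | zero => exact 𝓔.F_le_ker K hy
  | succ q =>
    obtain ⟨a, ha, c, ⟨e, he, rfl⟩, rfl⟩ := Submodule.mem_sup.1 hy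
    rw [map_add, 𝓔.F_le_ker K ha, mapCyc_Phi, 𝓔.F_le_ker K he, map_zero, add_zero]

lemma Phi_mem_imTheta {q : ℕ} {y : CycTensor (𝓔.base K) q} (hy : y ∈ 𝓔.imTheta K q) :
    𝓔.Phi K q y ∈ 𝓔.imTheta K (q + 1) := by
  refine (le_sup_right : (𝓔.F K q).map (𝓔.Phi K q) ≤ _) ?_
  cases q with
  | zero => exact Submodule.mem_map_of_mem hy
  | succ q =>
    obtain ⟨a, ha, c, ⟨e, he, rfl⟩, rfl⟩ := Submodule.mem_sup.1 hy
    rw [map_add, 𝓔.Phi_of_mem_unitSpan K (𝓔.Phi_mem_unitSpan K e), add_zero]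
    exact Submodule.mem_map_of_mem ha

lemma thetaVal_totD_zero {m : ℤ} (h : m + 1 = n) (z : (𝓔.diagram K).Tot n) {i : ℤ}
    (hq : 2 * i = m) :
    𝓔.thetaVal K m i 0 ((𝓔.diagram K).totD h z) =
      hochschild (𝓔.base K) 0 (𝓔.thetaVal K n i 1 z) := by
  rw [thetaVal, thetaVal, 𝓔.Fcomp_totD_even K h z (even_two_mul i) (by simpa using hq),
    𝓔.t_zero K (𝓔.Fcomp_mem K z _ _), sub_self, zero_add, LinearMap.add_apply, map_add,
    LinearMap.comp_apply, hochschild_Phi_zero, add_zero]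

/-- The boundary of y + Phi z is ∂y + (id - t)z - Phi (b + d')z, and B of the next column is Phi N
of its even part, since B Phi = 0. These are the differentials of the columns 2i and 2i + 1. -/
lemma thetaVal_totD_succ {m : ℤ} (h : m + 1 = n) (z : (𝓔.diagram K).Tot n) {i : ℤ} {q : ℕ}
    (hq : 2 * i + (q + 1 : ℕ) = m) :
    𝓔.thetaVal K m i (q + 1) ((𝓔.diagram K).totD h z) =
      hochschild (𝓔.base K) (q + 1) (𝓔.thetaVal K n i (q + 2) z) +
        connes (𝓔.base K) q (𝓔.thetaVal K n (i + 1) q z) := by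
  have hc : connes (𝓔.base K) q (𝓔.thetaVal K n (i + 1) q z) =
      connes (𝓔.base K) q (𝓔.Fcomp K n (2 * i + 1 + 1) q z) := by
    rw [show 2 * i + 1 + 1 = 2 * (i + 1) by ring]
    cases q with
    | zero => rfl
    | succ q =>
      rw [thetaVal, LinearMap.add_apply, map_add, LinearMap.comp_apply,
        connes_of_mem_unitSpan (𝓔.Phi_mem_unitSpan K _), add_zero]
  rw [hc, thetaVal, thetaVal, LinearMap.add_apply, LinearMap.add_apply, LinearMap.comp_apply,
    LinearMap.comp_apply, 𝓔.Fcomp_totD_even K h z (even_two_mul i) hq,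
    𝓔.Phi_Fcomp_totD_odd K h z (Int.not_even_two_mul_add_one i) (by push_cast at hq; omega),
    map_add (hochschild (𝓔.base K) (q + 1)),
    𝓔.hochschild_Phi_of_mem_F K (𝓔.Fcomp_mem K z _ _)]
  abel

end components

end CleftExtension

/-! ### Truncated total complexes inside the full one -/

namespace TripleDiagram

variable (𝓧 : TripleDiagram k) (S : Set ℤ) {n m : ℤ}

/-- The inclusion of the total complex of a truncation, as a graded module. -/
def truncIncl (n : ℤ) : (𝓧.trunc S).Tot n →ₗ[k] 𝓧.Tot n :=
  LinearMap.pi fun i => (𝓧.truncMod S i.1.1 i.1.2.1 i.1.2.2).subtype ∘ₗ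
    (LinearMap.proj i : (𝓧.trunc S).Tot n →ₗ[k] (𝓧.trunc S).X i.1.1 i.1.2.1 i.1.2.2)

lemma truncIncl_injective : Function.Injective (𝓧.truncIncl S n) := fun _ _ h =>
  funext fun i => Subtype.ext (congrFun h i)

lemma truncIncl_of_notMem (z : (𝓧.trunc S).Tot n) {i : TotIdx n} (hi : i.1.1 ∉ S) :
    𝓧.truncIncl S n z i = 0 :=
  (z i).2 hi

open Classical in
lemma coe_truncMap {u u' : ℤ} {v v' w w' : ℕ} (f : 𝓧.X u v w →ₗ[k] 𝓧.X u' v' w') (hu : u' ∈ S)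
    (x : 𝓧.truncMod S u v w) : (𝓧.truncMap S f x : 𝓧.X u' v' w') = f x := by
  have h : (if u' ∈ S then f ∘ₗ (𝓧.truncMod S u v w).subtype else 0) =
      f ∘ₗ (𝓧.truncMod S u v w).subtype := if_pos hu
  exact LinearMap.congr_fun h x

lemma truncIncl_totD (h : m + 1 = n) (z : (𝓧.trunc S).Tot n) {u : ℤ} {v w : ℕ}
    (hi : u + v + w = m) (hu : u ∈ S) :
    𝓧.truncIncl S m ((𝓧.trunc S).totD h z) ⟨(u, v, w), hi⟩ =
      𝓧.totD h (𝓧.truncIncl S n z) ⟨(u, v, w), hi⟩ := by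
  have e : ∀ (x₁ : 𝓧.truncMod S (u + 1) v w) (x₂ : 𝓧.truncMod S u (v + 1) w)
      (x₃ : 𝓧.truncMod S u v (w + 1)),
      ((𝓧.truncMap S (𝓧.dh u v w) x₁ + 𝓧.truncMap S (𝓧.dv u v w) x₂ +
        𝓧.truncMap S (𝓧.dd u v w) x₃ : 𝓧.truncMod S u v w) : 𝓧.X u v w) =
      𝓧.dh u v w x₁ + 𝓧.dv u v w x₂ + 𝓧.dd u v w x₃ := by
    intro x₁ x₂ x₃
    rw [Submodule.coe_add, Submodule.coe_add, 𝓧.coe_truncMap S _ hu, 𝓧.coe_truncMap S _ hu,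
      𝓧.coe_truncMap S _ hu]
  exact e _ _ _

/-- Deleting no column does not change the total complex. -/
def toTruncUniv (n : ℤ) : 𝓧.Tot n →ₗ[k] (𝓧.trunc Set.univ).Tot n :=
  LinearMap.pi fun i => LinearMap.codRestrict (𝓧.truncMod Set.univ i.1.1 i.1.2.1 i.1.2.2)
    (LinearMap.proj i : 𝓧.Tot n →ₗ[k] 𝓧.X i.1.1 i.1.2.1 i.1.2.2)
    fun _ hu => absurd (Set.mem_univ _) hu

lemma toTruncUniv_totD (h : m + 1 = n) (x : 𝓧.Tot n) :
    𝓧.toTruncUniv m (𝓧.totD h x) = (𝓧.trunc Set.univ).totD h (𝓧.toTruncUniv n x) := by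
  refine 𝓧.truncIncl_injective Set.univ ?_
  funext ⟨(u, v, w), hi⟩
  rw [𝓧.truncIncl_totD Set.univ h _ hi (Set.mem_univ u)]
  rfl

lemma toTruncUniv_surjective : Function.Surjective (𝓧.toTruncUniv n) := fun z =>
  ⟨𝓧.truncIncl Set.univ n z, rfl⟩

end TripleDiagram

namespace CleftExtension

variable {A E : Type*} [Ring A] [Algebra k A] [Ring E] [Algebra k E]
  (𝓔 : CleftExtension k A E) (K : Subalgebra k A)

/-! ### The total complex of the relative mixed complex -/

section mixed

variable {S : Set ℤ} {n m : ℤ}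

open Classical in
/-- The component of a chain in `E ⊗ Ē^{⊗ q} ⊗ uⁱ`; zero if the column `i` is not in `S`. -/
def mval (S : Set ℤ) (n i : ℤ) (q : ℕ) : (𝓔.relMixed K).Tot S n →ₗ[k] CycTensor (𝓔.base K) q :=
  if h : i ∈ S ∧ 2 * i + q = n then
    (LinearMap.ker (mapCyc 𝓔.p (𝓔.p_base K) q)).subtype ∘ₗ
      (LinearMap.proj (φ := fun i : MixedDiagram.TotIdx S n => (𝓔.relMixed K).X i.1.2) ⟨(i, q), h⟩)
  else 0

lemma mval_eq (c : (𝓔.relMixed K).Tot S n) {i : ℤ} {q : ℕ} (h : i ∈ S ∧ 2 * i + q = n) :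
    𝓔.mval K S n i q c = (c ⟨(i, q), h⟩ : LinearMap.ker (mapCyc 𝓔.p (𝓔.p_base K) q)).1 := by
  rw [mval, dif_pos h]
  rfl

lemma mval_of_notMem (c : (𝓔.relMixed K).Tot S n) {i : ℤ} (q : ℕ) (h : i ∉ S) :
    𝓔.mval K S n i q c = 0 := by
  rw [mval, dif_neg fun h' => h h'.1, LinearMap.zero_apply]

lemma mval_mem_ker (c : (𝓔.relMixed K).Tot S n) (i : ℤ) (q : ℕ) :
    mapCyc 𝓔.p (𝓔.p_base K) q (𝓔.mval K S n i q c) = 0 := by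
  by_cases h : i ∈ S ∧ 2 * i + q = n
  · rw [𝓔.mval_eq K c h]
    exact (c ⟨(i, q), h⟩ : LinearMap.ker (mapCyc 𝓔.p (𝓔.p_base K) q)).2
  · rw [mval, dif_neg h, LinearMap.zero_apply, map_zero]

variable {𝓔 K} in
lemma mval_ext {c c' : (𝓔.relMixed K).Tot S n}
    (h : ∀ i (q : ℕ), i ∈ S → 2 * i + q = n → 𝓔.mval K S n i q c = 𝓔.mval K S n i q c') : c = c' := by
  funext ⟨(i, q), hi⟩
  have := h i q hi.1 hi.2
  rw [𝓔.mval_eq K c hi, 𝓔.mval_eq K c' hi] at this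
  exact Subtype.ext this

lemma mval_totD_zero (h : m + 1 = n) (c : (𝓔.relMixed K).Tot S n) {i : ℤ} (hi : i ∈ S)
    (hm : 2 * i = m) : 𝓔.mval K S m i 0 ((𝓔.relMixed K).totD S h c) =
      hochschild (𝓔.base K) 0 (𝓔.mval K S n i 1 c) := by
  rw [𝓔.mval_eq K _ ⟨hi, by simpa using hm⟩, 𝓔.mval_eq K _ ⟨hi, by push_cast; omega⟩]
  have e : ∀ x : LinearMap.ker (mapCyc 𝓔.p (𝓔.p_base K) 0), (x + 0).1 = x.1 := fun x => by
    rw [add_zero]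
  exact e ((𝓔.relMixed K).b 0 (c ⟨(i, 1), _⟩))

/-- Reading the components in deleted columns as 0 gives one formula, whether or not the column i +
1 is kept. -/
lemma mval_totD_succ (h : m + 1 = n) (c : (𝓔.relMixed K).Tot S n) {i : ℤ} {q : ℕ} (hi : i ∈ S)
    (hm : 2 * i + (q + 1 : ℕ) = m) : 𝓔.mval K S m i (q + 1) ((𝓔.relMixed K).totD S h c) =
      hochschild (𝓔.base K) (q + 1) (𝓔.mval K S n i (q + 2) c) +
        connes (𝓔.base K) q (𝓔.mval K S n (i + 1) q c) := by
  rw [𝓔.mval_eq K _ ⟨hi, hm⟩, 𝓔.mval_eq K (q := q + 2) _ ⟨hi, by push_cast at hm ⊢; omega⟩]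
  have e : ∀ x y : LinearMap.ker (mapCyc 𝓔.p (𝓔.p_base K) (q + 1)), (x + y).1 = x.1 + y.1 :=
    fun x y => rfl
  refine (e ((𝓔.relMixed K).b (q + 1) (c ⟨(i, q + 2), _⟩))
    ((𝓔.relMixed K).totB S h ⟨(i, q + 1), hi, hm⟩ c)).trans ?_
  refine congrArg₂ (· + ·) rfl ?_
  by_cases hS : i + 1 ∈ S
  · have hB : (𝓔.relMixed K).totB S h ⟨(i, q + 1), hi, hm⟩ c =
        (𝓔.relMixed K).B q (c ⟨(i + 1, q), hS, by push_cast at hm; omega⟩) := by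
      rw [MixedDiagram.totB, dif_pos hS]
      rfl
    rw [𝓔.mval_eq K _ ⟨hS, by push_cast at hm; omega⟩]
    exact congrArg Subtype.val hB
  · have hB : (𝓔.relMixed K).totB S h ⟨(i, q + 1), hi, hm⟩ c = 0 := by
      rw [MixedDiagram.totB, dif_neg hS, LinearMap.zero_apply]
    rw [𝓔.mval_of_notMem K c q hS, map_zero]
    exact congrArg Subtype.val hB

lemma mixed_totD_totD {l : ℤ} (h : m + 1 = n) (h' : n + 1 = l) (c : (𝓔.relMixed K).Tot S l) :
    (𝓔.relMixed K).totD S h ((𝓔.relMixed K).totD S h' c) = 0 := by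
  refine mval_ext fun i q hi hq => ?_
  rw [map_zero]
  match q, hq with
  | 0, hq =>
    rw [𝓔.mval_totD_zero K h _ hi (by simpa using hq),
      𝓔.mval_totD_succ K (q := 0) h' _ hi (by push_cast at hq ⊢; omega), map_add,
      hochschild_hochschild, hochschild_connes_zero, add_zero]
  | q + 1, hq =>
    -- If the column i + 1 is deleted, both sides are 0; otherwise B² = 0 removes the part that
    -- comes from the column i + 2.
    have hB : connes (𝓔.base K) q (𝓔.mval K S n (i + 1) q ((𝓔.relMixed K).totD S h' c)) =
        connes (𝓔.base K) q (hochschild (𝓔.base K) q (𝓔.mval K S l (i + 1) (q + 1) c)) := by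
      by_cases hS : i + 1 ∈ S
      · match q, hq with
        | 0, hq => rw [𝓔.mval_totD_zero K h' _ hS (by push_cast at hq; omega)]
        | q + 1, hq =>
          rw [𝓔.mval_totD_succ K h' _ hS (by push_cast at hq ⊢; omega), map_add, connes_connes,
            add_zero]
      · rw [𝓔.mval_of_notMem K _ _ hS, 𝓔.mval_of_notMem K _ _ hS, map_zero, map_zero, map_zero]
    rw [𝓔.mval_totD_succ K h _ hi hq, hB,
      𝓔.mval_totD_succ K (q := q + 1) h' _ hi (by push_cast at hq ⊢; omega), map_add,
      hochschild_hochschild, zero_add, hochschild_connes]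

end mixed

/-! ### The comparison map is a quasi-isomorphism -/

section comparison

variable (S : Set ℤ) {n m : ℤ}

/-- The comparison map from the truncated triple complex to the relative mixed complex. -/
def Theta (n : ℤ) :
    ((𝓔.diagram K).trunc {u | u / 2 ∈ S}).Tot n →ₗ[k] (𝓔.relMixed K).Tot S n :=
  LinearMap.pi fun i => LinearMap.codRestrict (LinearMap.ker (mapCyc 𝓔.p (𝓔.p_base K) i.1.2))
    (𝓔.thetaVal K n i.1.1 i.1.2 ∘ₗ (𝓔.diagram K).truncIncl {u | u / 2 ∈ S} n)
    fun _ => 𝓔.imTheta_le_ker K (𝓔.thetaVal_mem K _ _ _)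

/-- Integer division by 2 rounds down, so the columns with u / 2 = i are 2i and 2i + 1, for negative
i too. -/
lemma two_mul_ediv (i : ℤ) : 2 * i / 2 = i := by omega

lemma two_mul_add_one_ediv (i : ℤ) : (2 * i + 1) / 2 = i := by omega

lemma Fcomp_truncIncl_of_notMem {T : Set ℤ} (z : ((𝓔.diagram K).trunc T).Tot n) {u : ℤ}
    (hu : u ∉ T) (q : ℕ) : 𝓔.Fcomp K n u q ((𝓔.diagram K).truncIncl T n z) = 0 := by
  rw [𝓔.Fcomp_congr K (z' := 0) (fun v w hi => (𝓔.diagram K).truncIncl_of_notMem T z hu) q, map_zero]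

lemma Fcomp_truncIncl_totD {T : Set ℤ} (h : m + 1 = n) (z : ((𝓔.diagram K).trunc T).Tot n) {u : ℤ}
    (hu : u ∈ T) (q : ℕ) :
    𝓔.Fcomp K m u q ((𝓔.diagram K).truncIncl T m (((𝓔.diagram K).trunc T).totD h z)) =
      𝓔.Fcomp K m u q ((𝓔.diagram K).totD h ((𝓔.diagram K).truncIncl T n z)) :=
  𝓔.Fcomp_congr K (fun _ _ hi => (𝓔.diagram K).truncIncl_totD T h z hi hu) q

lemma mval_Theta (z : ((𝓔.diagram K).trunc {u | u / 2 ∈ S}).Tot n) {i : ℤ} {q : ℕ}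
    (h : 2 * i + q = n) : 𝓔.mval K S n i q (𝓔.Theta K S n z) =
      𝓔.thetaVal K n i q ((𝓔.diagram K).truncIncl {u | u / 2 ∈ S} n z) := by
  by_cases hi : i ∈ S
  · rw [𝓔.mval_eq K _ ⟨hi, h⟩]
    rfl
  · have h0 : 2 * i ∉ {u : ℤ | u / 2 ∈ S} := by rwa [Set.mem_ofPred_eq, two_mul_ediv]
    have h1 : 2 * i + 1 ∉ {u : ℤ | u / 2 ∈ S} := by rwa [Set.mem_ofPred_eq, two_mul_add_one_ediv]
    rw [𝓔.mval_of_notMem K _ _ hi]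
    cases q with
    | zero => rw [thetaVal, 𝓔.Fcomp_truncIncl_of_notMem K z h0]
    | succ q =>
      rw [thetaVal, LinearMap.add_apply, LinearMap.comp_apply, 𝓔.Fcomp_truncIncl_of_notMem K z h0,
        𝓔.Fcomp_truncIncl_of_notMem K z h1, map_zero, add_zero]

lemma thetaVal_truncIncl_totD (h : m + 1 = n)
    (z : ((𝓔.diagram K).trunc {u | u / 2 ∈ S}).Tot n) {i : ℤ} (hi : i ∈ S) (q : ℕ) :
    𝓔.thetaVal K m i q ((𝓔.diagram K).truncIncl {u | u / 2 ∈ S} m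
      (((𝓔.diagram K).trunc {u | u / 2 ∈ S}).totD h z)) =
    𝓔.thetaVal K m i q ((𝓔.diagram K).totD h
      ((𝓔.diagram K).truncIncl {u | u / 2 ∈ S} n z)) := by
  have h0 : 2 * i ∈ {u : ℤ | u / 2 ∈ S} := by rwa [Set.mem_ofPred_eq, two_mul_ediv]
  have h1 : 2 * i + 1 ∈ {u : ℤ | u / 2 ∈ S} := by rwa [Set.mem_ofPred_eq, two_mul_add_one_ediv]
  cases q with
  | zero => rw [thetaVal, 𝓔.Fcomp_truncIncl_totD K h z h0]
  | succ q =>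
    rw [thetaVal, LinearMap.add_apply, LinearMap.comp_apply, 𝓔.Fcomp_truncIncl_totD K h z h0,
      𝓔.Fcomp_truncIncl_totD K h z h1]
    rfl

lemma Theta_totD (h : m + 1 = n) (z : ((𝓔.diagram K).trunc {u | u / 2 ∈ S}).Tot n) :
    𝓔.Theta K S m (((𝓔.diagram K).trunc {u | u / 2 ∈ S}).totD h z) =
      (𝓔.relMixed K).totD S h (𝓔.Theta K S n z) := by
  refine mval_ext fun i q hi hq => ?_
  rw [𝓔.mval_Theta K S _ hq, 𝓔.thetaVal_truncIncl_totD K S h z hi]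
  cases q with
  | zero =>
    rw [𝓔.thetaVal_totD_zero K h _ (by simpa using hq),
      𝓔.mval_totD_zero K h _ hi (by simpa using hq),
      𝓔.mval_Theta K S z (by push_cast at hq ⊢; omega)]
  | succ q =>
    rw [𝓔.thetaVal_totD_succ K h _ hq, 𝓔.mval_totD_succ K h _ hi hq,
      𝓔.mval_Theta K S z (by push_cast at hq ⊢; omega),
      𝓔.mval_Theta K S z (by push_cast at hq ⊢; omega)]

lemma Theta_injective : Function.Injective (𝓔.Theta K S n) := by
  rw [injective_iff_map_eq_zero]
  intro z hz
  set y := (𝓔.diagram K).truncIncl {u | u / 2 ∈ S} n z with hy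
  have hθ : ∀ (i : ℤ) (q : ℕ), 2 * i + q = n → 𝓔.thetaVal K n i q y = 0 := fun i q hq => by
    rw [hy, ← 𝓔.mval_Theta K S z hq, hz, map_zero]
  have hF : ∀ (u : ℤ) (q : ℕ), u + q = n → 𝓔.Fcomp K n u q y = 0 := by
    intro u q hq
    rcases Int.even_or_odd' u with ⟨i, rfl | rfl⟩
    -- An even column u = 2i is read off in degree q of the column i; an odd one, u = 2i + 1, enters
    -- through `Phi` and is read off in degree q + 1.
    · cases q with
      | zero => exact hθ i 0 hq
      | succ q =>
        exact (𝓔.eq_zero_of_add_Phi K (𝓔.Fcomp_mem K y _ _) (𝓔.Fcomp_mem K y _ _)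
          (hθ i (q + 1) hq)).1
    · exact (𝓔.eq_zero_of_add_Phi K (𝓔.Fcomp_mem K y _ _) (𝓔.Fcomp_mem K y _ _)
          (hθ i (q + 1) (by push_cast; omega))).2
  refine (𝓔.diagram K).truncIncl_injective _ ?_
  rw [map_zero]
  funext ⟨(u, v, w), hi⟩
  have h := 𝓔.gradeProj_Fcomp K y u (Nat.le_add_left w v)
  rw [hF u (v + w) (by push_cast; simp only at hi; omega), map_zero, 𝓔.zval_eq K y hi rfl] at h
  exact Subtype.ext h.symm

lemma projF_add_Phi_eps {q : ℕ} {y : CycTensor (𝓔.base K) (q + 1)} (hy : y ∈ 𝓔.imTheta K (q + 1)) :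
    𝓔.projF K (q + 1) y + 𝓔.Phi K q (𝓔.eps K q y) = y := by
  obtain ⟨a, ha, c, ⟨e, he, rfl⟩, rfl⟩ := Submodule.mem_sup.1 hy
  rw [map_add, map_add, 𝓔.projF_of_mem_F K ha, projF_Phi, 𝓔.eps_of_mem_F K ha, 𝓔.eps_Phi K he,
    add_zero, zero_add]

variable {S}

open Classical in
/-- The entry in column `u` and degree `q` of the preimage of a chain under the comparison map. -/
def preimage (c : (𝓔.relMixed K).Tot S n) (u : ℤ) (q : ℕ) : CycTensor (𝓔.base K) q :=
  if Even u then 𝓔.projF K q (𝓔.mval K S n (u / 2) q c)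
  else 𝓔.eps K q (𝓔.mval K S n (u / 2) (q + 1) c)

lemma preimage_mem_F (c : (𝓔.relMixed K).Tot S n) (u : ℤ) (q : ℕ) :
    𝓔.preimage K c u q ∈ 𝓔.F K q := by
  unfold preimage
  split_ifs
  exacts [𝓔.projF_mem_F K _, 𝓔.eps_mem_F K _]

lemma preimage_of_notMem (c : (𝓔.relMixed K).Tot S n) {u : ℤ} (hu : u / 2 ∉ S) (q : ℕ) :
    𝓔.preimage K c u q = 0 := by
  unfold preimage
  rw [𝓔.mval_of_notMem K c _ hu, 𝓔.mval_of_notMem K c _ hu, map_zero, map_zero, ite_self]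

/-- Being in the image can be tested on each component, as `Tot` is a direct product: the preimage
is chosen independently in each place. -/
lemma mem_range_Theta {c : (𝓔.relMixed K).Tot S n}
    (hc : ∀ i (q : ℕ), i ∈ S → 2 * i + q = n → 𝓔.mval K S n i q c ∈ 𝓔.imTheta K q) :
    c ∈ LinearMap.range (𝓔.Theta K S n) := by
  -- The entry in position (u, v, w) is the part of `preimage` in column u and degree v + w with w +
  -- 1 entries in M.
  let z : ((𝓔.diagram K).trunc {u | u / 2 ∈ S}).Tot n := fun i =>
    (⟨(⟨𝓔.gradeProj K (i.1.2.1 + i.1.2.2) (i.1.2.2 + 1)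
      (𝓔.preimage K c i.1.1 (i.1.2.1 + i.1.2.2)), 𝓔.gradeProj_mem_X K _ (𝓔.preimage_mem_F K _ _ _)⟩ :
      𝓔.X K (i.1.2.1 + i.1.2.2) i.1.2.2), fun hu => Subtype.ext
        ((congrArg _ (𝓔.preimage_of_notMem K c hu _)).trans
          (map_zero (𝓔.gradeProj K (i.1.2.1 + i.1.2.2) (i.1.2.2 + 1))))⟩ :
      (𝓔.diagram K).truncMod {u | u / 2 ∈ S} i.1.1 i.1.2.1 i.1.2.2)
  have hz : ∀ (u : ℤ) (q : ℕ), u + q = n →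
      𝓔.Fcomp K n u q ((𝓔.diagram K).truncIncl _ n z) = 𝓔.preimage K c u q := by
    intro u q hq
    rw [Fcomp_apply, ← 𝓔.sum_gradeProj_of_mem_F K (𝓔.preimage_mem_F K c u q)]
    refine Finset.sum_congr rfl fun w hw => ?_
    obtain ⟨v, rfl⟩ := Nat.exists_eq_add_of_le' (Nat.lt_succ_iff.1 (Finset.mem_range.1 hw))
    rw [𝓔.zval_eq K _ (show u + v + w = n by push_cast at hq; omega) rfl]
    rfl
  have h0 : ∀ (i : ℤ) (q : ℕ), 𝓔.preimage K c (2 * i) q = 𝓔.projF K q (𝓔.mval K S n i q c) :=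
    fun i q => by rw [preimage, if_pos (even_two_mul i), two_mul_ediv]
  have h1 : ∀ (i : ℤ) (q : ℕ), 𝓔.preimage K c (2 * i + 1) q =
      𝓔.eps K q (𝓔.mval K S n i (q + 1) c) :=
    fun i q => by rw [preimage, if_neg (Int.not_even_two_mul_add_one i), two_mul_add_one_ediv]
  refine ⟨z, mval_ext fun i q hi hq => ?_⟩
  rw [𝓔.mval_Theta K S z hq]
  have hci := hc i q hi hq
  cases q with
  | zero => rw [thetaVal, hz _ _ hq, h0, 𝓔.projF_of_mem_F K hci]
  | succ q =>
    rw [thetaVal, LinearMap.add_apply, LinearMap.comp_apply, hz _ _ hq,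
      hz _ _ (by push_cast at hq; omega), h0, h1, 𝓔.projF_add_Phi_eps K hci]

lemma mval_mem_imTheta {c : (𝓔.relMixed K).Tot S n} (hc : c ∈ LinearMap.range (𝓔.Theta K S n))
    {i : ℤ} {q : ℕ} (hq : 2 * i + q = n) : 𝓔.mval K S n i q c ∈ 𝓔.imTheta K q := by
  obtain ⟨z, rfl⟩ := hc
  rw [𝓔.mval_Theta K S z hq]
  exact 𝓔.thetaVal_mem K _ _ _

/-- The entry in degree `q` of the column `i` of the contracting homotopy applied to `c`. -/
def homotopyVal (c : (𝓔.relMixed K).Tot S n) (i : ℤ) : (q : ℕ) →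
    LinearMap.ker (mapCyc 𝓔.p (𝓔.p_base K) q)
  | 0 => 0
  | q + 1 => ⟨𝓔.Phi K q (𝓔.mval K S n i q c), by
      rw [LinearMap.mem_ker, mapCyc_Phi, mval_mem_ker, map_zero]⟩

/-- The cokernel of the comparison map is acyclic. -/
lemma exists_sub_totD_mem_range_Theta {l : ℤ} (h : m + 1 = n) (h' : n + 1 = l)
    (c : (𝓔.relMixed K).Tot S n)
    (hc : (𝓔.relMixed K).totD S h c ∈ LinearMap.range (𝓔.Theta K S m)) :
    ∃ c' : (𝓔.relMixed K).Tot S l,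
      c - (𝓔.relMixed K).totD S h' c' ∈ LinearMap.range (𝓔.Theta K S n) := by
  -- `Phi` applied in each column. Since B Phi = 0, the total boundary of c' has components ∂ Phi c.
  let c' : (𝓔.relMixed K).Tot S l := fun i => 𝓔.homotopyVal K c i.1.1 i.1.2
  have hc' : ∀ (i : ℤ) (q : ℕ), i ∈ S → 2 * i + q = n →
      𝓔.mval K S l i (q + 1) c' = 𝓔.Phi K q (𝓔.mval K S n i q c) := fun i q hi hq => by
    rw [𝓔.mval_eq K _ ⟨hi, by push_cast; omega⟩]
    rfl
  have hB : ∀ (i : ℤ) (q : ℕ), connes (𝓔.base K) q (𝓔.mval K S l i q c') = 0 := by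
    intro i q
    by_cases h : i ∈ S ∧ 2 * i + q = l
    · rw [𝓔.mval_eq K c' h]
      cases q with
      | zero => exact map_zero _
      | succ q => exact connes_of_mem_unitSpan (𝓔.Phi_mem_unitSpan K _)
    · rw [mval, dif_neg h, LinearMap.zero_apply, map_zero]
  refine ⟨c', 𝓔.mem_range_Theta K fun i q hi hq => ?_⟩
  cases q with
  | zero => exact 𝓔.mem_F_zero K (𝓔.mval_mem_ker K _ _ _)
  | succ q =>
    rw [map_sub, 𝓔.mval_totD_succ K h' _ hi hq, hB, add_zero, hc' i (q + 1) hi hq]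
    have hm : 2 * i + (q : ℤ) = m := by push_cast at hq; omega
    have hD := 𝓔.Phi_mem_imTheta K (𝓔.mval_mem_imTheta K hc hm)
    -- By hypothesis the total boundary of c is in the image, which `Phi` preserves. Since Phi B =
    -- 0, this says that Phi ∂ c is in the image.
    have hb : 𝓔.Phi K q (𝓔.mval K S m i q ((𝓔.relMixed K).totD S h c)) =
        𝓔.Phi K q (hochschild (𝓔.base K) q (𝓔.mval K S n i (q + 1) c)) := by
      cases q with
      | zero => rw [𝓔.mval_totD_zero K h _ hi (by simpa using hm)]
      | succ q =>
        rw [𝓔.mval_totD_succ K h _ hi hm, map_add,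
          𝓔.Phi_of_mem_unitSpan K (connes_mem_unitSpan _ _ _), add_zero]
    rw [hb] at hD
    -- c - ∂ Phi c = Phi ∂ c - (∂ Phi c + Phi ∂ c - c).
    have := sub_mem hD (𝓔.homotopy_mem K (𝓔.mval_mem_ker K c i (q + 1)))
    convert this using 1
    abel

variable (S)

/-- The homology of the columns `i ∈ S` of the relative mixed complex is that of the columns `2i` and
`2i + 1`, `i ∈ S`, of the triple complex. -/
theorem nonempty_homology_equiv (n : ℤ) :
    Nonempty ((𝓔.relMixed K).H S n ≃ₗ[k] ((𝓔.diagram K).trunc {u | u / 2 ∈ S}).H n) :=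
  homology_equiv _ _ ((𝓔.relMixed K).totD S (n := n + 1 + 1) rfl) _ _ (𝓔.Theta K S (n + 1))
    (𝓔.Theta K S n) (𝓔.Theta K S (n - 1)) (𝓔.Theta_totD K S _) (𝓔.Theta_totD K S _)
    (𝓔.mixed_totD_totD K _ _) (𝓔.mixed_totD_totD K _ _) (𝓔.Theta_injective K S)
    (𝓔.Theta_injective K S) (𝓔.exists_sub_totD_mem_range_Theta K _ _)
    (𝓔.exists_sub_totD_mem_range_Theta K _ _)

lemma nonempty_homology_equiv_of_eq {T : Set ℤ} (h : ∀ u, u ∈ T ↔ u / 2 ∈ S) (n : ℤ) :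
    Nonempty ((𝓔.relMixed K).H S n ≃ₗ[k] ((𝓔.diagram K).trunc T).H n) := by
  obtain rfl : T = {u | u / 2 ∈ S} := Set.ext h
  exact 𝓔.nonempty_homology_equiv K S n

/-- Inherited from the mixed complex through the injective comparison map. -/
lemma trunc_univ_totD_totD {l : ℤ} (h : m + 1 = n) (h' : n + 1 = l)
    (z : ((𝓔.diagram K).trunc Set.univ).Tot l) :
    ((𝓔.diagram K).trunc Set.univ).totD h (((𝓔.diagram K).trunc Set.univ).totD h' z) = 0 := by
  refine 𝓔.Theta_injective K Set.univ ?_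
  exact ((𝓔.Theta_totD K Set.univ h _).trans (congrArg _ (𝓔.Theta_totD K Set.univ h' z))).trans
    ((𝓔.mixed_totD_totD K h h' _).trans (map_zero _).symm)

lemma nonempty_trunc_univ_homology_equiv (n : ℤ) :
    Nonempty (((𝓔.diagram K).trunc Set.univ).H n ≃ₗ[k] (𝓔.diagram K).H n) :=
  homology_equiv _ _ (((𝓔.diagram K).trunc Set.univ).totD (n := n + 1 + 1) rfl) _ _
    ((𝓔.diagram K).toTruncUniv (n + 1)) ((𝓔.diagram K).toTruncUniv n)
    ((𝓔.diagram K).toTruncUniv (n - 1)) ((𝓔.diagram K).toTruncUniv_totD _)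
    ((𝓔.diagram K).toTruncUniv_totD _) (𝓔.trunc_univ_totD_totD K _ _)
    (𝓔.trunc_univ_totD_totD K _ _)
    (fun _ _ h => congrArg ((𝓔.diagram K).truncIncl Set.univ n) h)
    (fun _ _ h => congrArg ((𝓔.diagram K).truncIncl Set.univ (n - 1)) h)
    (fun _ _ => ⟨0, (𝓔.diagram K).toTruncUniv_surjective _⟩)
    (fun _ _ => ⟨0, (𝓔.diagram K).toTruncUniv_surjective _⟩)

end comparison

end CleftExtension

end Cleft

end

theorem mainTheorem2 {k A E : Type*} [CommRing k] [Algebra ℚ k] [Ring A] [Algebra k A] [Ring E]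
    [Algebra k E] (𝓔 : Cleft.CleftExtension k A E) (K : Subalgebra k A) :
    (𝓔.diagram K).IsTripleComplex ∧
    ∀ n : ℤ,
      Nonempty ((𝓔.relMixed K).HH n ≃ₗ[k] ((𝓔.diagram K).trunc (Set.Icc 0 1)).H n) ∧
      Nonempty ((𝓔.relMixed K).HC n ≃ₗ[k] ((𝓔.diagram K).trunc (Set.Ici 0)).H n) ∧
      Nonempty ((𝓔.relMixed K).HP n ≃ₗ[k] (𝓔.diagram K).H n) ∧
      Nonempty ((𝓔.relMixed K).HN n ≃ₗ[k] ((𝓔.diagram K).trunc (Set.Iic 1)).H n) := by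
  refine ⟨𝓔.isTripleComplex K, fun n => ⟨?_, ?_, ?_, ?_⟩⟩
  -- In each case only the columns are matched: u / 2 = 0 means 0 ≤ u ≤ 1, u / 2 ≥ 0 means u ≥ 0,
  -- and u / 2 ≤ 0 means u ≤ 1, which is why negative homology needs the column u = 1.
  · exact 𝓔.nonempty_homology_equiv_of_eq K _
      (fun u => by rw [Set.mem_Icc, Set.mem_singleton_iff]; omega) n
  · exact 𝓔.nonempty_homology_equiv_of_eq K _
      (fun u => by rw [Set.mem_Ici, Set.mem_Ici]; omega) n
  · obtain ⟨e⟩ := 𝓔.nonempty_homology_equiv_of_eq K Set.univ (T := Set.univ) (fun u => by simp) n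
    obtain ⟨e'⟩ := 𝓔.nonempty_trunc_univ_homology_equiv K n
    exact ⟨e.trans e'⟩
  · exact 𝓔.nonempty_homology_equiv_of_eq K _
      (fun u => by rw [Set.mem_Iic, Set.mem_Iic]; omega) n
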